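/- **Setting.** Let $n\ge 0$, $p\in(0,1]$, and let $x_1\prec x_2\prec\dots\prec x_n$ be an arbitrary (unknown) linear order of the vertex set $V=\{0,\dots,n-1\}$. The input graph $G=(V,E)$ is the random graph $G(n,p)$ to which the Hamiltonian path $x_1x_2\cdots x_n$ is added: the pairs $\{x_i,x_{i+1}\}$ are always edges, and every other pair is an edge independently with probability $p$. An algorithm knows $n$, $p$ and $G$; it learns about the order only by comparing the endpoints of edges of $G$. The number of comparisons is the number of distinct edges that are compared. **The algorithm StochasticSort** (with an integer constant $c$). Put $q=\max(1,\lceil\log_2(pn)\rceil)$ and $s_i=2^i/p$. All loops over vertices run in the order of the labels $0,\dots,n-1$. *Edge sets.* Let $\alpha\in[1,2]$ satisfy $\prod_{i=1}^q(1-\alpha p/2^i)=1-p$. Independently for each edge $e\in E$ draw indicators $(X_1,\dots,X_q)$, where $X_i$ are independent with $\Pr[X_i=1]=\alpha p/2^i$, conditioned on not all $X_i$ being $0$; put $e$ into $E_i$ iff $X_i=1$. *Levels.* The algorithm maintains sets $L_1\subseteq L_2\subseteq\cdots$, where $L_i$ for $i>q$ consists of all undiscovered vertices. To (re)build $L_i$,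 for each $v\in L_{i+1}$ it compares $v$ with all $u\in L_{i+c}$ such that $uv\in E_i$; if some such $u$ satisfies $u\prec v$, then $v\notin L_i$, and $v$ is recorded as blocked by the last such $u$; otherwise $v\in L_i$ and $v$ is not blocked. Initially $L_q,L_{q-1},\dots,L_1$ are built in this order. *First vertex.* Keep a vertex $v_0$ (initially the vertex $0$) and a set $S$ (initially empty). While $v_0$ has a neighbour $u\notin S$, compare the first such $u$ with $v_0$: if $u\prec v_0$, add $v_0$ to $S$ and replace $v_0$ by $u$; otherwise add $u$ to $S$. At the end $v_0$ is declared to be $x_1$. *Update after discovering $x_\ell$.* Remove $x_\ell$ from all levels. For each $v$ recorded as blocked by $x_\ell$, cancel the record, and starting from the lowest level $L_{i+1}$ containing $v$, compare $v$ with the $u\in L_{i+c}$ such that $uv\in E_i$, one by one, until some $u\prec v$ is found, in which case $v$ is recorded as blocked by $u$; if none is found, add $v$ to $L_i$ and continue in the same way with $i-1$, until $v$ is blocked or in $L_1$. Then, if $i$ is the largest index $\le q$ such that $\ell=\lfloor k s_i/32\rfloor$ for some integer $k$, rebuild $L_i,L_{i-1},\dots,L_1$ in this order. *Next vertex.* Let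 $C$ be the set of neighbours of $x_\ell$ in $L_1$. For $i=1,2,\dots,q+1$, as long as $|C|>1$, compare each $v\in C$ with all its neighbours in $L_i$ and remove from $C$ those $v$ for which some such neighbour $u$ satisfies $u\prec v$. The remaining vertex is declared to be $x_{\ell+1}$. In this way $x_1,\dots,x_{\lceil n/2\rceil}$ are found, and $x_n,x_{n-1},\dots,x_{\lceil n/2\rceil+1}$ are found by the same procedure, with the same sets $E_i$, applied to the reverse order. (For $n\le 1$ no comparison is made.) **Theorem.** There is a constant $c_0$ such that for every fixed integer $c\ge c_0$ there is a constant $K$, depending only on $c$, such that the following holds for all $n$, all $p\in(0,1]$ and every true order $x_1\prec\dots\prec x_n$. 1. StochasticSort always outputs the correct order $x_1,\dots,x_n$ and compares only endpoints of edges: this holds for every graph $G$ that contains the path $x_1x_2\cdots x_n$ and every outcome of the algorithm's random choices. 2. On $G(n,p)$ with the planted path, the expected number of comparisons, over the random graph and the random choices of the algorithm, is at most $K\,n\max(1,\log(pn))$; in particular it is $O(n\log(pn))$ for $pn\ge 2$. -/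

import Mathlib

/-! ### Comparison algorithms as decision trees -/

/-- A comparison algorithm on the vertex set `V` with output in `α`. It learns about the unknown
order only through `query u v`, which is answered by `true` exactly if `u` precedes `v`. -/
inductive Comp (V : Type) (α : Type) : Type
  | done (a : α) : Comp V α
  | query (u v : V) (next : Bool → Comp V α) : Comp V α

namespace Comp

variable {V α β : Type}

def bind : Comp V α → (α → Comp V β) → Comp V β
  | done a, f => f a
  | query u v next, f => query u v fun b => (next b).bind f

instance : Monad (Comp V) where
  pure := done
  bind := bind

/-- Compare two vertices. -/
def ask (u v : V) : Comp V Bool := query u v done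

/-- The output if the true order is `prec`. -/
def output (prec : V → V → Bool) : Comp V α → α
  | done a => a
  | query u v next => (next (prec u v)).output prec

/-- The set of vertex pairs that are compared if the true order is `prec`. -/
def asked [DecidableEq V] (prec : V → V → Bool) : Comp V α → Finset (Sym2 V)
  | done _ => ∅
  | query u v next => insert s(u, v) ((next (prec u v)).asked prec)

/-- The same algorithm, run on the reverse of the true order. -/
def reversed : Comp V α → Comp V α
  | done a => done a
  | query u v next => query v u fun b => (next b).reversed

end Comp

/-! ### The sorting algorithm

In this section `adj` is the adjacency relation of the input graph, `E i` is the `i`-th of the edge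
sets `E 1, …, E q`, `c` is the constant offset between levels, and `sched ℓ` is the highest level
that is rebuilt after the `ℓ`-th vertex has been discovered (`0` if there is none). All loops over
vertices run in the order of the labels `0, …, n - 1`. -/

namespace StochSort

/-- The levels `L i` (`i ≥ 1`; those with `i > q` contain all undiscovered vertices), and for each
vertex the vertex, if any, by which it is recorded to be blocked. -/
structure State (n : ℕ) where
  level : ℕ → Finset (Fin n)
  elim : Fin n → Option (Fin n)

/-- Compare `v` with each member of `us`, and return those members that precede `v`. -/
def predecessors {n : ℕ} (us : List (Fin n)) (v : Fin n) : Comp (Fin n) (List (Fin n)) :=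
  us.filterM fun u => Comp.ask u v

/-- Compare `v` with the members of `us` one by one, until one is found that precedes `v`. -/
def firstPredecessor {n : ℕ} : List (Fin n) → Fin n → Comp (Fin n) (Option (Fin n))
  | [], _ => pure none
  | u :: us, v => do
    if ← Comp.ask u v then pure (some u) else firstPredecessor us v

/-- The vertices `u ∈ L (i + c)` with `(u, v) ∈ E i`: those that can block `v` from level `i`. -/
def potentialBlockers {n : ℕ} (E : ℕ → Fin n → Fin n → Bool) (c i : ℕ) (S : State n) (v : Fin n) :
    List (Fin n) :=
  (List.finRange n).filter fun u => u ∈ S.level (i + c) ∧ E i u v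

/-- Decide from scratch whether `v`, a vertex of level `i + 1`, belongs to level `i`. -/
def rebuildVertex {n : ℕ} (E : ℕ → Fin n → Fin n → Bool) (c i : ℕ) (S : State n) (v : Fin n) :
    Comp (Fin n) (State n) := do
  let blockers ← predecessors (potentialBlockers E c i S v) v
  pure <| match blockers.getLast? with
    | none => { S with elim := Function.update S.elim v none }
    | some u =>
      { level := Function.update S.level i ((S.level i).erase v)
        elim := Function.update S.elim v (some u) }

/-- Rebuild level `i`: start with `L i = L (i + 1)` and remove the blocked vertices. -/
def rebuildLevel {n : ℕ} (E : ℕ → Fin n → Fin n → Bool) (c i : ℕ) (S : State n) :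
    Comp (Fin n) (State n) :=
  ((List.finRange n).filter fun v => v ∈ S.level (i + 1)).foldlM (rebuildVertex E c i)
    { S with level := Function.update S.level i (S.level (i + 1)) }

/-- Rebuild the levels `i, i - 1, …, 1`, in this order. -/
def createLevels {n : ℕ} (E : ℕ → Fin n → Fin n → Bool) (c : ℕ) :
    ℕ → State n → Comp (Fin n) (State n)
  | 0, S => pure S
  | i + 1, S => do createLevels E c i (← rebuildLevel E c (i + 1) S)

/-- Move `v`, whose lowest level is `i`, to lower levels until it is blocked or in level `1`. -/
def advance {n : ℕ} (E : ℕ → Fin n → Fin n → Bool) (c : ℕ) (v : Fin n) :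
    ℕ → State n → Comp (Fin n) (State n)
  | 0, S => pure S
  | 1, S => pure S
  | i + 2, S =>
    firstPredecessor (potentialBlockers E c (i + 1) S v) v >>= fun blocker =>
      match blocker with
      | some u => pure { S with elim := Function.update S.elim v (some u) }
      | none => advance E c v (i + 1)
          { S with level := Function.update S.level (i + 1) (insert v (S.level (i + 1))) }

/-- The lowest level that contains `v` (every undiscovered vertex is in level `q + 1`). -/
def lowestLevel {n : ℕ} (q : ℕ) (S : State n) (v : Fin n) : ℕ :=
  ((List.range' 1 (q + 1)).find? fun i => v ∈ S.level i).getD (q + 1)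

/-- The incremental update after `x` has been discovered: remove `x` from all levels, then let the
vertices that were blocked by `x` advance. -/
def increment {n : ℕ} (E : ℕ → Fin n → Fin n → Bool) (q c : ℕ) (x : Fin n) (S : State n) :
    Comp (Fin n) (State n) :=
  ((List.finRange n).filter fun v => S.elim v = some x).foldlM
    (fun S v => advance E c v (lowestLevel q S v)
      { S with elim := Function.update S.elim v none })
    { S with level := fun i => (S.level i).erase x }

/-- The search for the first vertex: `v₀` is the earliest vertex found so far, and `S` is a set of
vertices known to come after `v₀`. Each round adds one vertex to `S`, so `n` rounds suffice; the
first argument counts the remaining rounds. -/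
def findFirst {n : ℕ} (adj : Fin n → Fin n → Bool) :
    ℕ → Fin n → Finset (Fin n) → Comp (Fin n) (Fin n)
  | 0, v₀, _ => pure v₀
  | k + 1, v₀, S =>
    match (List.finRange n).find? fun u => adj u v₀ ∧ u ∉ S with
    | none => pure v₀
    | some u => do
      if ← Comp.ask u v₀ then findFirst adj k u (insert v₀ S)
      else findFirst adj k v₀ (insert u S)

/-- One round of elimination: query all edges between the candidates and level `i`, and keep the
candidates for which no predecessor shows up. -/
def eliminate {n : ℕ} (adj : Fin n → Fin n → Bool) (i : ℕ) (S : State n) (C : List (Fin n)) :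
    Comp (Fin n) (List (Fin n)) :=
  C.filterM fun v => do
    let us ← predecessors ((List.finRange n).filter fun u => u ∈ S.level i ∧ adj u v) v
    pure us.isEmpty

/-- Go through the given levels until at most one candidate is left. -/
def narrow {n : ℕ} (adj : Fin n → Fin n → Bool) (S : State n) :
    List ℕ → List (Fin n) → Comp (Fin n) (List (Fin n))
  | [], C => pure C
  | i :: is, C => if C.length ≤ 1 then pure C else do narrow adj S is (← eliminate adj i S C)

/-- The search for the successor of `x`, the most recently discovered vertex: the candidates are
the vertices of level `1` that are adjacent to `x`; they are tested against the levels
`1, …, q + 1`. -/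
def findNext {n : ℕ} (adj : Fin n → Fin n → Bool) (q : ℕ) (x : Fin n) (S : State n) :
    Comp (Fin n) (Fin n) := do
  let C ← narrow adj S (List.range' 1 (q + 1))
    ((List.finRange n).filter fun v => v ∈ S.level 1 ∧ adj x v)
  pure (C.headD x)

/-- The main loop, entered when `x` has been discovered as the `ℓ`-th vertex: update the levels,
and find `k` further vertices. Returns the vertices from `x` on. -/
def discover {n : ℕ} (adj : Fin n → Fin n → Bool) (E : ℕ → Fin n → Fin n → Bool) (q c : ℕ)
    (sched : ℕ → ℕ) : ℕ → ℕ → Fin n → State n → Comp (Fin n) (List (Fin n))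
  | k, ℓ, x, S => do
    let S₁ ← increment E q c x S
    let S₂ ← createLevels E c (sched ℓ) S₁
    match k with
    | 0 => pure [x]
    | k + 1 => do
      let y ← findNext adj q x S₂
      let rest ← discover adj E q c sched k (ℓ + 1) y S₂
      pure (x :: rest)

/-- Find the first `m` vertices of the true order. -/
def sortPrefix {n : ℕ} (adj : Fin n → Fin n → Bool) (E : ℕ → Fin n → Fin n → Bool) (q c : ℕ)
    (sched : ℕ → ℕ) (m : ℕ) : Comp (Fin n) (List (Fin n)) :=
  match m, (List.finRange n).head? with
  | k + 1, some v => do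
    let S ← createLevels E c q { level := fun _ => Finset.univ, elim := fun _ => none }
    let x ← findFirst adj n v ∅
    discover adj E q c sched k 1 x S
  | _, _ => pure []

/-- The whole algorithm: find the first half of the order, and find the second half by running the
same procedure on the reverse order. -/
def sortAll {n : ℕ} (adj : Fin n → Fin n → Bool) (E : ℕ → Fin n → Fin n → Bool) (q c : ℕ)
    (sched : ℕ → ℕ) : Comp (Fin n) (List (Fin n)) := do
  let front ← sortPrefix adj E q c sched ((n + 1) / 2)
  let back ← (sortPrefix adj E q c sched (n / 2)).reversed
  pure (front ++ back.reverse)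

noncomputable section

/-! ### Parameters and random choices -/

/-- The number `q` of edge sets: `log₂ (p n)`, rounded up, and at least `1`. -/
def numSets (n : ℕ) (p : unitInterval) : ℕ := max 1 ⌈Real.logb 2 ((p : ℝ) * n)⌉₊

/-- The target size `2 ^ i / p` of level `i`. -/
def targetSize (p : unitInterval) (i : ℕ) : ℝ := 2 ^ i / (p : ℝ)

open Classical in
/-- After the `ℓ`-th discovery the levels `i, …, 1` are rebuilt, where `i ≤ q` is the largest index
such that `ℓ` is a multiple of a 32nd of the target size of level `i` (up to rounding down). -/
def schedule (q : ℕ) (p : unitInterval) (ℓ : ℕ) : ℕ :=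
  ((Finset.Icc 1 q).filter fun i => ∃ k : ℕ, ⌊(k : ℝ) * (targetSize p i / 32)⌋₊ = ℓ).sup id

theorem exists_alpha {q : ℕ} (hq : 1 ≤ q) (p : unitInterval) :
    ∃ a ∈ Set.Icc (1 : ℝ) 2, ∏ i : Fin q, (1 - a * p / 2 ^ (i.val + 1)) = 1 - (p : ℝ) := by
  have hp0 : (0 : ℝ) ≤ p := p.2.1
  have hp1 : (p : ℝ) ≤ 1 := p.2.2
  have hcont : ContinuousOn
      (fun a : ℝ => ∏ i : Fin q, (1 - a * p / 2 ^ (i.val + 1))) (Set.Icc 1 2) := by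
    fun_prop
  refine intermediate_value_Icc' (by norm_num) hcont ⟨?_, ?_⟩
  · obtain ⟨r, rfl⟩ : ∃ r, q = r + 1 := ⟨q - 1, by omega⟩
    simp only [Fin.prod_univ_succ, Fin.val_zero, Fin.val_succ]
    have h : ∏ i : Fin r, (1 - 2 * (p : ℝ) / 2 ^ (i.val + 1 + 1)) ≤ 1 := by
      refine Finset.prod_le_one (fun i _ => ?_) (fun i _ => ?_)
      · rw [sub_nonneg, div_le_one (by positivity)]
        have : (1 : ℝ) ≤ 2 ^ i.val := one_le_pow₀ (by norm_num)
        rw [pow_add, pow_add]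
        linarith
      · have : (0 : ℝ) ≤ 2 * (p : ℝ) / 2 ^ (i.val + 1 + 1) := by positivity
        linarith
    have h2 : (1 : ℝ) - 2 * p / 2 ^ (0 + 1) = 1 - p := by norm_num
    rw [h2]
    exact mul_le_of_le_one_right (by linarith) h
  · have key : ∀ r : ℕ, 1 - (p : ℝ) * (1 - (1 / 2) ^ r) ≤
        ∏ i : Fin r, (1 - 1 * (p : ℝ) / 2 ^ (i.val + 1)) := by
      intro r
      induction r with
      | zero => simp
      | succ r ih =>
        rw [Fin.prod_univ_castSucc]
        simp only [Fin.val_castSucc, Fin.val_last]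
        have hx : (1 : ℝ) * p / 2 ^ (r + 1) = p * ((1 / 2) ^ r / 2) := by
          rw [pow_succ, one_div, inv_pow]; field_simp
        have ht0 : (0 : ℝ) ≤ (1 / 2) ^ r := by positivity
        have ht1 : ((1 : ℝ) / 2) ^ r ≤ 1 := pow_le_one₀ (by norm_num) (by norm_num)
        rw [hx]
        have hf : 0 ≤ 1 - (p : ℝ) * ((1 / 2) ^ r / 2) := by nlinarith
        refine le_trans ?_ (mul_le_mul_of_nonneg_right ih hf)
        rw [pow_succ]
        generalize ((1 : ℝ) / 2) ^ r = t at *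
        nlinarith [mul_nonneg (mul_nonneg hp0 hp0) (mul_nonneg ht0 (sub_nonneg.2 ht1))]
    refine le_trans ?_ (key q)
    have : (0 : ℝ) ≤ (1 / 2) ^ q := by positivity
    nlinarith

open Classical in
/-- The number `α ∈ [1, 2]` with `∏_{i=1}^q (1 - α p / 2 ^ i) = 1 - p`. -/
def alpha (q : ℕ) (p : unitInterval) : ℝ :=
  if h : ∃ a ∈ Set.Icc (1 : ℝ) 2, ∏ i : Fin q, (1 - a * p / 2 ^ (i.val + 1)) = 1 - (p : ℝ)
  then h.choose else 1

theorem alpha_mem (q : ℕ) (p : unitInterval) : alpha q p ∈ Set.Icc (1 : ℝ) 2 := by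
  unfold alpha
  split_ifs with h
  · exact h.choose_spec.1
  · norm_num

theorem prod_alpha {q : ℕ} (hq : 1 ≤ q) (p : unitInterval) :
    ∏ i : Fin q, (1 - alpha q p * p / 2 ^ (i.val + 1)) = 1 - (p : ℝ) := by
  unfold alpha
  rw [dif_pos (exists_alpha hq p)]
  exact (exists_alpha hq p).choose_spec.2

/-- The probability `α p / 2 ^ i` (the index `i : Fin q` stands for the edge set `E (i + 1)`). -/
def setProb (q : ℕ) (p : unitInterval) (i : Fin q) : unitInterval :=
  ⟨alpha q p * p / 2 ^ (i.val + 1), by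
    have h := alpha_mem q p
    have hp0 : (0 : ℝ) ≤ p := p.2.1
    have hp1 : (p : ℝ) ≤ 1 := p.2.2
    have h1 : (1 : ℝ) ≤ 2 ^ i.val := one_le_pow₀ (by norm_num)
    constructor
    · have := h.1
      positivity
    · rw [div_le_one (by positivity), pow_succ]
      nlinarith [h.1, h.2]⟩

open MeasureTheory ProbabilityTheory

/-- The law of independent indicators `X_1, …, X_q`, the `i`-th of which is `1` with probability
`α p / 2 ^ i`, conditioned on at least one of them being `1`. -/
def tupleLaw (q : ℕ) (p : unitInterval) : Measure (Fin q → Bool) :=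
  ProbabilityTheory.cond (Measure.pi fun i => bernoulliMeasure true false (setProb q p i)) {t | ∃ i, t i = true}

/-- The internal random choices of the algorithm: an independent tuple for each vertex pair. Only
the tuples of the pairs that are edges of the input graph are used. -/
def coinLaw (n q : ℕ) (p : unitInterval) : Measure (Sym2 (Fin n) → Fin q → Bool) :=
  Measure.pi fun _ => tupleLaw q p

open Classical in
/-- The edge sets `E 1, …, E q` obtained from the graph and the random tuples: `E i` consists of
the edges of `G` whose tuple has a `1` at position `i`. -/
def edgeSets {n q : ℕ} (G : SimpleGraph (Fin n)) (T : Sym2 (Fin n) → Fin q → Bool) (i : ℕ)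
    (u v : Fin n) : Bool :=
  decide (G.Adj u v ∧ ∃ j : Fin q, j.val + 1 = i ∧ T s(u, v) j = true)

open Classical in
/-- The algorithm, with constant `c`, on the input graph `G` with the random choices `T`. -/
def stochasticSort (c : ℕ) {n : ℕ} (p : unitInterval) (G : SimpleGraph (Fin n))
    (T : Sym2 (Fin n) → Fin (numSets n p) → Bool) : Comp (Fin n) (List (Fin n)) :=
  sortAll (fun u v => decide (G.Adj u v)) (edgeSets G T) (numSets n p) c
    (schedule (numSets n p) p)

/-! ### Instances -/

/-- `u` precedes `v` in the order `x 0, x 1, …, x (n - 1)`. -/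
def precedes {n : ℕ} (x : Equiv.Perm (Fin n)) (u v : Fin n) : Bool :=
  decide (x.symm u < x.symm v)

/-- The Hamiltonian path `x 0, x 1, …, x (n - 1)`. -/
def hamPath {n : ℕ} (x : Equiv.Perm (Fin n)) : SimpleGraph (Fin n) :=
  (SimpleGraph.pathGraph n).map x.toEmbedding

/-- The expected number of comparisons on `G(n, p)` with the planted Hamiltonian path of the true
order `x`, over the random graph and the random choices of the algorithm. -/
def expectedComparisons (c n : ℕ) (p : unitInterval) (x : Equiv.Perm (Fin n)) : ℝ :=
  ∫ ω, (((stochasticSort c p (ω.1 ⊔ hamPath x) ω.2).asked (precedes x)).card : ℝ)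
    ∂((SimpleGraph.binomialRandom (Fin n) p).prod (coinLaw n (numSets n p) p))

end

end StochSort

/-!
The output is correct because of two invariants. Every undiscovered vertex outside level `1` is
blocked by an undiscovered predecessor, so that the next vertex of the order is in level `1`; and
this vertex stays a candidate throughout the search, since it has no undiscovered predecessor.

For the cost, a vertex `v` in level `i` satisfies a condition on the input alone: each undiscovered
predecessor of `v` in an edge set `E k`, where `k ≥ i`, is itself blocked at level `k + c` or above.
As distinct pairs are independent and blockers are plentiful, this has probability at most a
constant times `(σ / (σ + j)) ^ 4` for a vertex `j` positions ahead, where `σ = targetSize p i`. A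
comparison at level `i` moreover requires an edge of `E i`, which off the path costs another factor
of order `1 / σ`. Summing over the pairs, a rebuild of level `i` costs `O(σ)` and happens about
every `σ / 32` discoveries, while the incremental updates cost `O(1)` per level and discovery. In
the search, the candidates decay in the same way from round to round, and each round costs `O(1)`.
There are `q = O(max 1 (log (p * n)))` levels, and only `O(n)` comparisons remain, namely those
along the path and those that find the two ends of the order.
-/

/-! ### Outputs and comparisons of comparison algorithms -/

namespace Comp

variable {V α β σ : Type} {prec : V → V → Bool}

@[simp] theorem output_pure (prec : V → V → Bool) (a : α) :
    (pure a : Comp V α).output prec = a := rfl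

@[simp] theorem output_bind (prec : V → V → Bool) (m : Comp V α) (f : α → Comp V β) :
    (m >>= f).output prec = (f (m.output prec)).output prec := by
  change (m.bind f).output prec = _
  induction m with
  | done a => rfl
  | query u v _ ih => exact ih _

@[simp] theorem output_ask (prec : V → V → Bool) (u v : V) :
    (ask u v).output prec = prec u v := rfl

theorem output_reversed (prec : V → V → Bool) (m : Comp V α) :
    m.reversed.output prec = m.output fun u v => prec v u := by
  induction m with
  | done a => rfl
  | query u v _ ih => exact ih _

theorem output_filterAuxM (prec : V → V → Bool) (f : β → Comp V Bool) (l acc : List β) :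
    (l.filterAuxM f acc).output prec = (l.filter fun b => (f b).output prec).reverse ++ acc := by
  induction l generalizing acc with
  | nil => rfl
  | cons b l ih =>
    simp only [List.filterAuxM, output_bind, ih, List.filter_cons]
    cases (f b).output prec <;> simp

@[simp] theorem output_filterM (prec : V → V → Bool) (f : β → Comp V Bool) (l : List β) :
    (l.filterM f).output prec = l.filter fun b => (f b).output prec := by
  simp [List.filterM, output_filterAuxM]

variable [DecidableEq V]

@[simp] theorem asked_pure (prec : V → V → Bool) (a : α) :
    (pure a : Comp V α).asked prec = ∅ := rfl

@[simp] theorem asked_bind (prec : V → V → Bool) (m : Comp V α) (f : α → Comp V β) :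
    (m >>= f).asked prec = m.asked prec ∪ (f (m.output prec)).asked prec := by
  change (m.bind f).asked prec = _
  induction m with
  | done a => exact (Finset.empty_union _).symm
  | query u v _ ih =>
    change insert _ _ = insert _ _ ∪ _
    rw [Finset.insert_union]
    exact congrArg _ (ih _)

@[simp] theorem asked_ask (prec : V → V → Bool) (u v : V) :
    (ask u v).asked prec = {s(u, v)} := rfl

theorem asked_reversed (prec : V → V → Bool) (m : Comp V α) :
    m.reversed.asked prec = m.asked fun u v => prec v u := by
  induction m with
  | done a => rfl
  | query u v _ ih =>
    change insert s(v, u) _ = insert s(u, v) _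
    rw [Sym2.eq_swap]
    exact congrArg _ (ih _)

theorem mem_asked_filterAuxM {f : β → Comp V Bool} {l acc : List β} {e : Sym2 V} :
    e ∈ (l.filterAuxM f acc).asked prec ↔ ∃ b ∈ l, e ∈ (f b).asked prec := by
  induction l generalizing acc with
  | nil => simp [List.filterAuxM]
  | cons b l ih => simp [List.filterAuxM, ih]

theorem mem_asked_filterM {f : β → Comp V Bool} {l : List β} {e : Sym2 V} :
    e ∈ (l.filterM f).asked prec ↔ ∃ b ∈ l, e ∈ (f b).asked prec := by
  simp [List.filterM, mem_asked_filterAuxM]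

/-- The judgement of a program logic for comparison algorithms: if the true order is `prec`, then
all pairs that `m` compares satisfy `A`, and the output of `m` satisfies `P`. -/
structure Spec (prec : V → V → Bool) (m : Comp V α) (A : Sym2 V → Prop) (P : α → Prop) : Prop where
  asked : ∀ e ∈ m.asked prec, A e
  output : P (m.output prec)

namespace Spec

variable {m : Comp V α} {A A' : Sym2 V → Prop} {P P' : α → Prop}

theorem pure {a : α} (ha : P a) : Spec prec (pure a) A P := ⟨by simp, ha⟩

theorem ask {u v : V} (h : A s(u, v)) : Spec prec (ask u v) A (· = prec u v) :=
  ⟨by simpa using h, rfl⟩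

theorem bind {f : α → Comp V β} {Q : β → Prop} (hm : Spec prec m A P)
    (hf : ∀ a, P a → Spec prec (f a) A Q) : Spec prec (m >>= f) A Q := by
  have hf := hf _ hm.output
  refine ⟨fun e he => ?_, by simpa using hf.output⟩
  rw [asked_bind, Finset.mem_union] at he
  exact he.elim (hm.asked e) (hf.asked e)

theorem mono (hm : Spec prec m A P) (hA : ∀ e, A e → A' e) (hP : ∀ a, P a → P' a) :
    Spec prec m A' P' :=
  ⟨fun e he => hA e (hm.asked e he), hP _ hm.output⟩

/-- The rule for loops: `I l s` is an invariant, where `l` is the list of remaining items. -/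
theorem foldlM {f : σ → β → Comp V σ} {I : List β → σ → Prop}
    (hf : ∀ b l s, I (b :: l) s → Spec prec (f s b) A (I l)) {l : List β} {s : σ} (hs : I l s) :
    Spec prec (l.foldlM f s) A (I []) := by
  induction l generalizing s with
  | nil => exact pure hs
  | cons b l ih => exact (hf b l s hs).bind fun _ => ih

end Spec

end Comp

namespace StochSort

variable {n : ℕ}

section primitives

variable {prec : Fin n → Fin n → Bool} {us : List (Fin n)} {v : Fin n} {e : Sym2 (Fin n)}

theorem output_predecessors (prec : Fin n → Fin n → Bool) (us : List (Fin n)) (v : Fin n) :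
    (predecessors us v).output prec = us.filter fun u => prec u v := by
  simp [predecessors]

theorem mem_asked_predecessors :
    e ∈ (predecessors us v).asked prec ↔ ∃ u ∈ us, e = s(u, v) := by
  simp [predecessors, Comp.mem_asked_filterM]

theorem output_firstPredecessor (prec : Fin n → Fin n → Bool) (us : List (Fin n)) (v : Fin n) :
    (firstPredecessor us v).output prec = us.find? fun u => prec u v := by
  induction us with
  | nil => rfl
  | cons u us ih => cases h : prec u v <;> simp [firstPredecessor, h, ih]

theorem mem_asked_firstPredecessor (he : e ∈ (firstPredecessor us v).asked prec) :
    ∃ u ∈ us, e = s(u, v) := by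
  induction us with
  | nil => simp [firstPredecessor] at he
  | cons u us ih =>
    cases h : prec u v
    · simp only [firstPredecessor, Comp.asked_bind, Comp.output_ask, Comp.asked_ask, h,
        Finset.mem_union, Finset.mem_singleton] at he
      rcases he with rfl | he
      · exact ⟨u, by simp, rfl⟩
      · obtain ⟨w, hw, rfl⟩ := ih (by simpa using he)
        exact ⟨w, by simp [hw], rfl⟩
    · exact ⟨u, by simp, by simpa [firstPredecessor, h] using he⟩

theorem mem_potentialBlockers {E : ℕ → Fin n → Fin n → Bool} {c i : ℕ} {S : State n} {u : Fin n} :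
    u ∈ potentialBlockers E c i S v ↔ u ∈ S.level (i + c) ∧ E i u v = true := by
  simp [potentialBlockers]

end primitives

/-- The position of `v` in the order `x 0, x 1, …, x (n - 1)`, counted from `0`. -/
def pos (x : Equiv.Perm (Fin n)) (v : Fin n) : ℕ := (x.symm v : ℕ)

theorem precedes_eq_true {x : Equiv.Perm (Fin n)} {u v : Fin n} :
    precedes x u v = true ↔ pos x u < pos x v := by
  simp [precedes, pos]

theorem pos_injective (x : Equiv.Perm (Fin n)) : Function.Injective (pos x) :=
  Fin.val_injective.comp x.symm.injective

theorem pos_lt (x : Equiv.Perm (Fin n)) (v : Fin n) : pos x v < n := (x.symm v).isLt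

theorem exists_pos_eq (x : Equiv.Perm (Fin n)) {k : ℕ} (hk : k < n) : ∃ v, pos x v = k :=
  ⟨x ⟨k, hk⟩, by simp [pos]⟩

/-! ### The levels -/

section Levels

section invariant

variable (x : Equiv.Perm (Fin n)) (E : ℕ → Fin n → Fin n → Bool) (q c : ℕ)

/-- One of the edge sets `E i, …, E q` joins `v` to a predecessor whose position is at least `r`. -/
def HasBlocker (i r : ℕ) (v : Fin n) : Prop :=
  ∃ k u, i ≤ k ∧ k ≤ q ∧ r ≤ pos x u ∧ pos x u < pos x v ∧ E k u v = true

/-- The condition that membership of `v` in level `k` is certain to guarantee after `ℓ`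
discoveries: every undiscovered predecessor in `E k` may itself be missing from level `k + c`. Here
`R k` bounds the time of the last rebuild of level `k` from below, so that the vertex that keeps
the predecessor out of level `k + c` was still undiscovered then. -/
def UnblockedAt (R : ℕ → ℕ) (ℓ k : ℕ) (v : Fin n) : Prop :=
  ∀ u, ℓ ≤ pos x u → pos x u < pos x v → E k u v = true → HasBlocker x E q (k + c) (R k) u

/-- The vertex `v` satisfies the necessary condition for membership in each of the levels
`i, …, q`. -/
def Unblocked (R : ℕ → ℕ) (ℓ i : ℕ) (v : Fin n) : Prop :=
  ∀ k, i ≤ k → k ≤ q → UnblockedAt x E q c R ℓ k v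

/-- The part of the invariant that concerns the levels from `b` on, after `ℓ` discoveries. -/
structure LevelInv (R : ℕ → ℕ) (b ℓ : ℕ) (S : State n) : Prop where
  mono : ∀ i, b ≤ i → S.level i ⊆ S.level (i + 1)
  top : ∀ i, q < i → ∀ v, v ∈ S.level i ↔ ℓ ≤ pos x v
  elim_lt : ∀ v u, S.elim v = some u → pos x u < pos x v
  unblocked : ∀ k, b ≤ k → k ≤ q → ∀ v ∈ S.level k, UnblockedAt x E q c R ℓ k v

/-- The vertex `u`, one of the last `n - ℓ`, is recorded to block `v`, and it keeps `v` out of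
level `k`, which is at least `b`. -/
structure BlockRecord (b ℓ : ℕ) (S : State n) (v u : Fin n) (k : ℕ) : Prop where
  elim_eq : S.elim v = some u
  le_pos : ℓ ≤ pos x u
  pos_lt : pos x u < pos x v
  le_level : b ≤ k
  level_le : k ≤ q
  edge : E k u v = true
  mem_succ : v ∈ S.level (k + 1)
  notMem : v ∉ S.level k

/-- The vertex `v` is in level `b`, or a recorded vertex keeps it out of some level. -/
def Recorded (b ℓ : ℕ) (S : State n) (v : Fin n) : Prop :=
  v ∈ S.level b ∨ ∃ u k, BlockRecord x E q b ℓ S v u k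

/-- The invariant of the algorithm for the levels from `b` on, after `ℓ` discoveries. -/
structure Inv (R : ℕ → ℕ) (b ℓ : ℕ) (S : State n) : Prop where
  levels : LevelInv x E q c R b ℓ S
  recorded : ∀ v, ℓ ≤ pos x v → Recorded x E q b ℓ S v

/-- A pair that may be compared in order to decide whether `v` belongs to level `i`. -/
def TestPair (R : ℕ → ℕ) (ℓ i : ℕ) (v : Fin n) (e : Sym2 (Fin n)) : Prop :=
  ∃ u, e = s(u, v) ∧ E i u v = true ∧ ℓ ≤ pos x u ∧ ℓ ≤ pos x v ∧
    Unblocked x E q c R ℓ (i + c) u ∧ Unblocked x E q c R ℓ (i + c) v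

/-- A pair that may be compared while level `i` is rebuilt. -/
def RebuildPair (R : ℕ → ℕ) (ℓ i : ℕ) (e : Sym2 (Fin n)) : Prop :=
  ∃ v, TestPair x E q c R ℓ i v e

/-- A pair that may be compared at level `i` by the incremental update after the `ℓ`-th
discovery: it tests a vertex `v` that the vertex `y` discovered last may have blocked. -/
def AdvancePair (R : ℕ → ℕ) (ℓ i : ℕ) (e : Sym2 (Fin n)) : Prop :=
  ∃ v, TestPair x E q c R ℓ i v e ∧ ∃ y k, pos x y + 1 = ℓ ∧ i ≤ k ∧ k ≤ q ∧ E k y v = true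

/-- The state `S` of the loop that rebuilds level `i` from the state `S₀`, when the vertices `l` are
still to be treated. -/
structure RebuildInv (i : ℕ) (S₀ : State n) (l : List (Fin n)) (S : State n) : Prop where
  nodup : l.Nodup
  mem_above : ∀ v ∈ l, v ∈ S₀.level (i + 1)
  level_ne : ∀ k, k ≠ i → S.level k = S₀.level k
  subset : S.level i ⊆ S₀.level (i + 1)
  pending : ∀ v ∈ l, v ∈ S.level i
  not_blocked : ∀ v ∈ S.level i, v ∉ l → ∀ u ∈ S₀.level (i + c), E i u v = true →
    ¬ pos x u < pos x v
  blocked : ∀ v ∈ S₀.level (i + 1), v ∉ S.level i → ∃ u ∈ S₀.level (i + c), E i u v = true ∧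
    pos x u < pos x v ∧ S.elim v = some u
  elim_eq : ∀ v, v ∉ S₀.level (i + 1) → S.elim v = S₀.elim v
  elim_lt : ∀ v u, S.elim v = some u → pos x u < pos x v

/-- The state `S` of the loop of the incremental update after the discovery of `y` at position `ℓ`,
when the records of the vertices `l` still name `y`. -/
structure IncrementInv (R : ℕ → ℕ) (ℓ : ℕ) (y : Fin n) (l : List (Fin n)) (S : State n) :
    Prop where
  levels : LevelInv x E q c R 1 (ℓ + 1) S
  nodup : l.Nodup
  elim_eq : ∀ v ∈ l, S.elim v = some y
  recorded_old : ∀ v, ℓ + 1 ≤ pos x v → Recorded x E q 1 ℓ S v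
  recorded : ∀ v, ℓ + 1 ≤ pos x v → v ∉ l → Recorded x E q 1 (ℓ + 1) S v

end invariant

variable {x : Equiv.Perm (Fin n)} {E : ℕ → Fin n → Fin n → Bool} {q c b b' ℓ ℓ' ℓ₀ r r' : ℕ}
  {R R' : ℕ → ℕ} {S S₀ S' : State n} {i j k : ℕ} {u v w y : Fin n} {l : List (Fin n)}
  {e : Sym2 (Fin n)}

theorem HasBlocker.mono_right (h : HasBlocker x E q i r v) (hr : r' ≤ r) :
    HasBlocker x E q i r' v :=
  let ⟨k, u, hik, hkq, hru, h⟩ := h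
  ⟨k, u, hik, hkq, hr.trans hru, h⟩

theorem Unblocked.mono (h : Unblocked x E q c R ℓ i v) (hR : ∀ k, R' k ≤ R k) (hij : i ≤ j) :
    Unblocked x E q c R' ℓ j v :=
  fun k hjk hkq u hℓ hu hE => (h k (hij.trans hjk) hkq u hℓ hu hE).mono_right (hR k)

namespace BlockRecord

theorem congr (h : BlockRecord x E q b ℓ S v u k) (hb : b' ≤ k) (hℓ : ℓ' ≤ pos x u)
    (helim : S'.elim v = S.elim v) (hlevel : ∀ j, k ≤ j → (v ∈ S'.level j ↔ v ∈ S.level j)) :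
    BlockRecord x E q b' ℓ' S' v u k :=
  { h with
    elim_eq := helim.trans h.elim_eq
    le_pos := hℓ
    le_level := hb
    mem_succ := (hlevel _ k.le_succ).2 h.mem_succ
    notMem := fun hv => h.notMem ((hlevel _ le_rfl).1 hv) }

end BlockRecord

namespace LevelInv

theorem subset (h : LevelInv x E q c R b ℓ S) (hi : b ≤ i) (hij : i ≤ j) :
    S.level i ⊆ S.level j := by
  induction j, hij using Nat.le_induction with
  | base => exact subset_rfl
  | succ j hij ih => exact ih.trans (h.mono j (hi.trans hij))

theorem le_pos (h : LevelInv x E q c R b ℓ S) (hi : b ≤ i) (hv : v ∈ S.level i) :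
    ℓ ≤ pos x v :=
  (h.top (max i (q + 1)) (by omega) v).1 (h.subset hi (le_max_left _ _) hv)

theorem unblocked_of_mem (h : LevelInv x E q c R b ℓ S) (hi : b ≤ i) (hv : v ∈ S.level i) :
    Unblocked x E q c R ℓ i v :=
  fun k hik hkq => h.unblocked k (hi.trans hik) hkq v (h.subset hi hik hv)

theorem testPair (h : LevelInv x E q c R b ℓ S) (hi : b ≤ i + c) (hu : u ∈ S.level (i + c))
    (hv : v ∈ S.level (i + c)) (hE : E i u v = true) : TestPair x E q c R ℓ i v s(u, v) :=
  ⟨u, rfl, hE, h.le_pos hi hu, h.le_pos hi hv, h.unblocked_of_mem hi hu,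
    h.unblocked_of_mem hi hv⟩

theorem mem_of_recorded (h : LevelInv x E q c R b ℓ S) (hr : Recorded x E q b ℓ₀ S v)
    (hi : b ≤ i) (hℓ : r ≤ ℓ₀) (hv : ¬ HasBlocker x E q i r v) : v ∈ S.level i := by
  rcases hr with hb | ⟨u, k, hu⟩
  · exact h.subset le_rfl hi hb
  · have hki : k < i := by
      by_contra! hik
      exact hv ⟨k, u, hik, hu.level_le, hℓ.trans hu.le_pos, hu.pos_lt, hu.edge⟩
    exact h.subset (hu.le_level.trans k.le_succ) hki hu.mem_succ

theorem unblockedAt_of_forall_not (h : LevelInv x E q c R b ℓ S) (hi : b ≤ i + c)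
    (hR : R i ≤ ℓ₀) (hrec : ∀ u, ℓ ≤ pos x u → pos x u < pos x v → Recorded x E q b ℓ₀ S u)
    (hv : ∀ u ∈ S.level (i + c), E i u v = true → ¬ pos x u < pos x v) :
    UnblockedAt x E q c R ℓ i v := by
  intro u hℓ hlt hE
  by_contra hu
  exact hv u (h.mem_of_recorded (hrec u hℓ hlt) hi hR hu) hE hlt

theorem update_elim (h : LevelInv x E q c R b ℓ S) {o : Option (Fin n)}
    (ho : ∀ u, o = some u → pos x u < pos x v) :
    LevelInv x E q c R b ℓ { S with elim := Function.update S.elim v o } :=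
  { h with
    elim_lt := (Function.forall_update_iff S.elim
      fun w o => ∀ u, o = some u → pos x u < pos x w).2 ⟨ho, fun w _ => h.elim_lt w⟩ }

theorem insert (h : LevelInv x E q c R b ℓ S) (hi : i ≤ q) (hv : v ∈ S.level (i + 1))
    (hun : UnblockedAt x E q c R ℓ i v) :
    LevelInv x E q c R b ℓ
      { S with level := Function.update S.level i (insert v (S.level i)) } where
  mono k hk := by
    rcases eq_or_ne k i with rfl | hki
    · simpa [Finset.insert_subset_iff, hv] using h.mono k hk
    rcases eq_or_ne (k + 1) i with rfl | hki'
    · simpa using (h.mono k hk).trans (Finset.subset_insert _ _)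
    · simpa [Function.update_of_ne hki, Function.update_of_ne hki'] using h.mono k hk
  top k hk w := by
    simpa only [Function.update_of_ne (show k ≠ i by omega)] using h.top k hk w
  elim_lt := h.elim_lt
  unblocked k hk hkq w hw := by
    rcases eq_or_ne k i with rfl | hki
    · simp only [Function.update_self, Finset.mem_insert] at hw
      rcases hw with rfl | hw
      · exact hun
      · exact h.unblocked k hk hkq w hw
    · simp only [Function.update_of_ne hki] at hw
      exact h.unblocked k hk hkq w hw

end LevelInv

theorem Recorded.mono_right (h : Recorded x E q b ℓ S v) (hℓ : ℓ' ≤ ℓ) :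
    Recorded x E q b ℓ' S v :=
  h.imp_right fun ⟨u, k, hu⟩ => ⟨u, k, { hu with le_pos := hℓ.trans hu.le_pos }⟩

theorem Inv.weaken (h : Inv x E q c R 1 ℓ S) (hb : 1 ≤ b) (hR : ∀ k, b ≤ k → R' k = R k) :
    Inv x E q c R' b ℓ S where
  levels :=
    { mono := fun i hi => h.levels.mono i (hb.trans hi)
      top := h.levels.top
      elim_lt := h.levels.elim_lt
      unblocked := fun k hk => by
        unfold UnblockedAt
        rw [hR k hk]
        exact h.levels.unblocked k (hb.trans hk) }
  recorded v hv := by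
    rcases h.recorded v hv with h1 | ⟨u, k, hu⟩
    · exact Or.inl (h.levels.subset le_rfl hb h1)
    rcases le_or_gt b k with hbk | hkb
    · exact Or.inr ⟨u, k, { hu with le_level := hbk }⟩
    · exact Or.inl (h.levels.subset (hu.le_level.trans k.le_succ) hkb hu.mem_succ)

theorem inv_init : Inv x E q c R (q + 1) 0 { level := fun _ => Finset.univ, elim := fun _ => none }
    where
  levels :=
    { mono := fun _ _ => subset_rfl
      top := by simp
      elim_lt := by simp
      unblocked := fun k hk hkq => by omega }
  recorded := fun v _ => Or.inl (Finset.mem_univ v)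

namespace RebuildInv

theorem init (h : LevelInv x E q c R (i + 1) ℓ S) :
    RebuildInv x E c i S ((List.finRange n).filter fun v => v ∈ S.level (i + 1))
      { S with level := Function.update S.level i (S.level (i + 1)) } where
  nodup := (List.nodup_finRange n).filter _
  mem_above := by simp
  level_ne k hk := Function.update_of_ne hk _ _
  subset := by simp
  pending := by simp
  not_blocked v hv hvl := by simp_all
  blocked v hv hvS := by simp_all
  elim_eq _ _ := rfl
  elim_lt := h.elim_lt

theorem keep (h : RebuildInv x E c i S₀ (v :: l) S)
    (hv : ∀ u ∈ S₀.level (i + c), E i u v = true → ¬ pos x u < pos x v) :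
    RebuildInv x E c i S₀ l { S with elim := Function.update S.elim v none } where
  nodup := (List.nodup_cons.1 h.nodup).2
  mem_above w hw := h.mem_above w (List.mem_cons_of_mem v hw)
  level_ne := h.level_ne
  subset := h.subset
  pending w hw := h.pending w (List.mem_cons_of_mem v hw)
  not_blocked w hw hwl := by
    rcases eq_or_ne w v with rfl | hwv
    · exact hv
    · exact h.not_blocked w hw (by simp [hwv, hwl])
  blocked w hw hwS := by
    have hwv : w ≠ v := fun hwv => hwS (hwv ▸ h.pending v List.mem_cons_self)
    simpa [Function.update_of_ne hwv] using h.blocked w hw hwS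
  elim_eq w hw := by
    have hwv : w ≠ v := fun hwv => hw (hwv ▸ h.mem_above v List.mem_cons_self)
    simpa [Function.update_of_ne hwv] using h.elim_eq w hw
  elim_lt := (Function.forall_update_iff S.elim
    fun w o => ∀ u, o = some u → pos x u < pos x w).2 ⟨by simp, fun w _ => h.elim_lt w⟩

theorem remove (h : RebuildInv x E c i S₀ (v :: l) S) (hu : u ∈ S₀.level (i + c))
    (hE : E i u v = true) (huv : pos x u < pos x v) :
    RebuildInv x E c i S₀ l
      { level := Function.update S.level i ((S.level i).erase v)
        elim := Function.update S.elim v (some u) } where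
  nodup := (List.nodup_cons.1 h.nodup).2
  mem_above w hw := h.mem_above w (List.mem_cons_of_mem v hw)
  level_ne k hk := (Function.update_of_ne hk _ _).trans (h.level_ne k hk)
  subset := by simpa using (Finset.erase_subset _ _).trans h.subset
  pending w hw := by
    have hwv : w ≠ v := fun hwv => (List.nodup_cons.1 h.nodup).1 (hwv ▸ hw)
    simpa [hwv] using h.pending w (List.mem_cons_of_mem v hw)
  not_blocked w hw hwl := by
    simp only [Function.update_self, Finset.mem_erase] at hw
    exact h.not_blocked w hw.2 (by simp [hw.1, hwl])
  blocked w hw hwS := by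
    rcases eq_or_ne w v with rfl | hwv
    · exact ⟨u, hu, hE, huv, Function.update_self ..⟩
    · simpa [Function.update_of_ne hwv] using h.blocked w hw (by simpa [hwv] using hwS)
  elim_eq w hw := by
    have hwv : w ≠ v := fun hwv => hw (hwv ▸ h.mem_above v List.mem_cons_self)
    simpa [Function.update_of_ne hwv] using h.elim_eq w hw
  elim_lt := (Function.forall_update_iff S.elim
    fun w o => ∀ u, o = some u → pos x u < pos x w).2 ⟨by simpa using huv, fun w _ => h.elim_lt w⟩

theorem levelInv (hS : RebuildInv x E c i S₀ [] S) (hc : 1 ≤ c) (hiq : i ≤ q) (hR : R i ≤ ℓ)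
    (h : Inv x E q c R (i + 1) ℓ S₀) : LevelInv x E q c R i ℓ S where
  mono k hk := by
    rcases hk.eq_or_lt with rfl | hk
    · rw [hS.level_ne _ i.succ_ne_self]
      exact hS.subset
    · rw [hS.level_ne _ hk.ne', hS.level_ne _ (by omega)]
      exact h.levels.mono k hk
  top k hk v := by
    rw [hS.level_ne _ (by omega)]
    exact h.levels.top k hk v
  elim_lt := hS.elim_lt
  unblocked k hk hkq v hv := by
    rcases hk.eq_or_lt with rfl | hk
    · exact h.levels.unblockedAt_of_forall_not (by omega) hR (fun u hu _ => h.recorded u hu)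
        (hS.not_blocked v hv (by simp))
    · rw [hS.level_ne _ hk.ne'] at hv
      exact h.levels.unblocked k hk hkq v hv

theorem recorded (hS : RebuildInv x E c i S₀ [] S) (hc : 1 ≤ c) (hiq : i ≤ q)
    (h : Inv x E q c R (i + 1) ℓ S₀) (hv : ℓ ≤ pos x v) : Recorded x E q i ℓ S v := by
  by_cases hvi : v ∈ S.level i
  · exact Or.inl hvi
  refine Or.inr ?_
  by_cases hv1 : v ∈ S₀.level (i + 1)
  · obtain ⟨u, hu, hE, hlt, hel⟩ := hS.blocked v hv1 hvi
    rw [← hS.level_ne _ i.succ_ne_self] at hv1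
    exact ⟨u, i, hel, h.levels.le_pos (by omega) hu, hlt, le_rfl, hiq, hE, hv1, hvi⟩
  · obtain ⟨u, k, hu⟩ := (h.recorded v hv).resolve_left hv1
    have hik : i < k := hu.le_level
    exact ⟨u, k, hu.congr hik.le hu.le_pos (hS.elim_eq v hv1) fun j hkj => by
      rw [hS.level_ne _ (by omega)]⟩

end RebuildInv

theorem rebuildVertex_spec (hc : 1 ≤ c) (h : LevelInv x E q c R (i + 1) ℓ S₀)
    (hS : RebuildInv x E c i S₀ (v :: l) S) :
    Comp.Spec (precedes x) (rebuildVertex E c i S v) (RebuildPair x E q c R ℓ i)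
      (RebuildInv x E c i S₀ l) := by
  have hlev : S.level (i + c) = S₀.level (i + c) := hS.level_ne _ (by omega)
  constructor
  · intro e he
    simp only [rebuildVertex, Comp.asked_bind, Comp.asked_pure, Finset.union_empty,
      mem_asked_predecessors, mem_potentialBlockers, hlev] at he
    obtain ⟨u, ⟨hu, hE⟩, rfl⟩ := he
    have hv : v ∈ S₀.level (i + c) :=
      h.subset le_rfl (by omega) (hS.mem_above v List.mem_cons_self)
    exact ⟨v, h.testPair (by omega) hu hv hE⟩
  · simp only [rebuildVertex, Comp.output_bind, output_predecessors, Comp.output_pure]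
    cases hlast : ((potentialBlockers E c i S v).filter fun u => precedes x u v).getLast? with
    | none =>
      rw [List.getLast?_eq_none_iff, List.filter_eq_nil_iff] at hlast
      refine hS.keep fun u hu hE hlt => hlast u ?_ (precedes_eq_true.2 hlt)
      exact mem_potentialBlockers.2 ⟨hlev ▸ hu, hE⟩
    | some u =>
      have hu := List.mem_of_getLast? hlast
      rw [List.mem_filter, mem_potentialBlockers, precedes_eq_true, hlev] at hu
      exact hS.remove hu.1.1 hu.1.2 hu.2

theorem rebuildLevel_spec (hc : 1 ≤ c) (hiq : i ≤ q) (hR : R i ≤ ℓ)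
    (h : Inv x E q c R (i + 1) ℓ S) :
    Comp.Spec (precedes x) (rebuildLevel E c i S) (RebuildPair x E q c R ℓ i)
      (Inv x E q c R i ℓ) :=
  (Comp.Spec.foldlM (fun _ _ _ => rebuildVertex_spec hc h.levels) (.init h.levels)).mono
    (fun _ => id) fun _ hS => ⟨hS.levelInv hc hiq hR h, fun _ => hS.recorded hc hiq h⟩

theorem createLevels_spec (hc : 1 ≤ c) (hiq : i ≤ q) (hR : ∀ k, 1 ≤ k → k ≤ i → R k ≤ ℓ)
    (h : Inv x E q c R (i + 1) ℓ S) :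
    Comp.Spec (precedes x) (createLevels E c i S)
      (fun e => ∃ k, 1 ≤ k ∧ k ≤ i ∧ RebuildPair x E q c R ℓ k e) (Inv x E q c R 1 ℓ) := by
  induction i generalizing S with
  | zero => exact .pure h
  | succ i ih =>
    refine ((rebuildLevel_spec hc hiq (hR _ (by omega) le_rfl) h).mono
      (fun e he => ⟨i + 1, by omega, le_rfl, he⟩) fun _ => id).bind fun S' hS' => ?_
    exact (ih (by omega) (fun k hk hki => hR k hk (by omega)) hS').mono
      (fun e ⟨k, hk, hki, he⟩ => ⟨k, hk, by omega, he⟩) fun _ => id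

/-- The states `S` and `S'` differ at most in what they record about `v`. -/
def AgreeExcept (v : Fin n) (S S' : State n) : Prop :=
  ∀ w, w ≠ v → (∀ k, w ∈ S'.level k ↔ w ∈ S.level k) ∧ S'.elim w = S.elim w

namespace AgreeExcept

theorem refl (v : Fin n) (S : State n) : AgreeExcept v S S := fun _ _ => ⟨fun _ => Iff.rfl, rfl⟩

theorem trans {S₁ S₂ S₃ : State n} (h₁ : AgreeExcept v S₁ S₂) (h₂ : AgreeExcept v S₂ S₃) :
    AgreeExcept v S₁ S₃ := fun w hw =>
  ⟨fun k => ((h₂ w hw).1 k).trans ((h₁ w hw).1 k), (h₂ w hw).2.trans (h₁ w hw).2⟩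

theorem update_elim (v : Fin n) (S : State n) (o : Option (Fin n)) :
    AgreeExcept v S { S with elim := Function.update S.elim v o } :=
  fun _ hw => ⟨fun _ => Iff.rfl, Function.update_of_ne hw _ _⟩

theorem insert (v : Fin n) (S : State n) (i : ℕ) :
    AgreeExcept v S { S with level := Function.update S.level i (insert v (S.level i)) } := by
  refine fun w hw => ⟨fun k => ?_, rfl⟩
  rcases eq_or_ne k i with rfl | hk
  · simp [hw]
  · simp only [Function.update_of_ne hk]

theorem recorded (h : AgreeExcept v S S') (hw : w ≠ v) (hr : Recorded x E q b ℓ S w) :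
    Recorded x E q b ℓ S' w :=
  hr.imp ((h w hw).1 b).2 fun ⟨u, k, hu⟩ =>
    ⟨u, k, hu.congr hu.le_level hu.le_pos (h w hw).2 fun j _ => (h w hw).1 j⟩

end AgreeExcept

/-- Among the levels `1, 2, …`, the lowest one that contains `v` is level `i`. -/
structure IsLowestLevel (S : State n) (v : Fin n) (i : ℕ) : Prop where
  one_le : 1 ≤ i
  mem : v ∈ S.level i
  notMem : ∀ k, 1 ≤ k → k < i → v ∉ S.level k

theorem IsLowestLevel.lowestLevel_eq (h : IsLowestLevel S v i) (hiq : i ≤ q + 1) :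
    lowestLevel q S v = i := by
  have hi := h.one_le
  have hsplit : List.range' 1 (q + 1) =
      List.range' 1 (i - 1) ++ i :: List.range' (i + 1) (q + 1 - i) := by
    rw [← List.range'_succ, show q + 1 = (i - 1) + (q + 1 - i + 1) by omega,
      ← List.range'_append_1]
    congr 2 <;> omega
  have hfind : (List.range' 1 (q + 1)).find? (fun i => decide (v ∈ S.level i)) = some i := by
    rw [List.find?_eq_some_iff_append]
    refine ⟨by simpa using h.mem, _, _, hsplit, fun k hk => ?_⟩
    rw [List.mem_range'_1] at hk
    simpa using h.notMem k (by omega) (by omega)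
  simp [lowestLevel, hfind]

theorem advance_spec (hc : 1 ≤ c) (hR : ∀ k, 1 ≤ k → k ≤ q → R k ≤ ℓ₀)
    (hv : IsLowestLevel S v i) (hiq : i ≤ q + 1) (hS : LevelInv x E q c R 1 ℓ S)
    (hrec : ∀ u, ℓ ≤ pos x u → pos x u < pos x v → Recorded x E q 1 ℓ₀ S u) :
    Comp.Spec (precedes x) (advance E c v i S)
      (fun e => ∃ k, 1 ≤ k ∧ k < i ∧ TestPair x E q c R ℓ k v e)
      (fun S' => LevelInv x E q c R 1 ℓ S' ∧ AgreeExcept v S S' ∧ Recorded x E q 1 ℓ S' v) := by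
  induction i using Nat.twoStepInduction generalizing S with
  | zero => exact absurd hv.one_le (by omega)
  | one => exact .pure ⟨hS, .refl v S, Or.inl hv.mem⟩
  | more j _ ih =>
    have hvc : v ∈ S.level (j + 1 + c) := hS.subset (by omega) (by omega) hv.mem
    have hask : Comp.Spec (precedes x) (firstPredecessor (potentialBlockers E c (j + 1) S v) v)
        (fun e => ∃ k, 1 ≤ k ∧ k < j + 2 ∧ TestPair x E q c R ℓ k v e)
        (· = (potentialBlockers E c (j + 1) S v).find? fun u => precedes x u v) := by
      refine ⟨fun e he => ?_, output_firstPredecessor ..⟩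
      obtain ⟨u, hu, rfl⟩ := mem_asked_firstPredecessor he
      obtain ⟨hu, hE⟩ := mem_potentialBlockers.1 hu
      exact ⟨j + 1, by omega, by omega, hS.testPair (by omega) hu hvc hE⟩
    refine hask.bind fun blocker hblocker => ?_
    cases blocker with
    | some u =>
      obtain ⟨hu, hE⟩ := mem_potentialBlockers.1 (List.mem_of_find?_eq_some hblocker.symm)
      have hlt : pos x u < pos x v :=
        precedes_eq_true.1 (by simpa using List.find?_some hblocker.symm)
      exact .pure ⟨hS.update_elim (by simpa using hlt), .update_elim v S _, Or.inr
        ⟨u, j + 1, Function.update_self .., hS.le_pos (by omega) hu, hlt, by omega, by omega, hE,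
          hv.mem, hv.notMem _ (by omega) (by omega)⟩⟩
    | none =>
      have hun : UnblockedAt x E q c R ℓ (j + 1) v :=
        hS.unblockedAt_of_forall_not (by omega) (hR _ (by omega) (by omega)) hrec
          fun u hu hE hlt => List.find?_eq_none.1 hblocker.symm u
            (mem_potentialBlockers.2 ⟨hu, hE⟩) (precedes_eq_true.2 hlt)
      have hagree := AgreeExcept.insert v S (j + 1)
      refine (ih ⟨by omega, by simp, fun k hk hkj => ?_⟩ (by omega)
        (hS.insert (by omega) hv.mem hun)
        fun u hℓ hlt => hagree.recorded (by rintro rfl; omega) (hrec u hℓ hlt)).mono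
        (fun e ⟨k, hk, hkj, he⟩ => ⟨k, hk, by omega, he⟩)
        fun S' ⟨hS', hagree', hv'⟩ => ⟨hS', hagree.trans hagree', hv'⟩
      simpa only [Function.update_of_ne hkj.ne] using hv.notMem k hk (by omega)

namespace IncrementInv

theorem init (hy : pos x y = ℓ) (h : Inv x E q c R 1 ℓ S) :
    IncrementInv x E q c R ℓ y ((List.finRange n).filter fun v => S.elim v = some y)
      { S with level := fun i => (S.level i).erase y } := by
  have hlt (v : Fin n) : ℓ + 1 ≤ pos x v ↔ v ≠ y ∧ ℓ ≤ pos x v := by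
    rw [Nat.succ_le_iff, lt_iff_le_and_ne, and_comm, ← hy, ne_comm, (pos_injective x).ne_iff]
  have hrec (v : Fin n) (hv : ℓ + 1 ≤ pos x v) : v ∈ (S.level 1).erase y ∨
      ∃ u k, S.elim v = some u ∧ ℓ ≤ pos x u ∧ ∀ ℓ' ≤ pos x u,
        BlockRecord x E q 1 ℓ' { S with level := fun i => (S.level i).erase y } v u k := by
    obtain ⟨hvy, hv⟩ := (hlt v).1 hv
    refine (h.recorded v hv).imp (fun hv1 => Finset.mem_erase.2 ⟨hvy, hv1⟩) fun ⟨u, k, hu⟩ =>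
      ⟨u, k, hu.elim_eq, hu.le_pos, fun ℓ' hℓ' => hu.congr hu.le_level hℓ' rfl fun j _ => ?_⟩
    simp [hvy]
  refine
    { levels :=
        { mono := fun i hi => Finset.erase_subset_erase _ (h.levels.mono i hi)
          top := fun i hi v => by rw [Finset.mem_erase, h.levels.top i hi v, hlt]
          elim_lt := h.levels.elim_lt
          unblocked := fun k hk hkq v hv u hℓ => h.levels.unblocked k hk hkq v
            (Finset.mem_of_mem_erase hv) u (by omega) }
      nodup := (List.nodup_finRange n).filter _
      elim_eq := by simp
      recorded_old := fun v hv => (hrec v hv).imp_right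
        fun ⟨u, k, _, hℓ, hu⟩ => ⟨u, k, hu ℓ hℓ⟩
      recorded := fun v hv hvl => (hrec v hv).imp_right
        fun ⟨u, k, hel, hℓ, hu⟩ => ⟨u, k, hu _ ((hlt u).2 ⟨?_, hℓ⟩)⟩ }
  rintro rfl
  simp [hel] at hvl

theorem exists_isLowestLevel (h : IncrementInv x E q c R ℓ y (v :: l) S)
    (hv : ℓ + 1 ≤ pos x v) :
    ∃ i, i ≤ q + 1 ∧ IsLowestLevel S v i ∧
      (1 < i → ∃ k, i ≤ k + 1 ∧ k ≤ q ∧ E k y v = true) := by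
  rcases h.recorded_old v hv with hv1 | ⟨u, k, hu⟩
  · exact ⟨1, by omega, ⟨le_rfl, hv1, fun k _ _ => by omega⟩, fun h => absurd h (lt_irrefl 1)⟩
  · obtain rfl : u = y :=
      Option.some_injective _ (hu.elim_eq.symm.trans (h.elim_eq v List.mem_cons_self))
    have hkq := hu.level_le
    refine ⟨k + 1, by omega, ⟨by omega, hu.mem_succ, fun k' hk' hlt hmem => ?_⟩,
      fun _ => ⟨k, le_rfl, hkq, hu.edge⟩⟩
    exact hu.notMem (h.levels.subset hk' (Nat.lt_succ_iff.1 hlt) hmem)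

theorem step (h : IncrementInv x E q c R ℓ y (v :: l) S) (hS' : LevelInv x E q c R 1 (ℓ + 1) S')
    (hagree : AgreeExcept v S S') (hv : Recorded x E q 1 (ℓ + 1) S' v) :
    IncrementInv x E q c R ℓ y l S' := by
  obtain ⟨hvl, hnd⟩ := List.nodup_cons.1 h.nodup
  refine ⟨hS', hnd, fun w hw => ?_, fun w hw => ?_, fun w hw hwl => ?_⟩
  · rw [(hagree w (ne_of_mem_of_not_mem hw hvl)).2]
    exact h.elim_eq w (List.mem_cons_of_mem v hw)
  · rcases eq_or_ne w v with rfl | hwv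
    · exact hv.mono_right ℓ.le_succ
    · exact hagree.recorded hwv (h.recorded_old w hw)
  · rcases eq_or_ne w v with rfl | hwv
    · exact hv
    · exact hagree.recorded hwv (h.recorded w hw (by simp [hwv, hwl]))

end IncrementInv

theorem increment_spec (hc : 1 ≤ c) (hR : ∀ k, 1 ≤ k → k ≤ q → R k ≤ ℓ) (hy : pos x y = ℓ)
    (h : Inv x E q c R 1 ℓ S) :
    Comp.Spec (precedes x) (increment E q c y S)
      (fun e => ∃ i, 1 ≤ i ∧ i ≤ q ∧ AdvancePair x E q c R (ℓ + 1) i e)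
      (Inv x E q c R 1 (ℓ + 1)) := by
  refine (Comp.Spec.foldlM (I := IncrementInv x E q c R ℓ y) (fun v l S hS => ?_)
    (.init hy h)).mono (fun _ => id) fun S hS => ⟨hS.levels, fun v hv => hS.recorded v hv (by simp)⟩
  have hv : ℓ + 1 ≤ pos x v := hy ▸ hS.levels.elim_lt v y (hS.elim_eq v List.mem_cons_self)
  obtain ⟨i, hiq, hi, hEi⟩ := hS.exists_isLowestLevel hv
  rw [hi.lowestLevel_eq hiq]
  have hagree := AgreeExcept.update_elim v S none
  refine (advance_spec (S := { S with elim := Function.update S.elim v none }) hc hR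
    ⟨hi.one_le, hi.mem, hi.notMem⟩ hiq (hS.levels.update_elim (by simp))
    fun u hℓ hlt => hagree.recorded (by rintro rfl; omega) (hS.recorded_old u hℓ)).mono
    ?_ fun S' ⟨hS', hagree', hv'⟩ => hS.step hS' (hagree.trans hagree') hv'
  rintro e ⟨k, hk, hki, he⟩
  obtain ⟨k', hik', hkq', hE⟩ := hEi (by omega)
  exact ⟨k, hk, by omega, v, he, y, k', by omega, by omega, hkq', hE⟩

end Levels

/-! ### The search and correctness -/

section Search

/-- `adj` is the adjacency relation of a graph that contains the path `x 0, x 1, …, x (n - 1)`, and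
the sets `E k` consist of edges of that graph. -/
structure ValidInput (x : Equiv.Perm (Fin n)) (adj : Fin n → Fin n → Bool)
    (E : ℕ → Fin n → Fin n → Bool) : Prop where
  symm : ∀ u v, adj u v = true → adj v u = true
  irrefl : ∀ v, ¬ adj v v = true
  path : ∀ u v, pos x u + 1 = pos x v → adj u v = true
  sub : ∀ k u v, E k u v = true → adj u v = true

/-- The pair `e` is an edge of the graph with adjacency relation `adj`. -/
def IsEdge (adj : Fin n → Fin n → Bool) (e : Sym2 (Fin n)) : Prop :=
  ∃ u v, e = s(u, v) ∧ adj u v = true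

section search

variable (x : Equiv.Perm (Fin n)) (adj : Fin n → Fin n → Bool) (E : ℕ → Fin n → Fin n → Bool)
  (q c : ℕ) (R : ℕ → ℕ)

/-- The necessary condition for `y` to pass the rounds below `r` of the search for the vertex in
position `ℓ`: every undiscovered predecessor adjacent to `y` may be missing from level `r - 1`. -/
def Survives (ℓ r : ℕ) (y : Fin n) : Prop :=
  2 ≤ r → ∀ u, ℓ ≤ pos x u → pos x u < pos x y → adj u y = true → HasBlocker x E q (r - 1) ℓ u

/-- The conditions that `y` satisfies if it is a wrong candidate in round `r` of the search for the
vertex in position `ℓ`. -/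
structure WrongCandidate (ℓ r : ℕ) (y : Fin n) : Prop where
  lt_pos : ℓ < pos x y
  adj_last : ∃ z, pos x z + 1 = ℓ ∧ adj z y = true
  unblocked : Unblocked x E q c R ℓ 1 y
  survives : Survives x adj E q ℓ r y

/-- A pair that may be compared in round `r` of the search for the vertex in position `ℓ`. Since
the search stops when one candidate is left, such a pair is always charged to a wrong candidate
`y`, but the vertex `z` that is tested may also be the right one. -/
def SearchPair (ℓ r : ℕ) (e : Sym2 (Fin n)) : Prop :=
  ∃ y, WrongCandidate x adj E q c R ℓ r y ∧ ∃ u z, e = s(u, z) ∧ (z = y ∨ pos x z = ℓ) ∧ u ≠ y ∧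
    adj u z = true ∧ ℓ ≤ pos x u ∧ Unblocked x E q c R ℓ r u

/-- The list `C` of candidates before round `r` of the search for the successor `y₀` of `z`. -/
structure CandidateInv (S : State n) (z y₀ : Fin n) (r : ℕ) (C : List (Fin n)) : Prop where
  nodup : C.Nodup
  mem : y₀ ∈ C
  adj_last : ∀ v ∈ C, adj z v = true
  mem_level_one : ∀ v ∈ C, v ∈ S.level 1
  not_lt : 2 ≤ r → ∀ v ∈ C, ∀ u ∈ S.level (r - 1), adj u v = true → ¬ pos x u < pos x v

end search

variable {x : Equiv.Perm (Fin n)} {adj : Fin n → Fin n → Bool} {E : ℕ → Fin n → Fin n → Bool}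
  {q c ℓ r : ℕ} {R : ℕ → ℕ} {S : State n} {C : List (Fin n)} {u v y z y₀ : Fin n}
  {e : Sym2 (Fin n)}

theorem output_eliminate (i : ℕ) (C : List (Fin n)) :
    (eliminate adj i S C).output (precedes x) =
      C.filter fun v => decide (∀ u ∈ S.level i, adj u v = true → ¬ pos x u < pos x v) := by
  simp only [eliminate, Comp.output_filterM, Comp.output_bind, output_predecessors,
    Comp.output_pure]
  refine List.filter_congr fun v _ => ?_
  rw [Bool.eq_iff_iff, List.isEmpty_iff, List.filter_eq_nil_iff, decide_eq_true_iff]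
  simp only [List.mem_filter, List.mem_finRange, true_and, decide_eq_true_eq, precedes_eq_true,
    and_imp]

theorem mem_asked_eliminate {i : ℕ} (he : e ∈ (eliminate adj i S C).asked (precedes x)) :
    ∃ v ∈ C, ∃ u ∈ S.level i, adj u v = true ∧ e = s(u, v) := by
  simp only [eliminate, Comp.mem_asked_filterM, Comp.asked_bind, Comp.asked_pure,
    Finset.union_empty, mem_asked_predecessors, List.mem_filter, List.mem_finRange, true_and,
    decide_eq_true_eq] at he
  obtain ⟨v, hv, u, ⟨hu, ha⟩, he⟩ := he
  exact ⟨v, hv, u, hu, ha, he⟩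

theorem Inv.lt_pos_of_mem_of_ne (hS : Inv x E q c R 1 ℓ S) (hy₀ : pos x y₀ = ℓ)
    (hv : v ∈ S.level 1) (hne : v ≠ y₀) : ℓ < pos x v :=
  lt_of_le_of_ne (hS.levels.le_pos le_rfl hv) fun h => hne (pos_injective x (h.symm.trans hy₀.symm))

namespace CandidateInv

theorem eq_singleton_of_forall (h : CandidateInv x adj S z y₀ r C) (hC : ∀ v ∈ C, v = y₀) :
    C = [y₀] := by
  have hlen := h.nodup
  rw [List.eq_replicate_of_mem hC, List.nodup_replicate] at hlen
  have hpos := List.length_pos_of_mem h.mem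
  rw [List.eq_replicate_of_mem hC, show C.length = 1 by omega, List.replicate_one]

theorem eq_singleton_of_length_le_one (h : CandidateInv x adj S z y₀ r C) (hC : C.length ≤ 1) :
    C = [y₀] := by
  have hpos := List.length_pos_of_mem h.mem
  obtain ⟨a, rfl⟩ := List.length_eq_one_iff.1 (le_antisymm hC hpos)
  rw [List.mem_singleton.1 h.mem]

theorem eq_singleton_of_last (hV : ValidInput x adj E) (hS : Inv x E q c R 1 ℓ S)
    (hy₀ : pos x y₀ = ℓ) (h : CandidateInv x adj S z y₀ (q + 2) C) : C = [y₀] := by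
  refine h.eq_singleton_of_forall fun v hv => ?_
  by_contra hne
  have hlt := hS.lt_pos_of_mem_of_ne hy₀ (h.mem_level_one v hv) hne
  obtain ⟨u, hu⟩ := exists_pos_eq x (k := pos x v - 1) (by have := pos_lt x v; omega)
  exact h.not_lt (by omega) v hv u ((hS.levels.top _ (by omega) u).2 (by omega))
    (hV.path u v (by omega)) (by omega)

theorem wrongCandidate (h : CandidateInv x adj S z y₀ r C) (hS : Inv x E q c R 1 ℓ S)
    (hz : pos x z + 1 = ℓ) (hy₀ : pos x y₀ = ℓ) (hy : y ∈ C) (hne : y ≠ y₀) :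
    WrongCandidate x adj E q c R ℓ r y where
  lt_pos := hS.lt_pos_of_mem_of_ne hy₀ (h.mem_level_one y hy) hne
  adj_last := ⟨z, hz, h.adj_last y hy⟩
  unblocked := hS.levels.unblocked_of_mem le_rfl (h.mem_level_one y hy)
  survives := fun hr u hℓ hlt hadj => by
    by_contra hu
    exact h.not_lt hr y hy u (hS.levels.mem_of_recorded (hS.recorded u hℓ) (by omega) le_rfl hu)
      hadj hlt

theorem eliminate (h : CandidateInv x adj S z y₀ r C) (hS : Inv x E q c R 1 ℓ S)
    (hy₀ : pos x y₀ = ℓ) (hr : 1 ≤ r) :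
    CandidateInv x adj S z y₀ (r + 1) ((eliminate adj r S C).output (precedes x)) := by
  simp only [output_eliminate]
  refine ⟨h.nodup.filter _, ?_, fun v hv => h.adj_last v (List.mem_of_mem_filter hv),
    fun v hv => h.mem_level_one v (List.mem_of_mem_filter hv), fun _ v hv => ?_⟩
  · simp only [List.mem_filter, decide_eq_true_eq]
    exact ⟨h.mem, fun u hu _ => by have := hS.levels.le_pos hr hu; omega⟩
  · exact of_decide_eq_true (List.mem_filter.1 hv).2

theorem searchPair (hV : ValidInput x adj E) (hS : Inv x E q c R 1 ℓ S)
    (hz : pos x z + 1 = ℓ) (hy₀ : pos x y₀ = ℓ) (h : CandidateInv x adj S z y₀ r C) (hr : 1 ≤ r)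
    (hlen : ¬ C.length ≤ 1) (he : e ∈ (StochSort.eliminate adj r S C).asked (precedes x)) :
    SearchPair x adj E q c R ℓ r e ∨ SearchPair x adj E q c R ℓ 1 e := by
  obtain ⟨v, hv, u, hu, hadj, rfl⟩ := mem_asked_eliminate he
  obtain ⟨y, hy, hne⟩ : ∃ y ∈ C, y ≠ y₀ := by
    by_contra! hcon
    exact hlen (by simp [h.eq_singleton_of_forall hcon])
  have hwrong {y} (hy : y ∈ C) (hne : y ≠ y₀) := h.wrongCandidate hS hz hy₀ hy hne
  have hℓu := hS.levels.le_pos hr hu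
  have hub := hS.levels.unblocked_of_mem hr hu
  by_cases hvy : v = y₀
  · subst hvy
    by_cases huy : u = y
    · -- The edge between the two candidates is charged to round `1`, with its ends exchanged.
      subst huy
      exact .inr ⟨u, { hwrong hy hne with survives := fun h => by omega }, v, u, Sym2.eq_swap,
        .inl rfl, hne.symm, hV.symm _ _ hadj, hy₀.ge,
        hS.levels.unblocked_of_mem le_rfl (h.mem_level_one v hv)⟩
    · exact .inl ⟨y, hwrong hy hne, u, v, rfl, .inr hy₀, huy, hadj, hℓu, hub⟩
  · refine .inl ⟨v, hwrong hv hvy, u, v, rfl, .inl rfl, ?_, hadj, hℓu, hub⟩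
    rintro rfl
    exact hV.irrefl _ hadj

theorem narrow_spec (hV : ValidInput x adj E) (hS : Inv x E q c R 1 ℓ S) (hz : pos x z + 1 = ℓ)
    (hy₀ : pos x y₀ = ℓ) {m : ℕ} (hr : 1 ≤ r) (hm : r + m = q + 2)
    (h : CandidateInv x adj S z y₀ r C) :
    Comp.Spec (precedes x) (narrow adj S (List.range' r m) C)
      (fun e => ∃ r, 1 ≤ r ∧ r ≤ q + 1 ∧ SearchPair x adj E q c R ℓ r e) (· = [y₀]) := by
  induction m generalizing r C with
  | zero =>
    obtain rfl : r = q + 2 := hm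
    exact .pure (h.eq_singleton_of_last hV hS hy₀)
  | succ m ih =>
    rw [List.range'_succ, narrow]
    split_ifs with hlen
    · exact .pure (h.eq_singleton_of_length_le_one hlen)
    · refine .bind (P := CandidateInv x adj S z y₀ (r + 1)) ⟨fun e he => ?_, h.eliminate hS hy₀ hr⟩
        fun C' hC' => ih (by omega) (by omega) hC'
      rcases h.searchPair hV hS hz hy₀ hr hlen he with he | he
      · exact ⟨r, hr, by omega, he⟩
      · exact ⟨1, le_rfl, by omega, he⟩

end CandidateInv

theorem findNext_spec (hV : ValidInput x adj E) (hS : Inv x E q c R 1 ℓ S) (hz : pos x z + 1 = ℓ)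
    (hy₀ : pos x y₀ = ℓ) :
    Comp.Spec (precedes x) (findNext adj q z S)
      (fun e => ∃ r, 1 ≤ r ∧ r ≤ q + 1 ∧ SearchPair x adj E q c R ℓ r e) (· = y₀) := by
  have hmem : y₀ ∈ S.level 1 := by
    rcases hS.recorded y₀ hy₀.ge with h | ⟨u, k, hu⟩
    · exact h
    · exact absurd hu.le_pos (by have := hu.pos_lt; omega)
  have hinit : CandidateInv x adj S z y₀ 1
      ((List.finRange n).filter fun v => v ∈ S.level 1 ∧ adj z v) :=
    { nodup := (List.nodup_finRange n).filter _
      mem := by simp [hmem, hV.path z y₀ (by omega)]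
      adj_last := fun v hv => by simp_all
      mem_level_one := fun v hv => by simp_all
      not_lt := fun h => by omega }
  refine (hinit.narrow_spec hV hS hz hy₀ le_rfl (by omega)).bind ?_
  rintro _ rfl
  exact .pure rfl

theorem card_asked_findFirst_le (prec : Fin n → Fin n → Bool) (k : ℕ) (v₀ : Fin n)
    (S : Finset (Fin n)) : ((findFirst adj k v₀ S).asked prec).card ≤ k := by
  induction k generalizing v₀ S with
  | zero => simp [findFirst]
  | succ k ih =>
    rw [findFirst]
    split
    · simp
    · rename_i u _
      have hcard (b : Bool) : ((if b then findFirst adj k u (insert v₀ S)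
          else findFirst adj k v₀ (insert u S)).asked prec).card ≤ k := by
        cases b <;> exact ih _ _
      simp only [Comp.asked_bind, Comp.asked_ask]
      refine (Finset.card_union_le _ _).trans ?_
      rw [Finset.card_singleton, add_comm]
      exact Nat.succ_le_succ (hcard _)

theorem pos_eq_zero_of_forall_adj_lt (hV : ValidInput x adj E)
    (hv : ∀ u, adj u v = true → pos x v < pos x u) : pos x v = 0 := by
  by_contra hpos
  obtain ⟨u, hu⟩ := exists_pos_eq x (k := pos x v - 1) (by have := pos_lt x v; omega)
  have := hv u (hV.path u v (by omega))
  omega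

theorem findFirst_spec (hV : ValidInput x adj E) (k : ℕ) (v₀ : Fin n) (S : Finset (Fin n))
    (hS : ∀ u ∈ S, pos x v₀ < pos x u) (hk : n ≤ k + S.card) :
    Comp.Spec (precedes x) (findFirst adj k v₀ S) (IsEdge adj) (pos x · = 0) := by
  have hv₀ : v₀ ∉ S := fun h => lt_irrefl _ (hS v₀ h)
  induction k generalizing v₀ S with
  | zero =>
    have := Finset.card_lt_univ_of_notMem hv₀
    rw [Fintype.card_fin] at this
    omega
  | succ k ih =>
    rw [findFirst]
    split
    · rename_i hnone
      simp only [List.find?_eq_none, List.mem_finRange, decide_eq_true_eq, not_and, not_not,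
        true_imp_iff] at hnone
      exact .pure (pos_eq_zero_of_forall_adj_lt hV fun u hu => hS u (hnone u hu))
    · rename_i u hsome
      obtain ⟨hadj, hu⟩ : adj u v₀ = true ∧ u ∉ S := by simpa using List.find?_some hsome
      have hne : pos x u ≠ pos x v₀ := fun h => by
        rw [pos_injective x h] at hadj
        exact hV.irrefl _ hadj
      refine (Comp.Spec.ask ⟨u, v₀, rfl, hadj⟩).bind ?_
      rintro _ rfl
      split_ifs with hprec
      · rw [precedes_eq_true] at hprec
        have hS' : ∀ w ∈ insert v₀ S, pos x u < pos x w := by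
          simpa [hprec] using fun w hw => hprec.trans (hS w hw)
        refine ih u _ hS' ?_ fun h => lt_irrefl _ (hS' u h)
        rw [Finset.card_insert_of_notMem hv₀]
        omega
      · rw [precedes_eq_true] at hprec
        have hS' : ∀ w ∈ insert u S, pos x v₀ < pos x w := by
          simpa [lt_of_le_of_ne (not_lt.1 hprec) hne.symm] using hS
        refine ih v₀ _ hS' ?_ fun h => lt_irrefl _ (hS' v₀ h)
        rw [Finset.card_insert_of_notMem hu]
        omega

/-- The time of the last rebuild of a level, after a number of discoveries:
`lastRebuild sched ℓ k` refers to level `k` after `ℓ` discoveries. -/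
def lastRebuild (sched : ℕ → ℕ) : ℕ → ℕ → ℕ
  | 0, _ => 0
  | ℓ + 1, k => if k ≤ sched (ℓ + 1) then ℓ + 1 else lastRebuild sched ℓ k

theorem lastRebuild_le (sched : ℕ → ℕ) (ℓ k : ℕ) : lastRebuild sched ℓ k ≤ ℓ := by
  induction ℓ with
  | zero => exact le_rfl
  | succ ℓ ih => rw [lastRebuild]; split_ifs <;> omega

theorem lastRebuild_le_succ (sched : ℕ → ℕ) (ℓ k : ℕ) :
    lastRebuild sched ℓ k ≤ lastRebuild sched (ℓ + 1) k := by
  have := lastRebuild_le sched ℓ k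
  rw [lastRebuild]
  split_ifs <;> omega

/-- The pairs that may be compared when `ℓ` vertices have been discovered. -/
def ComparedAt (x : Equiv.Perm (Fin n)) (adj : Fin n → Fin n → Bool)
    (E : ℕ → Fin n → Fin n → Bool) (q c : ℕ) (sched : ℕ → ℕ) (ℓ : ℕ) (e : Sym2 (Fin n)) : Prop :=
  (∃ i, 1 ≤ i ∧ i ≤ q ∧ (ℓ = 0 ∨ i ≤ sched ℓ) ∧
    RebuildPair x E q c (lastRebuild sched (ℓ - 1)) ℓ i e) ∨
  (∃ i, 1 ≤ i ∧ i ≤ q ∧ AdvancePair x E q c (lastRebuild sched (ℓ - 1)) ℓ i e) ∨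
  ∃ r, 1 ≤ r ∧ r ≤ q + 1 ∧ SearchPair x adj E q c (lastRebuild sched (ℓ - 1)) ℓ r e

theorem RebuildPair.mono {R' : ℕ → ℕ} {i : ℕ} (h : RebuildPair x E q c R ℓ i e)
    (hR : ∀ k, R' k ≤ R k) : RebuildPair x E q c R' ℓ i e :=
  let ⟨v, u, he, hE, hu, hv, hu', hv'⟩ := h
  ⟨v, u, he, hE, hu, hv, hu'.mono hR le_rfl, hv'.mono hR le_rfl⟩

theorem SearchPair.mono {R' : ℕ → ℕ} (h : SearchPair x adj E q c R ℓ r e)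
    (hR : ∀ k, R' k ≤ R k) : SearchPair x adj E q c R' ℓ r e :=
  let ⟨y, hy, u, z, he, hz, huy, hadj, hu, hub⟩ := h
  ⟨y, { hy with unblocked := hy.unblocked.mono hR le_rfl }, u, z, he, hz, huy, hadj, hu,
    hub.mono hR le_rfl⟩

theorem ComparedAt.isEdge {sched : ℕ → ℕ} (hV : ValidInput x adj E)
    (h : ComparedAt x adj E q c sched ℓ e) : IsEdge adj e := by
  rcases h with ⟨i, -, -, -, v, u, he, hE, -⟩ | ⟨i, -, -, v, ⟨u, he, hE, -⟩, -⟩ |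
    ⟨r, -, -, y, -, u, z, he, -, -, hadj, -⟩
  · exact ⟨u, v, he, hV.sub _ _ _ hE⟩
  · exact ⟨u, v, he, hV.sub _ _ _ hE⟩
  · exact ⟨u, z, he, hadj⟩

theorem update_bind_spec (hc : 1 ≤ c) {sched : ℕ → ℕ} (hsched : ∀ ℓ, sched ℓ ≤ q) (hℓ : ℓ < n)
    (hy : pos x y = ℓ) (hS : Inv x E q c (lastRebuild sched ℓ) 1 ℓ S) {α : Type}
    {f : State n → Comp (Fin n) α} {P : α → Prop}
    (hf : ∀ S', Inv x E q c (lastRebuild sched (ℓ + 1)) 1 (ℓ + 1) S' → Comp.Spec (precedes x) (f S')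
      (fun e => ∃ ℓ ≤ n, ComparedAt x adj E q c sched ℓ e) P) :
    Comp.Spec (precedes x)
      (increment E q c y S >>= fun S₁ => createLevels E c (sched (ℓ + 1)) S₁ >>= f)
      (fun e => ∃ ℓ ≤ n, ComparedAt x adj E q c sched ℓ e) P := by
  have hincr := increment_spec hc (fun k _ _ => lastRebuild_le sched ℓ k) hy hS
  refine (hincr.mono (fun e he => ⟨ℓ + 1, hℓ, .inr (.inl he)⟩) fun _ h => h).bind fun S₁ hS₁ => ?_
  have hS₁' : Inv x E q c (lastRebuild sched (ℓ + 1)) (sched (ℓ + 1) + 1) (ℓ + 1) S₁ :=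
    hS₁.weaken (by omega) fun k hk => by rw [lastRebuild, if_neg (by omega)]
  refine ((createLevels_spec hc (hsched _) (fun k _ _ => lastRebuild_le sched _ k) hS₁').mono
    (fun e he => ?_) fun _ h => h).bind hf
  obtain ⟨i, hi, his, he⟩ := he
  exact ⟨ℓ + 1, hℓ, .inl ⟨i, hi, his.trans (hsched _), .inr his,
    he.mono (lastRebuild_le_succ sched ℓ)⟩⟩

theorem discover_spec (hV : ValidInput x adj E) (hc : 1 ≤ c) {sched : ℕ → ℕ}
    (hsched : ∀ ℓ, sched ℓ ≤ q) (k : ℕ) (hkn : ℓ + k < n) (hy : pos x y = ℓ)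
    (hS : Inv x E q c (lastRebuild sched ℓ) 1 ℓ S) :
    Comp.Spec (precedes x) (discover adj E q c sched k (ℓ + 1) y S)
      (fun e => ∃ ℓ ≤ n, ComparedAt x adj E q c sched ℓ e)
      (fun l => l.map (pos x) = List.range' ℓ (k + 1)) := by
  induction k generalizing ℓ y S with
  | zero =>
    rw [discover]
    exact update_bind_spec hc hsched hkn hy hS fun _ _ => .pure (by simp [hy])
  | succ k ih =>
    rw [discover]
    refine update_bind_spec hc hsched (by omega) hy hS fun S' hS' => ?_
    obtain ⟨y₀, hy₀⟩ := exists_pos_eq x (k := ℓ + 1) (by omega)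
    refine ((findNext_spec hV hS' (z := y) (by omega) hy₀).mono (fun e he => ?_)
      fun _ h => h).bind ?_
    · obtain ⟨r, hr, hrq, he⟩ := he
      exact ⟨ℓ + 1, by omega, .inr (.inr ⟨r, hr, hrq, he.mono (lastRebuild_le_succ sched ℓ)⟩)⟩
    · rintro _ rfl
      refine (ih (by omega) hy₀ hS').bind fun rest hrest => .pure ?_
      rw [List.map_cons, hrest, hy, List.range'_succ (s := ℓ)]

theorem sortPrefix_spec (hV : ValidInput x adj E) (hc : 1 ≤ c) {sched : ℕ → ℕ}
    (hsched : ∀ ℓ, sched ℓ ≤ q) {m : ℕ} (hm : m ≤ n) :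
    ∃ F : Finset (Sym2 (Fin n)), F.card ≤ n ∧ (∀ e ∈ F, IsEdge adj e) ∧
      Comp.Spec (precedes x) (sortPrefix adj E q c sched m)
        (fun e => e ∈ F ∨ ∃ ℓ ≤ n, ComparedAt x adj E q c sched ℓ e)
        (fun l => l.map (pos x) = List.range' 0 m) := by
  match m, hm with
  | 0, _ => exact ⟨∅, by simp, by simp, by simpa [sortPrefix] using .pure rfl⟩
  | k + 1, hm =>
    obtain ⟨n, rfl⟩ : ∃ m, n = m + 1 := ⟨n - 1, by omega⟩
    have hfirst := findFirst_spec hV (n + 1) 0 ∅ (by simp) (by simp)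
    refine ⟨_, card_asked_findFirst_le (precedes x) (n + 1) 0 ∅, hfirst.asked, ?_⟩
    have hhead : (List.finRange (n + 1)).head? = some 0 := by simp [List.finRange_succ]
    unfold sortPrefix
    rw [hhead]
    refine ((createLevels_spec hc le_rfl (fun k _ _ => lastRebuild_le sched 0 k) inv_init).mono
      ?_ fun _ h => h).bind fun S hS => ?_
    · rintro e ⟨i, hi, hiq, he⟩
      exact .inr ⟨0, by omega, .inl ⟨i, hi, hiq, .inl rfl, he⟩⟩
    · exact .bind ⟨fun e he => .inl he, hfirst.output⟩ fun y hy =>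
        (discover_spec hV hc hsched k (by omega) hy hS).mono (fun e he => .inr he) fun _ h => h

/-- The order `x` read backwards. -/
def reverseOrder (x : Equiv.Perm (Fin n)) : Equiv.Perm (Fin n) := Fin.revPerm.trans x

theorem pos_reverseOrder (x : Equiv.Perm (Fin n)) (v : Fin n) :
    pos (reverseOrder x) v = n - 1 - pos x v := by
  simp only [pos, reverseOrder, Equiv.symm_trans_apply, Fin.revPerm_symm, Fin.revPerm_apply,
    Fin.val_rev]
  omega

theorem precedes_reverseOrder (x : Equiv.Perm (Fin n)) :
    (fun u v => precedes x v u) = precedes (reverseOrder x) := by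
  funext u v
  have := pos_lt x u
  have := pos_lt x v
  rw [Bool.eq_iff_iff, precedes_eq_true, precedes_eq_true, pos_reverseOrder, pos_reverseOrder]
  omega

theorem ValidInput.reverse (h : ValidInput x adj E) : ValidInput (reverseOrder x) adj E where
  symm := h.symm
  irrefl := h.irrefl
  sub := h.sub
  path := fun u v huv => by
    have := pos_lt x u
    have := pos_lt x v
    rw [pos_reverseOrder, pos_reverseOrder] at huv
    exact h.symm _ _ (h.path v u (by omega))

theorem asked_sortAll (sched : ℕ → ℕ) :
    (sortAll adj E q c sched).asked (precedes x) =
      (sortPrefix adj E q c sched ((n + 1) / 2)).asked (precedes x) ∪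
      (sortPrefix adj E q c sched (n / 2)).asked (precedes (reverseOrder x)) := by
  simp [sortAll, Comp.asked_reversed, precedes_reverseOrder]

theorem append_reverse_eq_ofFn {front back : List (Fin n)}
    (hfront : front.map (pos x) = List.range' 0 ((n + 1) / 2))
    (hback : back.map (pos (reverseOrder x)) = List.range' 0 (n / 2)) :
    front ++ back.reverse = List.ofFn x := by
  have hback' : back.map (pos x) = (List.range' 0 (n / 2)).map fun k => n - 1 - k := by
    rw [← hback, List.map_map]
    refine List.map_congr_left fun v _ => ?_
    have := pos_lt x v
    simp only [Function.comp, pos_reverseOrder]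
    omega
  refine List.map_injective_iff.2 (pos_injective x) ?_
  rw [List.map_append, List.map_reverse, hfront, hback']
  refine List.ext_getElem ?_ fun i hi _ => ?_
  · simp only [List.length_append, List.length_range', List.length_reverse, List.length_map,
      List.length_ofFn]
    omega
  · simp only [List.length_append, List.length_range', List.length_reverse, List.length_map] at hi
    simp only [List.map_ofFn, List.getElem_ofFn, Function.comp, pos, Equiv.symm_apply_apply,
      List.getElem_append, List.length_range', List.getElem_reverse, List.getElem_map,
      List.getElem_range', List.length_map]
    split_ifs <;> omega

theorem output_sortAll (hV : ValidInput x adj E) (hc : 1 ≤ c) {sched : ℕ → ℕ}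
    (hsched : ∀ ℓ, sched ℓ ≤ q) : (sortAll adj E q c sched).output (precedes x) = List.ofFn x := by
  obtain ⟨_, -, -, hfront⟩ := sortPrefix_spec hV hc hsched (m := (n + 1) / 2) (by omega)
  obtain ⟨_, -, -, hback⟩ := sortPrefix_spec hV.reverse hc hsched (m := n / 2) (by omega)
  simp only [sortAll, Comp.output_bind, Comp.output_pure, Comp.output_reversed,
    precedes_reverseOrder]
  exact append_reverse_eq_ofFn hfront.output hback.output

end Search

/-! ### The rebuild schedule -/

theorem hamPath_adj {x : Equiv.Perm (Fin n)} {u v : Fin n} :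
    (hamPath x).Adj u v ↔ pos x u + 1 = pos x v ∨ pos x v + 1 = pos x u := by
  simp only [hamPath, SimpleGraph.map_adj, SimpleGraph.pathGraph_adj, pos]
  constructor
  · rintro ⟨a, b, h, rfl, rfl⟩
    simpa using h
  · intro h
    exact ⟨x.symm u, x.symm v, h, by simp, by simp⟩

theorem hamPath_reverseOrder (x : Equiv.Perm (Fin n)) : hamPath (reverseOrder x) = hamPath x := by
  ext u v
  have := pos_lt x u
  have := pos_lt x v
  rw [hamPath_adj, hamPath_adj, pos_reverseOrder, pos_reverseOrder]
  omega

open Classical in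
theorem validInput {q : ℕ} {x : Equiv.Perm (Fin n)} {G : SimpleGraph (Fin n)}
    (T : Sym2 (Fin n) → Fin q → Bool) (hG : hamPath x ≤ G) :
    ValidInput x (fun u v => decide (G.Adj u v)) (edgeSets G T) where
  symm := fun u v h => by simpa using (of_decide_eq_true h).symm
  irrefl := fun v => by simp
  path := fun u v h => decide_eq_true (hG (hamPath_adj.2 (Or.inl h)))
  sub := fun k u v h => by
    simp only [edgeSets, decide_eq_true_eq] at h ⊢
    exact h.1

theorem schedule_le (q : ℕ) (p : unitInterval) (ℓ : ℕ) : schedule q p ℓ ≤ q := by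
  classical
  refine Finset.sup_le fun i hi => ?_
  simp only [Finset.mem_filter, Finset.mem_Icc] at hi
  exact hi.1.2

theorem le_schedule_iff {q : ℕ} {p : unitInterval} {ℓ i : ℕ} (hi : 1 ≤ i) (hiq : i ≤ q) :
    i ≤ schedule q p ℓ ↔ ∃ k : ℕ, ⌊(k : ℝ) * (targetSize p i / 32)⌋₊ = ℓ := by
  classical
  constructor
  · intro h
    have hne : ((Finset.Icc 1 q).filter
        fun i => ∃ k : ℕ, ⌊(k : ℝ) * (targetSize p i / 32)⌋₊ = ℓ).Nonempty := by
      by_contra hcon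
      rw [Finset.not_nonempty_iff_eq_empty] at hcon
      rw [schedule, hcon] at h
      simp at h
      omega
    obtain ⟨j, hj, hj'⟩ := Finset.exists_mem_eq_sup _ hne id
    simp only [Finset.mem_filter, Finset.mem_Icc] at hj
    obtain ⟨-, k, hk⟩ := hj
    have hij : i ≤ j := h.trans_eq hj'
    refine ⟨k * 2 ^ (j - i), ?_⟩
    rw [← hk]
    congr 1
    have : (2 : ℝ) ^ j = 2 ^ (j - i) * 2 ^ i := by rw [← pow_add]; congr 1; omega
    rw [targetSize, targetSize, this]
    push_cast
    ring
  · intro h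
    exact Finset.le_sup (f := id)
      (Finset.mem_filter.2 ⟨Finset.mem_Icc.2 ⟨hi, hiq⟩, h⟩)

theorem le_lastRebuild {sched : ℕ → ℕ} {k τ ℓ : ℕ} (hτ : k ≤ sched τ) (hle : τ ≤ ℓ) :
    τ ≤ lastRebuild sched ℓ k := by
  induction ℓ with
  | zero => omega
  | succ ℓ ih =>
    rw [lastRebuild]
    split_ifs with h
    · exact hle
    · refine ih (Nat.le_of_lt_succ (lt_of_le_of_ne hle ?_))
      rintro rfl
      exact h hτ

theorem targetSize_pos {p : unitInterval} (hp : 0 < p) (i : ℕ) : 0 < targetSize p i :=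
  div_pos (by positivity) hp

theorem targetSize_mono {p : unitInterval} (hp : 0 < p) : Monotone (targetSize p) := by
  have hp : (0 : ℝ) < p := hp
  intro i j hij
  unfold targetSize
  gcongr
  norm_num

theorem targetSize_add (p : unitInterval) (i c : ℕ) :
    targetSize p (i + c) = targetSize p i * 2 ^ c := by
  rw [targetSize, targetSize, pow_add]
  ring

theorem two_le_targetSize {p : unitInterval} (hp : 0 < p) {i : ℕ} (hi : 1 ≤ i) :
    2 ≤ targetSize p i := by
  have hp' : (0 : ℝ) < p := hp
  rw [targetSize, le_div_iff₀ hp']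
  have : (2 : ℝ) ^ 1 ≤ 2 ^ i := pow_le_pow_right₀ (by norm_num) hi
  nlinarith [p.2.2]

theorem sub_lastRebuild_le {q : ℕ} {p : unitInterval} (hp : 0 < p) {k : ℕ} (hk : 1 ≤ k)
    (hkq : k ≤ q) (ℓ : ℕ) :
    (ℓ : ℝ) - lastRebuild (schedule q p) ℓ k ≤ targetSize p k / 32 + 1 := by
  have hs : 0 < targetSize p k / 32 := by have := targetSize_pos hp k; positivity
  set s := targetSize p k / 32
  set m := ⌊(ℓ : ℝ) / s⌋₊
  have hm_le : (m : ℝ) * s ≤ ℓ := (le_div_iff₀ hs).1 (Nat.floor_le (by positivity))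
  have lt_hm : (ℓ : ℝ) < (m + 1) * s := (div_lt_iff₀ hs).1 (Nat.lt_floor_add_one _)
  have hlast : (⌊(m : ℝ) * s⌋₊ : ℝ) ≤ lastRebuild (schedule q p) ℓ k := by
    exact_mod_cast le_lastRebuild ((le_schedule_iff hk hkq).2 ⟨m, rfl⟩) (Nat.floor_le_of_le hm_le)
  have := Nat.lt_floor_add_one ((m : ℝ) * s)
  linarith

/-- Each of the levels `1, …, q` was last rebuilt at time `R k`, about `targetSize p k / 32` rounds
before time `ℓ`. -/
def RecentlyRebuilt (p : unitInterval) (q : ℕ) (R : ℕ → ℕ) (ℓ : ℕ) : Prop :=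
  ∀ k, 1 ≤ k → k ≤ q → R k ≤ ℓ ∧ (ℓ : ℝ) - R k ≤ targetSize p k / 32 + 2

theorem recentlyRebuilt_lastRebuild {p : unitInterval} (hp : 0 < p) (q ℓ : ℕ) :
    RecentlyRebuilt p q (lastRebuild (schedule q p) (ℓ - 1)) ℓ := by
  intro k hk hkq
  refine ⟨(lastRebuild_le _ _ _).trans (Nat.sub_le _ _), ?_⟩
  have h := sub_lastRebuild_le hp hk hkq (ℓ - 1)
  have : (ℓ : ℝ) ≤ (ℓ - 1 : ℕ) + 1 := by exact_mod_cast (by omega : ℓ ≤ ℓ - 1 + 1)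
  linarith

theorem card_rebuild_le {q : ℕ} {p : unitInterval} (hp : 0 < p) {i : ℕ} (hi : 1 ≤ i)
    (hiq : i ≤ q) (n : ℕ) :
    (((Finset.Icc 1 n).filter fun ℓ => i ≤ schedule q p ℓ).card : ℝ) ≤
      32 * (n + 1) / targetSize p i := by
  have hs := targetSize_pos hp i
  have hsub : ((Finset.Icc 1 n).filter fun ℓ => i ≤ schedule q p ℓ) ⊆
      (Finset.Icc 1 ⌊32 * ((n : ℝ) + 1) / targetSize p i⌋₊).image
        fun k : ℕ => ⌊(k : ℝ) * (targetSize p i / 32)⌋₊ := by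
    intro ℓ hℓ
    obtain ⟨hℓ, hsched⟩ := Finset.mem_filter.1 hℓ
    obtain ⟨hℓ₁, hℓn⟩ := Finset.mem_Icc.1 hℓ
    obtain ⟨k, hk⟩ := (le_schedule_iff hi hiq).1 hsched
    refine Finset.mem_image.2 ⟨k, Finset.mem_Icc.2 ⟨?_, Nat.le_floor ?_⟩, hk⟩
    · rcases k.eq_zero_or_pos with rfl | hk₀
      · simp only [Nat.cast_zero, zero_mul, Nat.floor_zero] at hk
        omega
      · exact hk₀
    · rw [le_div_iff₀ hs]
      have hlt := Nat.lt_floor_add_one ((k : ℝ) * (targetSize p i / 32))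
      have : (ℓ : ℝ) ≤ n := by exact_mod_cast hℓn
      rw [hk] at hlt
      linarith
  have hcard := (Finset.card_le_card hsub).trans Finset.card_image_le
  rw [Nat.card_Icc, Nat.add_sub_cancel] at hcard
  calc _ ≤ ((⌊32 * ((n : ℝ) + 1) / targetSize p i⌋₊ : ℕ) : ℝ) := by exact_mod_cast hcard
    _ ≤ _ := Nat.floor_le (by positivity)

theorem one_le_numSets (n : ℕ) (p : unitInterval) : 1 ≤ numSets n p := le_max_left _ _

theorem le_targetSize_numSets {p : unitInterval} (hp : 0 < p) (n : ℕ) :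
    (n : ℝ) ≤ targetSize p (numSets n p) := by
  have hp' : (0 : ℝ) < p := hp
  rw [targetSize, le_div_iff₀ hp']
  rcases Nat.eq_zero_or_pos n with rfl | hn
  · simp
  have : (0 : ℝ) < n := by exact_mod_cast hn
  calc (n : ℝ) * p = 2 ^ Real.logb 2 ((p : ℝ) * n) := by
        rw [Real.rpow_logb (by norm_num) (by norm_num) (by positivity), mul_comm]
    _ ≤ 2 ^ (numSets n p : ℝ) := by
        refine Real.rpow_le_rpow_of_exponent_le (by norm_num) ?_
        refine (Nat.le_ceil _).trans ?_
        exact_mod_cast le_max_right _ _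
    _ = 2 ^ numSets n p := Real.rpow_natCast _ _

theorem numSets_add_one_le {p : unitInterval} (n : ℕ) :
    (numSets n p : ℝ) + 1 ≤ 4 * max 1 (Real.log (p * n)) := by
  have one_le_max : (1 : ℝ) ≤ max 1 (Real.log (p * n)) := le_max_left _ _
  have log_le_max : Real.log (p * n) ≤ max 1 (Real.log (p * n)) := le_max_right _ _
  set M := max 1 (Real.log (p * n))
  have hlog2 : (0.5 : ℝ) ≤ Real.log 2 := by
    have := Real.log_two_gt_d9
    linarith
  have logb_le : Real.logb 2 ((p : ℝ) * n) ≤ 2 * M := by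
    rw [Real.logb, div_le_iff₀ (by linarith)]
    nlinarith
  rw [numSets]
  rcases le_total ⌈Real.logb 2 ((p : ℝ) * n)⌉₊ 1 with h | h
  · rw [max_eq_left h]
    push_cast
    linarith
  · rw [max_eq_right h]
    have hceil : (⌈Real.logb 2 ((p : ℝ) * n)⌉₊ : ℝ) < Real.logb 2 ((p : ℝ) * n) + 1 := by
      refine Nat.ceil_lt_add_one ?_
      by_contra hcon
      rw [Nat.ceil_eq_zero.2 (by linarith)] at h
      omega
    linarith

theorem mem_edgeSet_of_mem_asked_sortPrefix {q c : ℕ} (hc : 1 ≤ c) {sched : ℕ → ℕ}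
    (hsched : ∀ ℓ, sched ℓ ≤ q) {x : Equiv.Perm (Fin n)} {G : SimpleGraph (Fin n)}
    [DecidableRel G.Adj] {E : ℕ → Fin n → Fin n → Bool}
    (hV : ValidInput x (fun u v => decide (G.Adj u v)) E) {m : ℕ} (hm : m ≤ n) {e : Sym2 (Fin n)}
    (he : e ∈ (sortPrefix (fun u v => decide (G.Adj u v)) E q c sched m).asked (precedes x)) :
    e ∈ G.edgeSet := by
  obtain ⟨F, -, hF, hspec⟩ := sortPrefix_spec hV hc hsched hm
  obtain ⟨u, v, rfl, huv⟩ : IsEdge (fun u v => decide (G.Adj u v)) e := by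
    rcases hspec.asked e he with he | ⟨ℓ, -, he⟩
    · exact hF e he
    · exact he.isEdge hV
  exact of_decide_eq_true huv

theorem stochasticSort_correct {c : ℕ} (hc : 1 ≤ c) {p : unitInterval} {x : Equiv.Perm (Fin n)}
    {G : SimpleGraph (Fin n)} (T : Sym2 (Fin n) → Fin (numSets n p) → Bool) (hG : hamPath x ≤ G) :
    (stochasticSort c p G T).output (precedes x) = List.ofFn x ∧
      ∀ e ∈ (stochasticSort c p G T).asked (precedes x), e ∈ G.edgeSet := by
  classical
  have hV := validInput T hG
  refine ⟨output_sortAll hV hc (schedule_le _ p), fun e he => ?_⟩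
  rw [stochasticSort, asked_sortAll, Finset.mem_union] at he
  rcases he with he | he
  · exact mem_edgeSet_of_mem_asked_sortPrefix hc (schedule_le _ p) hV (by omega) he
  · exact mem_edgeSet_of_mem_asked_sortPrefix hc (schedule_le _ p) hV.reverse (by omega) he

end StochSort

/-! ### The random input -/

open MeasureTheory

/-- The event `A` is determined by the variables `Z e` with `e ∈ S`. -/
def DeterminedBy {Ω ι β : Type*} (Z : ι → Ω → β) (S : Set ι) (A : Ω → Prop) : Prop :=
  ∀ ω ω', (∀ e ∈ S, Z e ω = Z e ω') → (A ω ↔ A ω')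

namespace DeterminedBy

variable {Ω ι β : Type*} {Z : ι → Ω → β} {S T : Set ι} {A B : Ω → Prop}

theorem mono (h : DeterminedBy Z S A) (hST : S ⊆ T) : DeterminedBy Z T A :=
  fun ω ω' hω => h ω ω' fun e he => hω e (hST he)

theorem and (hA : DeterminedBy Z S A) (hB : DeterminedBy Z S B) :
    DeterminedBy Z S fun ω => A ω ∧ B ω :=
  fun ω ω' h => and_congr (hA ω ω' h) (hB ω ω' h)

theorem imp (hA : DeterminedBy Z S A) (hB : DeterminedBy Z S B) :
    DeterminedBy Z S fun ω => A ω → B ω :=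
  fun ω ω' h => imp_congr (hA ω ω' h) (hB ω ω' h)

theorem not (hA : DeterminedBy Z S A) : DeterminedBy Z S fun ω => ¬ A ω :=
  fun ω ω' h => not_congr (hA ω ω' h)

theorem all {τ : Sort*} {A : τ → Ω → Prop} (hA : ∀ t, DeterminedBy Z S (A t)) :
    DeterminedBy Z S fun ω => ∀ t, A t ω :=
  fun ω ω' h => forall_congr' fun t => hA t ω ω' h

theorem ex {τ : Sort*} {A : τ → Ω → Prop} (hA : ∀ t, DeterminedBy Z S (A t)) :
    DeterminedBy Z S fun ω => ∃ t, A t ω :=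
  fun ω₁ ω₂ h => exists_congr fun t => hA t ω₁ ω₂ h

theorem const_and {a : Prop} (hB : a → DeterminedBy Z S B) :
    DeterminedBy Z S fun ω => a ∧ B ω :=
  fun ω ω' h => and_congr_right fun ha => hB ha ω ω' h

theorem const_imp {a : Prop} (hB : a → DeterminedBy Z S B) :
    DeterminedBy Z S fun ω => a → B ω :=
  fun ω ω' h => imp_congr_right fun ha => hB ha ω ω' h

end DeterminedBy

namespace StochSort

/-- A random graph that contains the path `x 0, x 1, …, x (n - 1)`, with random edge sets
`E 1, …, E q`. Different vertex pairs are independent: what happens at the pair `e` is determined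
by the variable `Z e`. -/
structure PathModel {n : ℕ} {Ω β : Type*} [MeasurableSpace Ω] (μ : Measure Ω)
    (Z : Sym2 (Fin n) → Ω → β) (x : Equiv.Perm (Fin n)) (adj : Ω → Fin n → Fin n → Bool)
    (E : Ω → ℕ → Fin n → Fin n → Bool) (q : ℕ) (p : unitInterval) : Prop where
  p_pos : 0 < p
  n_le : (n : ℝ) ≤ targetSize p q
  valid : ∀ ω, ValidInput x (adj ω) (E ω)
  E_symm : ∀ ω k u v, E ω k u v = E ω k v u
  indep : ∀ S T A B, Disjoint S T → DeterminedBy Z S A → DeterminedBy Z T B →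
    μ.real {ω | A ω ∧ B ω} = μ.real {ω | A ω} * μ.real {ω | B ω}
  adj_det : ∀ u v, DeterminedBy Z {s(u, v)} fun ω => adj ω u v = true
  E_det : ∀ k u v, DeterminedBy Z {s(u, v)} fun ω => E ω k u v = true
  adj_eq : ∀ u v, u ≠ v → ¬ (hamPath x).Adj u v → μ.real {ω | adj ω u v = true} = p
  E_le : ∀ k u v, 1 ≤ k → k ≤ q → u ≠ v → ¬ (hamPath x).Adj u v →
    μ.real {ω | E ω k u v = true} ≤ 2 * p / 2 ^ k
  E_le' : ∀ k u v, 1 ≤ k → k ≤ q → u ≠ v → μ.real {ω | E ω k u v = true} ≤ 2 / 2 ^ k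
  le_E : ∀ k u v, 1 ≤ k → k ≤ q → u ≠ v → p / 2 ^ k ≤ μ.real {ω | E ω k u v = true}

theorem sum_Icc_div_two_pow_le {a : ℝ} (ha : 0 ≤ a) (k m : ℕ) :
    ∑ k' ∈ Finset.Icc k m, a / 2 ^ k' ≤ 2 * a / 2 ^ k := by
  rcases Nat.lt_or_ge m k with hkm | hkm
  · rw [Finset.Icc_eq_empty (by omega), Finset.sum_empty]
    positivity
  · suffices h : ∑ k' ∈ Finset.Icc k m, a / 2 ^ k' ≤ 2 * a / 2 ^ k - a / 2 ^ m by
      have : 0 ≤ a / 2 ^ m := by positivity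
      linarith
    induction m, hkm using Nat.le_induction with
    | base =>
      rw [Finset.Icc_self, Finset.sum_singleton]
      apply le_of_eq
      ring
    | succ m hkm ih =>
      rw [← Finset.insert_Icc_right_eq_Icc_add_one (by omega), Finset.sum_insert (by simp)]
      have : a / 2 ^ m = 2 * (a / 2 ^ (m + 1)) := by rw [pow_succ]; field_simp
      linarith

theorem card_pos_mem_Ico {n : ℕ} (x : Equiv.Perm (Fin n)) {a b : ℕ} (hb : b ≤ n) :
    (Finset.univ.filter fun v => a ≤ pos x v ∧ pos x v < b).card = b - a := by
  rw [← Nat.card_Ico]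
  refine Finset.card_nbij (pos x) (fun v hv => by simpa using hv) (pos_injective x).injOn
    fun d hd => ?_
  rw [Finset.coe_Ico, Set.mem_Ico] at hd
  obtain ⟨v, rfl⟩ := exists_pos_eq x (hd.2.trans_le hb)
  exact ⟨v, by simpa using hd, rfl⟩

theorem sum_pos_le {n : ℕ} (x : Equiv.Perm (Fin n)) (ℓ : ℕ) (f : ℕ → ℝ) (hf : ∀ j, 0 ≤ f j) :
    ∑ v ∈ Finset.univ.filter (fun v => ℓ ≤ pos x v), f (pos x v - ℓ) ≤
      ∑ j ∈ Finset.range n, f j := by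
  have hinj : Set.InjOn (fun v => pos x v - ℓ)
      (Finset.univ.filter fun v => ℓ ≤ pos x v : Finset (Fin n)) := by
    intro u hu v hv huv
    simp only [Finset.coe_filter, Finset.mem_univ, true_and, Set.mem_ofPred_eq] at hu hv huv
    exact pos_injective x (by omega)
  rw [← Finset.sum_image (f := f) hinj]
  refine Finset.sum_le_sum_of_subset_of_nonneg ?_ fun j _ _ => hf j
  intro j hj
  simp only [Finset.mem_image, Finset.mem_filter, Finset.mem_univ, true_and] at hj
  obtain ⟨v, -, rfl⟩ := hj
  have := pos_lt x v
  simp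
  omega

namespace PathModel

variable {n : ℕ} {Ω β : Type*} [MeasurableSpace Ω] {μ : Measure Ω} {Z : Sym2 (Fin n) → Ω → β}
  {x : Equiv.Perm (Fin n)}
  {adj : Ω → Fin n → Fin n → Bool} {E : Ω → ℕ → Fin n → Fin n → Bool} {q : ℕ} {p : unitInterval}

theorem prob_and_forall_le (M : PathModel μ Z x adj E q p) {τ : Type*}
    (T : Finset τ) {F : Ω → Prop} {A : τ → Ω → Prop} {S₀ : Set (Sym2 (Fin n))}
    {S : τ → Set (Sym2 (Fin n))} {r : τ → ℝ} (hF : DeterminedBy Z S₀ F)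
    (hA : ∀ t ∈ T, DeterminedBy Z (S t) (A t)) (hd : ∀ t ∈ T, Disjoint S₀ (S t))
    (hdd : ∀ t ∈ T, ∀ t' ∈ T, t ≠ t' → Disjoint (S t) (S t'))
    (hr : ∀ t ∈ T, μ.real {ω | A t ω} ≤ r t) :
    μ.real {ω | F ω ∧ ∀ t ∈ T, A t ω} ≤ μ.real {ω | F ω} * ∏ t ∈ T, r t := by
  classical
  induction T using Finset.induction_on with
  | empty => simp
  | insert t T ht ih =>
    have hset : {ω | F ω ∧ ∀ t' ∈ insert t T, A t' ω} =
        {ω | (F ω ∧ ∀ t' ∈ T, A t' ω) ∧ A t ω} := by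
      ext ω
      simp only [Finset.forall_mem_insert, Set.mem_ofPred_eq]
      tauto
    have hdet : DeterminedBy Z (S₀ ∪ ⋃ t' ∈ T, S t') fun ω => F ω ∧ ∀ t' ∈ T, A t' ω := by
      refine (hF.mono Set.subset_union_left).and ?_
      refine DeterminedBy.all fun t' => DeterminedBy.const_imp fun ht' => ?_
      refine (hA t' (Finset.mem_insert_of_mem ht')).mono ?_
      exact (Set.subset_biUnion_of_mem (u := S) ht').trans Set.subset_union_right
    have hdisj : Disjoint (S₀ ∪ ⋃ t' ∈ T, S t') (S t) := by
      rw [Set.disjoint_union_left, Set.disjoint_iUnion₂_left]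
      refine ⟨hd t (Finset.mem_insert_self _ _), fun t' ht' => ?_⟩
      exact hdd t' (Finset.mem_insert_of_mem ht') t (Finset.mem_insert_self _ _)
        (fun h => ht (h ▸ ht'))
    rw [hset, M.indep _ _ _ _ hdisj hdet (hA t (Finset.mem_insert_self _ _)),
      Finset.prod_insert ht, mul_left_comm, mul_comm]
    have hT := ih (fun t' ht' => hA t' (Finset.mem_insert_of_mem ht'))
      (fun t' ht' => hd t' (Finset.mem_insert_of_mem ht'))
      (fun a ha b hb => hdd a (Finset.mem_insert_of_mem ha) b (Finset.mem_insert_of_mem hb))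
      (fun t' ht' => hr t' (Finset.mem_insert_of_mem ht'))
    exact mul_le_mul (hr t (Finset.mem_insert_self _ _)) hT measureReal_nonneg
      (measureReal_nonneg.trans (hr t (Finset.mem_insert_self _ _)))

/-- The pairs that consist of `t` and an earlier vertex. -/
def earlierPairs (x : Equiv.Perm (Fin n)) (t : Fin n) : Set (Sym2 (Fin n)) :=
  {e | ∃ s, pos x s < pos x t ∧ e = s(s, t)}

theorem det_hasBlocker (M : PathModel μ Z x adj E q p) (k a : ℕ) (t : Fin n) :
    DeterminedBy Z (earlierPairs x t) fun ω => HasBlocker x (E ω) q k a t := by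
  refine DeterminedBy.ex fun k' => DeterminedBy.ex fun s => DeterminedBy.const_and fun _ =>
    DeterminedBy.const_and fun _ => DeterminedBy.const_and fun _ => DeterminedBy.const_and
      fun h => (M.E_det k' s t).mono ?_
  rintro e rfl
  exact ⟨s, h, rfl⟩

variable [IsProbabilityMeasure μ]

theorem prob_exists_ge_le {k : ℕ} {u v : Fin n} {a : ℝ} (ha0 : 0 ≤ a)
    (ha : ∀ k', k ≤ k' → k' ≤ q → μ.real {ω | E ω k' u v = true} ≤ a / 2 ^ k') :
    μ.real {ω | ∃ k', k ≤ k' ∧ k' ≤ q ∧ E ω k' u v = true} ≤ 2 * a / 2 ^ k := by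
  have hsub : {ω | ∃ k', k ≤ k' ∧ k' ≤ q ∧ E ω k' u v = true} ⊆
      ⋃ k' ∈ Finset.Icc k q, {ω | E ω k' u v = true} := by
    rintro ω ⟨k', hk, hkq, hE⟩
    simp only [Set.mem_iUnion, Finset.mem_Icc]
    exact ⟨k', ⟨hk, hkq⟩, hE⟩
  calc _ ≤ _ := measureReal_mono hsub (measure_ne_top _ _)
    _ ≤ ∑ k' ∈ Finset.Icc k q, μ.real {ω | E ω k' u v = true} := measureReal_biUnion_finset_le _ _
    _ ≤ ∑ k' ∈ Finset.Icc k q, a / 2 ^ k' := Finset.sum_le_sum fun k' hk' =>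
        ha k' (Finset.mem_Icc.1 hk').1 (Finset.mem_Icc.1 hk').2
    _ ≤ _ := sum_Icc_div_two_pow_le ha0 k q

theorem prob_edge_ge_le (M : PathModel μ Z x adj E q p) {k : ℕ} (hk : 1 ≤ k) {u v : Fin n}
    (huv : u ≠ v) (hh : ¬ (hamPath x).Adj u v) :
    μ.real {ω | ∃ k', k ≤ k' ∧ k' ≤ q ∧ E ω k' u v = true} ≤ 4 * p / 2 ^ k := by
  have hp : (0 : ℝ) < p := M.p_pos
  refine (prob_exists_ge_le (by positivity) fun k' hkk' hk'q =>
    M.E_le k' u v (hk.trans hkk') hk'q huv hh).trans_eq ?_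
  ring

theorem prob_path_edge_ge_le (M : PathModel μ Z x adj E q p) {k : ℕ} (hk : 1 ≤ k) {u v : Fin n}
    (huv : u ≠ v) :
    μ.real {ω | ∃ k', k ≤ k' ∧ k' ≤ q ∧ E ω k' u v = true} ≤ 4 / 2 ^ k := by
  refine (prob_exists_ge_le zero_le_two fun k' hkk' hk'q =>
    M.E_le' k' u v (hk.trans hkk') hk'q huv).trans_eq ?_
  ring

/- All earlier vertices are joined to `t` by non-path pairs, except the predecessor of `t`, which
accounts for the additional `4 / 2 ^ k`. -/
theorem prob_hasBlocker_le (M : PathModel μ Z x adj E q p) {k : ℕ} (hk : 1 ≤ k) (t : Fin n)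
    {a : ℕ} (ha : a ≤ pos x t) :
    μ.real {ω | HasBlocker x (E ω) q k a t} ≤ (4 * p * ((pos x t : ℝ) - a) + 4) / 2 ^ k := by
  have hp : (0 : ℝ) < p := M.p_pos
  set B := Finset.univ.filter fun s => a ≤ pos x s ∧ pos x s < pos x t with hB
  have hsub : {ω | HasBlocker x (E ω) q k a t} ⊆
      ⋃ s ∈ B, {ω | ∃ k', k ≤ k' ∧ k' ≤ q ∧ E ω k' s t = true} := by
    rintro ω ⟨k', s, hk, hkq, has, hst, hE⟩
    simp only [hB, Set.mem_iUnion, Finset.mem_filter, Finset.mem_univ, true_and]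
    exact ⟨s, ⟨has, hst⟩, k', hk, hkq, hE⟩
  have hterm : ∀ s ∈ B, μ.real {ω | ∃ k', k ≤ k' ∧ k' ≤ q ∧ E ω k' s t = true} ≤
      4 * p / 2 ^ k + if pos x s = pos x t - 1 then 4 / 2 ^ k else 0 := by
    intro s hs
    simp only [hB, Finset.mem_filter, Finset.mem_univ, true_and] at hs
    have hst : s ≠ t := by rintro rfl; omega
    split_ifs
    · exact (M.prob_path_edge_ge_le hk hst).trans (le_add_of_nonneg_left (by positivity))
    · rw [add_zero]
      refine M.prob_edge_ge_le hk hst ?_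
      rw [hamPath_adj]
      omega
  have hcard : (B.card : ℝ) ≤ (pos x t : ℝ) - a := by
    rw [← Nat.cast_sub ha]
    exact_mod_cast (card_pos_mem_Ico x (pos_lt x t).le).le
  have hcard_pred : ((B.filter fun s => pos x s = pos x t - 1).card : ℝ) ≤ 1 := by
    norm_cast
    refine Finset.card_le_one.2 fun u hu v hv => pos_injective x ?_
    exact (Finset.mem_filter.1 hu).2.trans (Finset.mem_filter.1 hv).2.symm
  calc _ ≤ _ := measureReal_mono hsub (measure_ne_top _ _)
    _ ≤ _ := measureReal_biUnion_finset_le _ _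
    _ ≤ _ := Finset.sum_le_sum hterm
    _ = B.card * (4 * p / 2 ^ k) +
        (B.filter fun s => pos x s = pos x t - 1).card * (4 / 2 ^ k) := by
      rw [Finset.sum_add_distrib, Finset.sum_const, nsmul_eq_mul, ← Finset.sum_filter,
        Finset.sum_const, nsmul_eq_mul]
    _ ≤ ((pos x t : ℝ) - a) * (4 * p / 2 ^ k) + 1 * (4 / 2 ^ k) := by gcongr
    _ = _ := by ring

/-- The pairs that decide whether `t` blocks `v`. -/
def blockingPairs (x : Equiv.Perm (Fin n)) (v t : Fin n) : Set (Sym2 (Fin n)) :=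
  insert s(t, v) (earlierPairs x t)

theorem notMem_earlierPairs {v t : Fin n} (ht : pos x t < pos x v) :
    s(t, v) ∉ earlierPairs x t := by
  rintro ⟨s, hs, h⟩
  rw [Sym2.eq_iff] at h
  rcases h with ⟨hts, -⟩ | ⟨-, hvs⟩ <;> subst_vars <;> omega

theorem disjoint_blockingPairs {v t t' : Fin n} (ht : pos x t < pos x v) (ht' : pos x t' < pos x v)
    (hne : t ≠ t') : Disjoint (blockingPairs x v t) (blockingPairs x v t') := by
  rw [Set.disjoint_left]
  rintro e (rfl | ⟨s, hs, rfl⟩) (he | ⟨s', hs', he⟩) <;> rw [Sym2.eq_iff] at he <;>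
    rcases he with ⟨h₁, h₂⟩ | ⟨h₁, h₂⟩ <;> subst_vars <;> omega

variable [DiscreteMeasurableSpace Ω]

theorem prob_imp_hasBlocker_le (M : PathModel μ Z x adj E q p) {A : Ω → Prop} {v t : Fin n}
    {k a : ℕ} {r : ℝ} (ht : pos x t < pos x v) (hA : DeterminedBy Z {s(t, v)} A)
    (hAr : 2 * r ≤ μ.real {ω | A ω}) (hk : 1 ≤ k) (ha : a ≤ pos x t) (hr : 0 ≤ r)
    (hsmall : (4 * p * ((pos x t : ℝ) - a) + 4) / 2 ^ k ≤ 1 / 2) :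
    μ.real {ω | A ω → HasBlocker x (E ω) q k a t} ≤ 1 - r := by
  have hset : {ω | A ω → HasBlocker x (E ω) q k a t} =
      {ω | A ω ∧ ¬ HasBlocker x (E ω) q k a t}ᶜ := by
    ext ω
    exact not_and_not_right.symm
  have hindep : μ.real {ω | A ω ∧ ¬ HasBlocker x (E ω) q k a t} =
      μ.real {ω | A ω} * μ.real {ω | ¬ HasBlocker x (E ω) q k a t} :=
    M.indep _ _ _ _ (Set.disjoint_singleton_left.2 (notMem_earlierPairs ht)) hA
      (M.det_hasBlocker k a t).not
  have hcompl : μ.real {ω | ¬ HasBlocker x (E ω) q k a t} =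
      1 - μ.real {ω | HasBlocker x (E ω) q k a t} :=
    probReal_compl_eq_one_sub (MeasurableSet.of_discrete (s := {ω | HasBlocker x (E ω) q k a t}))
  have hB := M.prob_hasBlocker_le hk t ha
  rw [hset, probReal_compl_eq_one_sub MeasurableSet.of_discrete, hindep]
  nlinarith

end PathModel

/-! ### The probability of being unblocked -/

/-- A function of `j` that is about `1` for `j ≤ σ` and decays rapidly for `j ≥ σ`. -/
noncomputable def decay (σ : ℝ) (j : ℕ) : ℝ := (σ / (σ + j)) ^ 4

theorem decay_nonneg (σ : ℝ) (j : ℕ) : 0 ≤ decay σ j :=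
  Even.pow_nonneg (by decide) _

/-- The bound on the probability that a vertex `j` positions after the last discovery is not
blocked at the levels from `i` on. -/
noncomputable def unblockedBound (p : unitInterval) (c i j : ℕ) : ℝ :=
  16 * (2 ^ c) ^ 4 * decay (targetSize p i) j

theorem unblockedBound_nonneg (p : unitInterval) (c i j : ℕ) : 0 ≤ unblockedBound p c i j :=
  mul_nonneg (by positivity) (decay_nonneg _ _)

theorem prod_one_sub_inv_pow {A j : ℕ} (hA : 1 ≤ A) (hAj : A < j) :
    ∏ d ∈ Finset.Ico (A + 1) j, (1 - 1 / (d : ℝ)) ^ 4 = (A / ((j : ℝ) - 1)) ^ 4 := by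
  induction j, hAj using Nat.le_induction with
  | base =>
    have : (A : ℝ) ≠ 0 := by positivity
    simp [this]
  | succ j hj ih =>
    have hj₀ : (j : ℝ) ≠ 0 := by
      have : 0 < j := by omega
      positivity
    have hj₁ : (j : ℝ) - 1 ≠ 0 := by
      have : (1 : ℝ) < j := by exact_mod_cast (by omega : 1 < j)
      linarith
    rw [Finset.prod_Ico_succ_top hj, ih, ← mul_pow,
      show ((j + 1 : ℕ) : ℝ) - 1 = j by push_cast; ring]
    congr 1
    field_simp

theorem prod_erase_one_sub_inv_pow_le {A j : ℕ} (hA : 1 ≤ A) (hAj : A < j) (d₀ : ℕ) :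
    ∏ d ∈ (Finset.Ico (A + 1) j).erase d₀, (1 - 1 / (d : ℝ)) ^ 4 ≤
      16 * (A / ((j : ℝ) - 1)) ^ 4 := by
  rw [← prod_one_sub_inv_pow hA hAj]
  by_cases hd₀ : d₀ ∈ Finset.Ico (A + 1) j
  · rw [← Finset.mul_prod_erase _ _ hd₀, ← mul_assoc]
    refine le_mul_of_one_le_left (Finset.prod_nonneg fun d _ => by positivity) ?_
    have hd₀' : (2 : ℝ) ≤ d₀ := by
      exact_mod_cast (by have := Finset.mem_Ico.1 hd₀; omega : 2 ≤ d₀)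
    have hinv : 1 / (d₀ : ℝ) ≤ 1 / 2 := one_div_le_one_div_of_le (by norm_num) hd₀'
    calc (1 : ℝ) = 16 * (1 / 2) ^ 4 := by norm_num
      _ ≤ 16 * (1 - 1 / (d₀ : ℝ)) ^ 4 := by gcongr; linarith
  · rw [Finset.erase_eq_of_notMem hd₀]
    exact le_mul_of_one_le_left (Finset.prod_nonneg fun d _ => by positivity) (by norm_num)

/-- The vertices between the positions `a` and `pos x v`, except possibly `x₀`. -/
def between {n : ℕ} (x : Equiv.Perm (Fin n)) (a : ℕ) (v x₀ : Fin n) : Finset (Fin n) :=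
  Finset.univ.filter fun t => (a < pos x t ∧ pos x t < pos x v) ∧ t ≠ x₀

theorem mem_between {n : ℕ} {x : Equiv.Perm (Fin n)} {a : ℕ} {v x₀ t : Fin n} :
    t ∈ between x a v x₀ ↔ (a < pos x t ∧ pos x t < pos x v) ∧ t ≠ x₀ := by
  simp [between]

theorem prod_between {n : ℕ} (x : Equiv.Perm (Fin n)) (ℓ A : ℕ) (v x₀ : Fin n) (f : ℕ → ℝ) :
    ∏ t ∈ between x (ℓ + A) v x₀, f (pos x t - ℓ) =
      ∏ d ∈ (Finset.Ico (A + 1) (pos x v - ℓ)).erase (pos x x₀ - ℓ), f d := by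
  refine Finset.prod_nbij (fun t => pos x t - ℓ) (fun t ht => ?_) (fun t ht t' ht' h => ?_)
    (fun d hd => ?_) fun _ _ => rfl
  · obtain ⟨ht, hne⟩ := mem_between.1 ht
    have := (pos_injective x).ne hne
    rw [Finset.mem_erase, Finset.mem_Ico]
    omega
  · have ht := mem_between.1 (Finset.mem_coe.1 ht)
    have ht' := mem_between.1 (Finset.mem_coe.1 ht')
    exact pos_injective x (by simp only at h; omega)
  · obtain ⟨hne, hd⟩ := Finset.mem_erase.1 (Finset.mem_coe.1 hd)
    rw [Finset.mem_Ico] at hd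
    obtain ⟨t, ht⟩ := exists_pos_eq x (k := ℓ + d) (by have := pos_lt x v; omega)
    refine ⟨t, Finset.mem_coe.2 (mem_between.2 ⟨by omega, ?_⟩), by simp [ht]⟩
    rintro rfl
    omega

/- The range of `t` starts beyond distance `σ * B / 16`, and the remaining product telescopes. -/
theorem prod_between_le_decay {n : ℕ} (x : Equiv.Perm (Fin n)) {ℓ : ℕ} (v x₀ : Fin n) {σ B : ℝ}
    (hσ : 2 ≤ σ) (hB : 2 ^ 8 ≤ B) :
    ∏ t ∈ between x (ℓ + ⌊σ * B / 16⌋₊) v x₀, (1 - 1 / ((pos x t - ℓ : ℕ) : ℝ)) ^ 4 ≤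
      16 * B ^ 4 * decay σ (pos x v - ℓ) := by
  rw [prod_between x ℓ _ v x₀ fun d => (1 - 1 / (d : ℝ)) ^ 4, decay, mul_assoc, ← mul_pow,
    ← mul_div_assoc]
  set A := ⌊σ * B / 16⌋₊ with hA
  generalize pos x v - ℓ = j
  generalize pos x x₀ - ℓ = d₀
  have hA_le : (A : ℝ) ≤ σ * B / 16 := Nat.floor_le (by positivity)
  have hA_one : 1 ≤ A := by
    rw [hA, Nat.one_le_floor_iff]
    nlinarith
  have : (0 : ℝ) ≤ j := by positivity
  rcases Nat.lt_or_ge (A + 1) j with hj | hj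
  · refine (prod_erase_one_sub_inv_pow_le hA_one (by omega) d₀).trans ?_
    have hj' : (A : ℝ) + 2 ≤ j := by exact_mod_cast hj
    have hA₀ : (0 : ℝ) ≤ A := by positivity
    have hbase : (A : ℝ) / (j - 1) ≤ B * σ / (σ + j) := by
      rw [div_le_div_iff₀ (by linarith) (by linarith)]
      have hσj : σ + j ≤ 3 * (j - 1) := by
        have := Nat.lt_floor_add_one (σ * B / 16)
        nlinarith
      have : 0 ≤ B * σ * (j - 1) := mul_nonneg (by positivity) (by linarith)
      calc (A : ℝ) * (σ + j) ≤ (σ * B / 16) * (3 * (j - 1)) := by gcongr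
        _ ≤ _ := by linarith
    have : (0 : ℝ) ≤ A / ((j : ℝ) - 1) := div_nonneg hA₀ (by linarith)
    gcongr
  · rw [Finset.Ico_eq_empty (by omega), Finset.erase_empty, Finset.prod_empty]
    have hj' : (j : ℝ) ≤ A + 1 := by exact_mod_cast hj
    have hbase : 1 ≤ B * σ / (σ + j) := by
      rw [le_div_iff₀ (by linarith), one_mul]
      nlinarith
    have := one_le_pow₀ hbase (n := 4)
    linarith

namespace PathModel

variable {n : ℕ} {Ω β : Type*} [MeasurableSpace Ω] {μ : Measure Ω} {Z : Sym2 (Fin n) → Ω → β}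
  {x : Equiv.Perm (Fin n)} {adj : Ω → Fin n → Fin n → Bool} {E : Ω → ℕ → Fin n → Fin n → Bool}
  {q : ℕ} {p : unitInterval} {c ℓ : ℕ} {R : ℕ → ℕ}

theorem det_imp_hasBlocker (M : PathModel μ Z x adj E q p) {A : Ω → Prop} {v t : Fin n}
    (hA : DeterminedBy Z {s(t, v)} A) (k a : ℕ) :
    DeterminedBy Z (blockingPairs x v t) fun ω => A ω → HasBlocker x (E ω) q k a t :=
  (hA.mono (Set.singleton_subset_iff.2 (Set.mem_insert _ _))).imp
    ((M.det_hasBlocker k a t).mono (Set.subset_insert _ _))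

theorem exists_blocking_level (M : PathModel μ Z x adj E q p) (hc : 8 ≤ c) {i d : ℕ} (hd : d < n)
    (hid : targetSize p (i + c) / 16 < d) :
    ∃ k, i < k ∧ k ≤ q ∧ targetSize p (k + c) / 32 < d ∧ (d : ℝ) ≤ targetSize p (k + c) / 16 := by
  classical
  have hq : (d : ℝ) ≤ targetSize p (q + c) / 16 := by
    have hdn : (d : ℝ) ≤ n := by exact_mod_cast hd.le
    have h2c : (2 : ℝ) ^ 8 ≤ 2 ^ c := pow_le_pow_right₀ (by norm_num) hc
    have := targetSize_pos M.p_pos q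
    have := M.n_le
    rw [targetSize_add]
    nlinarith
  have hex : ∃ k, (d : ℝ) ≤ targetSize p (k + c) / 16 := ⟨q, hq⟩
  obtain ⟨k, hk, hmin⟩ : ∃ k, (d : ℝ) ≤ targetSize p (k + c) / 16 ∧
      ∀ m, (d : ℝ) ≤ targetSize p (m + c) / 16 → k ≤ m :=
    ⟨Nat.find hex, Nat.find_spec hex, fun m hm => Nat.find_min' hex hm⟩
  have hik : i < k := by
    by_contra hcon
    have := targetSize_mono M.p_pos (by omega : k + c ≤ i + c)
    linarith
  refine ⟨k, hik, hmin q hq, ?_, hk⟩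
  by_contra hcon
  have hhalf : targetSize p (k + c) = 2 * targetSize p (k - 1 + c) := by
    rw [show k + c = k - 1 + c + 1 by omega, targetSize_add p _ 1]
    ring
  have := hmin (k - 1) (by linarith)
  omega

variable [IsProbabilityMeasure μ] [DiscreteMeasurableSpace Ω]

/- Bernoulli's inequality turns the bound `1 - 4 / d`, of order `p / 2 ^ k`, into the factor
`(1 - 1 / d) ^ 4`, for which the product over `d` telescopes. -/
theorem prob_edge_imp_hasBlocker_le (M : PathModel μ Z x adj E q p) (hc : 8 ≤ c)
    (hR : RecentlyRebuilt p q R ℓ) {v t : Fin n} (hℓ : ℓ < pos x t) (ht : pos x t < pos x v)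
    {k : ℕ} (hk : 1 ≤ k) (hkq : k ≤ q)
    (hlow : targetSize p (k + c) / 32 < ((pos x t - ℓ : ℕ) : ℝ))
    (hupp : ((pos x t - ℓ : ℕ) : ℝ) ≤ targetSize p (k + c) / 16) :
    μ.real {ω | E ω k t v = true → HasBlocker x (E ω) q (k + c) (R k) t} ≤
      (1 - 1 / ((pos x t - ℓ : ℕ) : ℝ)) ^ 4 := by
  have hp : (0 : ℝ) < p := M.p_pos
  have h2c : (2 : ℝ) ^ 8 ≤ 2 ^ c := pow_le_pow_right₀ (by norm_num) hc
  have h2k : (2 : ℝ) ^ 1 ≤ 2 ^ k := pow_le_pow_right₀ (by norm_num) hk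
  obtain ⟨hRℓ, hRsub⟩ := hR k hk hkq
  have hd₁ : (1 : ℝ) ≤ ((pos x t - ℓ : ℕ) : ℝ) := by exact_mod_cast (by omega : 1 ≤ pos x t - ℓ)
  have hpos : (pos x t : ℝ) = ((pos x t - ℓ : ℕ) : ℝ) + ℓ := by
    rw [Nat.cast_sub hℓ.le, sub_add_cancel]
  generalize ((pos x t - ℓ : ℕ) : ℝ) = d at *
  have hbern : 1 - 4 / d ≤ (1 - 1 / d) ^ 4 := by
    have : 1 / d ≤ 1 := (div_le_one (by linarith)).2 hd₁
    calc 1 - 4 / d = 1 + ((4 : ℕ) : ℝ) * -(1 / d) := by push_cast; ring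
      _ ≤ (1 + -(1 / d)) ^ 4 := one_add_mul_le_pow (by linarith) 4
      _ = _ := by ring
  refine (M.prob_imp_hasBlocker_le ht (M.E_det k t v) ?_ (by omega) (by omega)
    (by positivity) ?_).trans hbern
  · refine le_trans ?_ (M.le_E k t v hk hkq (by rintro rfl; omega))
    rw [targetSize, div_div, pow_add, div_lt_iff₀ (by positivity)] at hlow
    rw [← mul_div_assoc, div_le_div_iff₀ (by linarith) (by positivity)]
    nlinarith
  · rw [hpos, div_le_iff₀ (by positivity)]
    have hfar : 4 * p * (targetSize p (k + c) / 16) = 2 ^ (k + c) / 4 := by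
      rw [targetSize]; field_simp; ring
    have hnear : 4 * p * (targetSize p k / 32 + 2) = 2 ^ k / 8 + 8 * (p : ℝ) := by
      rw [targetSize]; field_simp; ring
    have hsum : 4 * p * (d + ℓ - R k) ≤
        4 * p * (targetSize p (k + c) / 16) + 4 * p * (targetSize p k / 32 + 2) := by
      rw [← mul_add]
      gcongr
      linarith
    rw [hfar, hnear, pow_add] at hsum
    rw [pow_add]
    nlinarith [p.2.2]

/- Each vertex `t` far from `ℓ` is assigned the level `κ t` at which it is likely to block `v`; the
events that `t` does not do so depend on disjoint sets of pairs. -/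
theorem prob_and_unblocked_le_prod (M : PathModel μ Z x adj E q p) (hc : 8 ≤ c) {i : ℕ} (hi : 1 ≤ i)
    (hR : RecentlyRebuilt p q R ℓ) {v x₀ : Fin n} {F : Ω → Prop} {S₀ : Set (Sym2 (Fin n))}
    (hF : DeterminedBy Z S₀ F) {A : ℕ} (hA : targetSize p (i + c) / 16 < A + 1)
    (hS₀ : ∀ t ∈ between x (ℓ + A) v x₀, Disjoint S₀ (blockingPairs x v t)) :
    μ.real {ω | F ω ∧ Unblocked x (E ω) q c R ℓ i v} ≤
      μ.real {ω | F ω} * ∏ t ∈ between x (ℓ + A) v x₀, (1 - 1 / ((pos x t - ℓ : ℕ) : ℝ)) ^ 4 := by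
  have hlevel : ∀ t ∈ between x (ℓ + A) v x₀, ∃ k, i < k ∧ k ≤ q ∧
      targetSize p (k + c) / 32 < ((pos x t - ℓ : ℕ) : ℝ) ∧
      ((pos x t - ℓ : ℕ) : ℝ) ≤ targetSize p (k + c) / 16 := by
    intro t ht
    have ht := mem_between.1 ht
    have : (A : ℝ) + 1 ≤ ((pos x t - ℓ : ℕ) : ℝ) := by exact_mod_cast (by omega)
    exact M.exists_blocking_level hc (lt_of_le_of_lt (Nat.sub_le _ _) (pos_lt x t)) (by linarith)
  choose! κ hκ using hlevel
  have hsub : {ω | F ω ∧ Unblocked x (E ω) q c R ℓ i v} ⊆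
      {ω | F ω ∧ ∀ t ∈ between x (ℓ + A) v x₀,
        E ω (κ t) t v = true → HasBlocker x (E ω) q (κ t + c) (R (κ t)) t} := by
    rintro ω ⟨hFω, hub⟩
    refine ⟨hFω, fun t ht => ?_⟩
    have htv := (mem_between.1 ht).1
    exact hub (κ t) (hκ t ht).1.le (hκ t ht).2.1 t (by omega) htv.2
  refine (measureReal_mono hsub (measure_ne_top _ _)).trans ?_
  refine M.prob_and_forall_le _ (S := blockingPairs x v) hF
    (fun t _ => M.det_imp_hasBlocker (M.E_det (κ t) t v) _ _) hS₀ ?_ ?_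
  · intro t ht t' ht' hne
    exact disjoint_blockingPairs (mem_between.1 ht).1.2 (mem_between.1 ht').1.2 hne
  · intro t ht
    obtain ⟨hik, hkq, hlow, hupp⟩ := hκ t ht
    have htv := (mem_between.1 ht).1
    exact M.prob_edge_imp_hasBlocker_le hc hR (by omega) htv.2 (by omega) hkq hlow hupp

theorem prob_and_unblocked_le (M : PathModel μ Z x adj E q p) (hc : 8 ≤ c) {i : ℕ} (hi : 1 ≤ i)
    (hR : RecentlyRebuilt p q R ℓ) {v : Fin n} (x₀ : Fin n) {F : Ω → Prop}
    {S₀ : Set (Sym2 (Fin n))} (hF : DeterminedBy Z S₀ F)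
    (hS₀ : ∀ t, targetSize p (i + c) / 16 < (pos x t : ℝ) - ℓ → pos x t < pos x v → t ≠ x₀ →
      Disjoint S₀ (blockingPairs x v t)) :
    μ.real {ω | F ω ∧ Unblocked x (E ω) q c R ℓ i v} ≤
      μ.real {ω | F ω} * unblockedBound p c i (pos x v - ℓ) := by
  have hA : targetSize p (i + c) / 16 < ⌊targetSize p (i + c) / 16⌋₊ + 1 :=
    Nat.lt_floor_add_one _
  refine (M.prob_and_unblocked_le_prod hc hi hR (x₀ := x₀) hF hA fun t ht => ?_).trans ?_
  · obtain ⟨⟨hℓ, htv⟩, hne⟩ := mem_between.1 ht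
    have : (ℓ : ℝ) + ⌊targetSize p (i + c) / 16⌋₊ + 1 ≤ pos x t := by exact_mod_cast hℓ
    exact hS₀ t (by linarith) htv hne
  · rw [targetSize_add, unblockedBound]
    gcongr
    exact prod_between_le_decay x v x₀ (two_le_targetSize M.p_pos hi)
      (pow_le_pow_right₀ (by norm_num) hc)

end PathModel

/-! ### The probability of surviving the search -/

section Decay

variable {σ : ℝ}

theorem ratio_nonneg (hσ : 1 ≤ σ) (j : ℕ) : 0 ≤ σ / (σ + j) := by positivity

theorem ratio_le_one (hσ : 1 ≤ σ) (j : ℕ) : σ / (σ + j) ≤ 1 := by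
  rw [div_le_one (by positivity)]
  exact le_add_of_nonneg_right j.cast_nonneg

/- `∑ σ ^ 2 / (σ + j) ^ 2` is dominated by the telescoping sum with terms
`σ ^ 2 / ((σ + j) ^ 2 - 1 / 4)`. -/
theorem sum_ratio_sq_le (hσ : 1 ≤ σ) (n : ℕ) :
    ∑ j ∈ Finset.range n, (σ / (σ + j)) ^ 2 ≤ 2 * σ := by
  have hterm (j : ℕ) : (σ / (σ + j)) ^ 2 ≤
      σ ^ 2 / (σ + j - 1 / 2) - σ ^ 2 / (σ + (j + 1 : ℕ) - 1 / 2) := by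
    have : (0 : ℝ) ≤ j := j.cast_nonneg
    have h₀ : σ + j - 1 / 2 ≠ 0 := by linarith
    have h₁ : σ + ((j + 1 : ℕ) : ℝ) - 1 / 2 ≠ 0 := by push_cast; linarith
    have h₂ : (σ + j) ^ 2 - 1 / 4 ≠ 0 := by nlinarith
    calc (σ / (σ + j)) ^ 2 ≤ σ ^ 2 / ((σ + j) ^ 2 - 1 / 4) := by
          rw [div_pow]
          exact div_le_div_of_nonneg_left (by positivity) (by nlinarith) (by linarith)
      _ = _ := by
          rw [div_sub_div _ _ h₀ h₁, div_eq_div_iff h₂ (mul_ne_zero h₀ h₁)]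
          push_cast
          ring
  have hlast : 0 ≤ σ ^ 2 / (σ + n - 1 / 2) :=
    div_nonneg (by positivity) (by have : (0 : ℝ) ≤ n := n.cast_nonneg; linarith)
  calc _ ≤ _ := Finset.sum_le_sum fun j _ => hterm j
    _ = σ ^ 2 / (σ - 1 / 2) - σ ^ 2 / (σ + n - 1 / 2) := by
        rw [Finset.sum_range_sub' fun j : ℕ => σ ^ 2 / (σ + j - 1 / 2), Nat.cast_zero, add_zero]
    _ ≤ σ ^ 2 / (σ - 1 / 2) := sub_le_self _ hlast
    _ ≤ 2 * σ := by
        rw [div_le_iff₀ (by linarith)]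
        nlinarith

theorem decay_le_sq (hσ : 1 ≤ σ) (j : ℕ) : decay σ j ≤ (σ / (σ + j)) ^ 2 :=
  pow_le_pow_of_le_one (ratio_nonneg hσ j) (ratio_le_one hσ j) (by norm_num)

theorem sum_decay_le (hσ : 1 ≤ σ) (n : ℕ) : ∑ j ∈ Finset.range n, decay σ j ≤ 2 * σ :=
  (Finset.sum_le_sum fun j _ => decay_le_sq hσ j).trans (sum_ratio_sq_le hσ n)

theorem mul_decay_le (hσ : 1 ≤ σ) (j : ℕ) : (j : ℝ) * decay σ j ≤ σ * (σ / (σ + j)) ^ 2 := by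
  have := ratio_nonneg hσ j
  have h₁ := ratio_le_one hσ j
  have hj : (j : ℝ) * (σ / (σ + j)) ≤ σ := by
    rw [mul_div_assoc', div_le_iff₀ (by positivity)]
    have : (0 : ℝ) ≤ j := j.cast_nonneg
    nlinarith
  calc (j : ℝ) * decay σ j = (j * (σ / (σ + j))) * ((σ / (σ + j)) * (σ / (σ + j)) ^ 2) := by
        rw [decay]; ring
    _ ≤ σ * (1 * (σ / (σ + j)) ^ 2) := by gcongr
    _ = _ := by ring

theorem sum_mul_decay_le (hσ : 1 ≤ σ) (n : ℕ) :
    ∑ j ∈ Finset.range n, (j : ℝ) * decay σ j ≤ 2 * σ ^ 2 := by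
  calc _ ≤ ∑ j ∈ Finset.range n, σ * (σ / (σ + j)) ^ 2 :=
        Finset.sum_le_sum fun j _ => mul_decay_le hσ j
    _ = σ * ∑ j ∈ Finset.range n, (σ / (σ + j)) ^ 2 := by rw [Finset.mul_sum]
    _ ≤ σ * (2 * σ) := by
        have := sum_ratio_sq_le hσ n
        gcongr
    _ = _ := by ring

theorem sum_mul_decay_le_mul (hσ : 1 ≤ σ) (n : ℕ) :
    ∑ j ∈ Finset.range n, (j : ℝ) * decay σ j ≤ n * (2 * σ) := by
  calc _ ≤ ∑ j ∈ Finset.range n, (n : ℝ) * decay σ j := by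
        refine Finset.sum_le_sum fun j hj => ?_
        have hjn : (j : ℝ) ≤ n := by exact_mod_cast (Finset.mem_range.1 hj).le
        have := decay_nonneg σ j
        gcongr
    _ = n * ∑ j ∈ Finset.range n, decay σ j := by rw [Finset.mul_sum]
    _ ≤ _ := by
        have := sum_decay_le hσ n
        gcongr

theorem exp_one_sub_div_le_decay (hσ : 1 ≤ σ) (j : ℕ) :
    Real.exp (1 - j / σ) ≤ 216 * decay σ j := by
  have hdecay : decay σ j = 1 / (1 + j / σ) ^ 4 := by
    rw [decay, show (1 : ℝ) + j / σ = (σ + j) / σ by field_simp, div_pow, div_pow, one_div_div]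
  have hpow : (1 + j / σ) ^ 4 ≤ Real.exp (1 + j / σ) * 24 := by
    have := Real.pow_div_factorial_le_exp (x := 1 + j / σ) (by positivity) 4
    rwa [show (Nat.factorial 4 : ℝ) = 24 by norm_num [Nat.factorial],
      div_le_iff₀ (by norm_num)] at this
  have hexp : Real.exp (1 - j / σ) * Real.exp (1 + j / σ) = Real.exp 1 ^ 2 := by
    rw [← Real.exp_add, ← Real.exp_nat_mul]
    congr 1
    push_cast
    ring
  have hexp_one : Real.exp 1 < 3 := Real.exp_one_lt_d9.trans (by norm_num)
  rw [hdecay, mul_one_div, le_div_iff₀ (by positivity)]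
  calc Real.exp (1 - j / σ) * (1 + j / σ) ^ 4
      ≤ Real.exp (1 - j / σ) * (Real.exp (1 + j / σ) * 24) := by gcongr
    _ = Real.exp 1 ^ 2 * 24 := by rw [← mul_assoc, hexp]
    _ ≤ 3 ^ 2 * 24 := by gcongr
    _ = 216 := by norm_num

end Decay

/-- The scale at which the probability that a vertex survives the search decays. -/
noncomputable def survivalScale (p : unitInterval) (c : ℕ) : ℝ := 4 * 2 ^ c / p

/-- A bound on the probability that the vertex `j` positions after the last discovered one survives
the search for the next vertex. -/
noncomputable def survivalBound (p : unitInterval) (c j : ℕ) : ℝ :=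
  216 * decay (survivalScale p c) j

section SurvivalScale

variable {p : unitInterval} {c j r : ℕ}

theorem one_le_survivalScale (hp : 0 < p) (c : ℕ) : 1 ≤ survivalScale p c := by
  have hp' : (0 : ℝ) < p := hp
  have h2c : (1 : ℝ) ≤ 2 ^ c := one_le_pow₀ (by norm_num)
  rw [survivalScale, le_div_iff₀ hp']
  linarith [p.2.2]

theorem survivalBound_nonneg (p : unitInterval) (c j : ℕ) : 0 ≤ survivalBound p c j :=
  mul_nonneg (by norm_num) (decay_nonneg _ j)

theorem one_le_survivalBound (hp : 0 < p) (hr : r < 5)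
    (hj : (j : ℝ) ≤ targetSize p (r + c) / 16) : 1 ≤ survivalBound p c j := by
  have hp' : (0 : ℝ) < p := hp
  refine le_trans (Real.one_le_exp ?_) (exp_one_sub_div_le_decay (one_le_survivalScale hp c) j)
  have hjr : (j : ℝ) / survivalScale p c ≤ 2 ^ r / 64 := by
    rw [survivalScale, div_le_iff₀ (by positivity)]
    refine hj.trans_eq ?_
    rw [targetSize, pow_add]
    field_simp
    ring
  have : (2 : ℝ) ^ r ≤ 2 ^ 4 := pow_le_pow_right₀ (by norm_num) (by omega)
  linarith

theorem one_sub_half_pow_le_survivalBound (hp : 0 < p) {N : ℕ}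
    (hN : (j : ℝ) / (2 * 2 ^ c) - 2 ≤ N) :
    (1 - (p : ℝ) / 2) ^ N ≤ survivalBound p c j := by
  have hp' : (0 : ℝ) < p := hp
  have hp₁ : (p : ℝ) ≤ 1 := p.2.2
  have hscale : (j : ℝ) / survivalScale p c = p / 2 * (j / (2 * 2 ^ c)) := by
    rw [survivalScale]
    field_simp
    ring
  calc (1 - (p : ℝ) / 2) ^ N ≤ Real.exp (-(p / 2)) ^ N :=
        pow_le_pow_left₀ (by linarith) (Real.one_sub_le_exp_neg _) _
    _ ≤ Real.exp (1 - j / survivalScale p c) := by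
        rw [← Real.exp_nat_mul, Real.exp_le_exp, hscale]
        nlinarith
    _ ≤ _ := exp_one_sub_div_le_decay (one_le_survivalScale hp c) j

end SurvivalScale

/- The vertices of `T` lie among the first `targetSize p (r - 1) / 16` positions after `ℓ`. -/
theorem exists_card_ge_near {n : ℕ} {x : Equiv.Perm (Fin n)} {p : unitInterval} {c ℓ r : ℕ}
    {y : Fin n} (hr : 1 ≤ r) (hy : ℓ < pos x y)
    (hnear : ((pos x y - ℓ : ℕ) : ℝ) ≤ targetSize p (r + c) / 16) (x₀ : Fin n) :
    ∃ T : Finset (Fin n), ((pos x y - ℓ : ℕ) : ℝ) / (2 * 2 ^ c) - 2 ≤ T.card ∧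
      ∀ t ∈ T, t ≠ x₀ ∧ ℓ ≤ pos x t ∧ pos x t + 1 < pos x y ∧
        pos x t - ℓ ≤ ⌊targetSize p (r - 1) / 16⌋₊ := by
  classical
  set j := pos x y - ℓ
  set b := ⌊targetSize p (r - 1) / 16⌋₊
  set m := min (j - 1) (b + 1) with hm
  refine ⟨(Finset.univ.filter fun t => ℓ ≤ pos x t ∧ pos x t < ℓ + m).erase x₀, ?_, ?_⟩
  · have hcard := card_pos_mem_Ico x (a := ℓ) (b := ℓ + m) (by have := pos_lt x y; omega)
    have herase := Finset.pred_card_le_card_erase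
      (s := Finset.univ.filter fun t => ℓ ≤ pos x t ∧ pos x t < ℓ + m) (a := x₀)
    have hm_le : (m : ℝ) ≤ ((Finset.univ.filter fun t => ℓ ≤ pos x t ∧ pos x t < ℓ + m).erase
        x₀).card + 1 := by exact_mod_cast (by omega)
    have hle_m : (j : ℝ) / (2 * 2 ^ c) - 1 ≤ m := by
      rw [hm, Nat.cast_min, le_min_iff]
      constructor
      · have hpred : (j : ℝ) ≤ ((j - 1 : ℕ) : ℝ) + 1 := by exact_mod_cast (by omega)
        have h2c : (1 : ℝ) ≤ 2 ^ c := one_le_pow₀ (by norm_num)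
        have : (j : ℝ) / (2 * 2 ^ c) ≤ j := div_le_self (by positivity) (by linarith)
        linarith
      · have hfloor : targetSize p (r - 1) / 16 < b + 1 := Nat.lt_floor_add_one _
        have : (j : ℝ) / (2 * 2 ^ c) ≤ targetSize p (r - 1) / 16 := by
          rw [div_le_iff₀ (by positivity)]
          refine hnear.trans_eq ?_
          rw [targetSize_add, ← Nat.sub_add_cancel hr, targetSize_add, Nat.add_sub_cancel]
          ring
        push_cast
        linarith
    linarith
  · intro t ht
    simp only [Finset.mem_erase, Finset.mem_filter, Finset.mem_univ, true_and] at ht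
    exact ⟨ht.1, ht.2.1, by omega, by omega⟩

namespace PathModel

variable {n : ℕ} {Ω β : Type*} [MeasurableSpace Ω] {μ : Measure Ω} {Z : Sym2 (Fin n) → Ω → β}
  {x : Equiv.Perm (Fin n)} {adj : Ω → Fin n → Fin n → Bool} {E : Ω → ℕ → Fin n → Fin n → Bool}
  {q : ℕ} {p : unitInterval} {c ℓ : ℕ} [IsProbabilityMeasure μ] [DiscreteMeasurableSpace Ω]
  {r : ℕ} {y : Fin n}

theorem prob_adj_imp_hasBlocker_le (M : PathModel μ Z x adj E q p) (hr : 5 ≤ r) {t : Fin n}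
    (hℓ : ℓ ≤ pos x t) (ht : pos x t + 1 < pos x y)
    (hnear : pos x t - ℓ ≤ ⌊targetSize p (r - 1) / 16⌋₊) :
    μ.real {ω | adj ω t y = true → HasBlocker x (E ω) q (r - 1) ℓ t} ≤ 1 - (p : ℝ) / 2 := by
  have hp : (0 : ℝ) < p := M.p_pos
  refine M.prob_imp_hasBlocker_le (by omega) (M.adj_det t y) ?_ (by omega) hℓ (by positivity) ?_
  · rw [M.adj_eq t y (by rintro rfl; omega) (by rw [hamPath_adj]; omega)]
    linarith
  · rw [← Nat.cast_sub hℓ, div_le_iff₀ (by positivity)]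
    have hdist : ((pos x t - ℓ : ℕ) : ℝ) ≤ targetSize p (r - 1) / 16 :=
      (Nat.cast_le.2 hnear).trans
        (Nat.floor_le (div_nonneg (targetSize_pos M.p_pos _).le (by norm_num)))
    have hsize : 4 * p * (targetSize p (r - 1) / 16) = 2 ^ (r - 1) / 4 := by
      rw [targetSize]; field_simp; ring
    have hmul : 4 * p * ((pos x t - ℓ : ℕ) : ℝ) ≤ 4 * p * (targetSize p (r - 1) / 16) := by gcongr
    have : (2 : ℝ) ^ 4 ≤ 2 ^ (r - 1) := pow_le_pow_right₀ (by norm_num) (by omega)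
    linarith

theorem prob_and_survives_le (M : PathModel μ Z x adj E q p) (hy : ℓ < pos x y)
    (hnear : ((pos x y - ℓ : ℕ) : ℝ) ≤ targetSize p (r + c) / 16) (x₀ : Fin n) {F : Ω → Prop}
    {S₀ : Set (Sym2 (Fin n))} (hF : DeterminedBy Z S₀ F)
    (hS₀ : ∀ t, ℓ ≤ pos x t → pos x t + 1 < pos x y → t ≠ x₀ →
      Disjoint S₀ (blockingPairs x y t)) :
    μ.real {ω | F ω ∧ Survives x (adj ω) (E ω) q ℓ r y} ≤
      μ.real {ω | F ω} * survivalBound p c (pos x y - ℓ) := by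
  rcases Nat.lt_or_ge r 5 with hr | hr
  · calc _ ≤ μ.real {ω | F ω} := measureReal_mono (fun ω h => h.1) (measure_ne_top _ _)
      _ ≤ _ := le_mul_of_one_le_right measureReal_nonneg
        (one_le_survivalBound M.p_pos hr hnear)
  · obtain ⟨T, hcard, hT⟩ := exists_card_ge_near (by omega) hy hnear x₀
    have hsub : {ω | F ω ∧ Survives x (adj ω) (E ω) q ℓ r y} ⊆ {ω | F ω ∧ ∀ t ∈ T,
        adj ω t y = true → HasBlocker x (E ω) q (r - 1) ℓ t} := by
      rintro ω ⟨hFω, hsurv⟩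
      refine ⟨hFω, fun t ht => ?_⟩
      obtain ⟨-, hℓ, hty, -⟩ := hT t ht
      exact hsurv (by omega) t hℓ (by omega)
    calc _ ≤ _ := measureReal_mono hsub (measure_ne_top _ _)
      _ ≤ μ.real {ω | F ω} * ∏ t ∈ T, (1 - (p : ℝ) / 2) := by
        refine M.prob_and_forall_le T (S := blockingPairs x y) hF
          (fun t _ => M.det_imp_hasBlocker (M.adj_det t y) _ _) ?_ ?_ ?_
        · intro t ht
          obtain ⟨hne, hℓ, hty, -⟩ := hT t ht
          exact hS₀ t hℓ hty hne
        · intro t ht t' ht' hne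
          exact disjoint_blockingPairs (by have := hT t ht; omega) (by have := hT t' ht'; omega) hne
        · intro t ht
          obtain ⟨-, hℓ, hty, hfloor⟩ := hT t ht
          exact M.prob_adj_imp_hasBlocker_le hr hℓ hty hfloor
      _ ≤ _ := by
        rw [Finset.prod_const]
        exact mul_le_mul_of_nonneg_left (one_sub_half_pow_le_survivalBound M.p_pos hcard)
          measureReal_nonneg

end PathModel

/-! ### The cost of the levels -/

section UnblockedBound

variable {p : unitInterval} {i : ℕ}

theorem sum_unblockedBound_le (hp : 0 < p) (hi : 1 ≤ i) (c n : ℕ) :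
    ∑ j ∈ Finset.range n, unblockedBound p c i j ≤ 32 * (2 ^ c) ^ 4 * targetSize p i := by
  have := sum_decay_le (one_le_two.trans (two_le_targetSize hp hi)) n
  calc _ = 16 * (2 ^ c) ^ 4 * ∑ j ∈ Finset.range n, decay (targetSize p i) j :=
        (Finset.mul_sum _ _ _).symm
    _ ≤ 16 * (2 ^ c) ^ 4 * (2 * targetSize p i) := by gcongr
    _ = _ := by ring

theorem sum_mul_unblockedBound (p : unitInterval) (c i n : ℕ) :
    ∑ j ∈ Finset.range n, (j : ℝ) * unblockedBound p c i j =
      16 * (2 ^ c) ^ 4 * ∑ j ∈ Finset.range n, (j : ℝ) * decay (targetSize p i) j := by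
  rw [Finset.mul_sum]
  exact Finset.sum_congr rfl fun j _ => mul_left_comm _ _ _

theorem sum_mul_unblockedBound_le_sq (hp : 0 < p) (hi : 1 ≤ i) (c n : ℕ) :
    ∑ j ∈ Finset.range n, (j : ℝ) * unblockedBound p c i j ≤
      32 * (2 ^ c) ^ 4 * targetSize p i ^ 2 := by
  have := sum_mul_decay_le (one_le_two.trans (two_le_targetSize hp hi)) n
  calc _ = _ := sum_mul_unblockedBound p c i n
    _ ≤ 16 * (2 ^ c) ^ 4 * (2 * targetSize p i ^ 2) := by gcongr
    _ = _ := by ring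

theorem sum_mul_unblockedBound_le_mul (hp : 0 < p) (hi : 1 ≤ i) (c n : ℕ) :
    ∑ j ∈ Finset.range n, (j : ℝ) * unblockedBound p c i j ≤
      32 * (2 ^ c) ^ 4 * (n * targetSize p i) := by
  have := sum_mul_decay_le_mul (one_le_two.trans (two_le_targetSize hp hi)) n
  calc _ = _ := sum_mul_unblockedBound p c i n
    _ ≤ 16 * (2 ^ c) ^ 4 * (n * (2 * targetSize p i)) := by gcongr
    _ = _ := by ring

end UnblockedBound

section PairMass

variable {n : ℕ}

open Classical in
/-- The vertex pairs that are not edges of the path `x 0, x 1, …, x (n - 1)`. -/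
noncomputable def offPath (x : Equiv.Perm (Fin n)) : Finset (Sym2 (Fin n)) :=
  Finset.univ.filter fun e => e ∉ (hamPath x).edgeSet

theorem mem_offPath {x : Equiv.Perm (Fin n)} {u v : Fin n} :
    s(u, v) ∈ offPath x ↔ ¬ (hamPath x).Adj u v := by
  simp [offPath]

/-- The expected number of pairs off the path that have the random property `Q`. -/
noncomputable def pairMass {Ω : Type*} [MeasurableSpace Ω] (μ : Measure Ω)
    (x : Equiv.Perm (Fin n)) (Q : Ω → Sym2 (Fin n) → Prop) : ℝ :=
  ∑ e ∈ offPath x, μ.real {ω | Q ω e}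

theorem pairMass_le {Ω ι : Type*} [MeasurableSpace Ω] {μ : Measure Ω} [IsProbabilityMeasure μ]
    {x : Equiv.Perm (Fin n)} {Q : Ω → Sym2 (Fin n) → Prop} {I : Finset ι} {f : ι → Sym2 (Fin n)}
    {A : ι → Ω → Prop} {B : ι → ℝ} (hQ : ∀ ω, ∀ e ∈ offPath x, Q ω e → ∃ a ∈ I, e = f a ∧ A a ω)
    (hB₀ : ∀ a ∈ I, 0 ≤ B a) (hB : ∀ a ∈ I, f a ∈ offPath x → μ.real {ω | A a ω} ≤ B a) :
    pairMass μ x Q ≤ ∑ a ∈ I, B a := by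
  classical
  have hle : ∀ e ∈ offPath x, μ.real {ω | Q ω e} ≤ ∑ a ∈ I, if f a = e then B a else 0 := by
    intro e he
    have hsub : {ω | Q ω e} ⊆ ⋃ a ∈ I.filter fun a => f a = e, {ω | A a ω} := by
      intro ω hω
      obtain ⟨a, ha, rfl, hA⟩ := hQ ω e he hω
      simp only [Set.mem_iUnion, Finset.mem_filter]
      exact ⟨a, ⟨ha, rfl⟩, hA⟩
    refine (measureReal_mono hsub (measure_ne_top _ _)).trans
      ((measureReal_biUnion_finset_le _ _).trans ?_)
    rw [← Finset.sum_filter]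
    refine Finset.sum_le_sum fun a ha => ?_
    obtain ⟨haI, rfl⟩ := Finset.mem_filter.1 ha
    exact hB a haI he
  refine (Finset.sum_le_sum hle).trans ?_
  rw [Finset.sum_comm]
  refine Finset.sum_le_sum fun a ha => ?_
  rw [Finset.sum_ite_eq]
  split_ifs
  · exact le_rfl
  · exact hB₀ a ha

/-- The pairs of vertices in positions at least `ℓ`, listed in their true order. -/
def laterPairs (x : Equiv.Perm (Fin n)) (ℓ : ℕ) : Finset (Fin n × Fin n) :=
  Finset.univ.filter fun ab => ℓ ≤ pos x ab.1 ∧ pos x ab.1 < pos x ab.2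

theorem mem_laterPairs {x : Equiv.Perm (Fin n)} {ℓ : ℕ} {ab : Fin n × Fin n} :
    ab ∈ laterPairs x ℓ ↔ ℓ ≤ pos x ab.1 ∧ pos x ab.1 < pos x ab.2 := by
  simp [laterPairs]

theorem sum_laterPairs (x : Equiv.Perm (Fin n)) (ℓ : ℕ) (f : Fin n → Fin n → ℝ) :
    ∑ ab ∈ laterPairs x ℓ, f ab.1 ab.2 =
      ∑ b with ℓ ≤ pos x b, ∑ a with ℓ ≤ pos x a ∧ pos x a < pos x b, f a b := by
  rw [laterPairs, Finset.sum_filter, Fintype.sum_prod_type_right, Finset.sum_filter]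
  refine Finset.sum_congr rfl fun b _ => ?_
  rw [← Finset.sum_filter]
  split_ifs with hb
  · rfl
  · rw [Finset.filter_eq_empty_iff.2 fun a _ ⟨hℓa, hab⟩ => hb (hℓa.trans hab.le), Finset.sum_empty]

theorem sum_laterPairs_le (x : Equiv.Perm (Fin n)) (ℓ : ℕ) {g : ℕ → ℝ} (hg : ∀ j, 0 ≤ g j) :
    ∑ ab ∈ laterPairs x ℓ, g (pos x ab.2 - ℓ) ≤ ∑ j ∈ Finset.range n, (j : ℝ) * g j := by
  calc _ = ∑ b with ℓ ≤ pos x b, ((pos x b - ℓ : ℕ) : ℝ) * g (pos x b - ℓ) := by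
        rw [sum_laterPairs x ℓ fun _ b => g (pos x b - ℓ)]
        refine Finset.sum_congr rfl fun b _ => ?_
        rw [Finset.sum_const, nsmul_eq_mul, card_pos_mem_Ico x (pos_lt x b).le]
    _ ≤ _ := sum_pos_le x ℓ (fun j => (j : ℝ) * g j) fun j => mul_nonneg j.cast_nonneg (hg j)

theorem sum_laterPairs_fst_le (x : Equiv.Perm (Fin n)) (ℓ : ℕ) {g : ℕ → ℝ} (hg : ∀ j, 0 ≤ g j) :
    ∑ ab ∈ laterPairs x ℓ, (if pos x ab.1 = ℓ then g (pos x ab.2 - ℓ) else 0) ≤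
      ∑ j ∈ Finset.range n, g j := by
  rw [sum_laterPairs x ℓ fun a b => if pos x a = ℓ then g (pos x b - ℓ) else 0]
  refine (Finset.sum_le_sum fun b _ => ?_).trans (sum_pos_le x ℓ g hg)
  rw [← Finset.sum_filter, Finset.sum_const, nsmul_eq_mul]
  refine mul_le_of_le_one_left (hg _) ?_
  norm_cast
  refine Finset.card_le_one.2 fun u hu v hv => pos_injective x ?_
  exact (Finset.mem_filter.1 hu).2.trans (Finset.mem_filter.1 hv).2.symm

end PairMass

namespace PathModel

variable {n : ℕ} {Ω β : Type*} [MeasurableSpace Ω] {μ : Measure Ω} {Z : Sym2 (Fin n) → Ω → β}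
  {x : Equiv.Perm (Fin n)} {adj : Ω → Fin n → Fin n → Bool} {E : Ω → ℕ → Fin n → Fin n → Bool}
  {q : ℕ} {p : unitInterval} {c ℓ i : ℕ} {R : ℕ → ℕ}

theorem exists_mem_laterPairs_of_testPair (M : PathModel μ Z x adj E q p) {ω : Ω} {v : Fin n}
    {e : Sym2 (Fin n)} (h : TestPair x (E ω) q c R ℓ i v e) :
    ∃ ab ∈ laterPairs x ℓ, e = s(ab.1, ab.2) ∧ (v = ab.1 ∨ v = ab.2) ∧ E ω i ab.1 ab.2 = true ∧
      Unblocked x (E ω) q c R ℓ (i + c) ab.2 := by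
  obtain ⟨u, rfl, huv, hu, hv, hub, hvb⟩ := h
  rcases lt_trichotomy (pos x u) (pos x v) with hlt | heq | hlt
  · exact ⟨(u, v), mem_laterPairs.2 ⟨hu, hlt⟩, rfl, Or.inr rfl, huv, hvb⟩
  · obtain rfl := pos_injective x heq
    exact absurd ((M.valid ω).sub _ _ _ huv) ((M.valid ω).irrefl u)
  · exact ⟨(v, u), mem_laterPairs.2 ⟨hv, hlt⟩, Sym2.eq_swap, Or.inl rfl, M.E_symm ω i u v ▸ huv,
      hub⟩

theorem E_le_div_targetSize (M : PathModel μ Z x adj E q p) (hi : 1 ≤ i) (hiq : i ≤ q)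
    {a b : Fin n} (hab : a ≠ b) (hoff : ¬ (hamPath x).Adj a b) :
    μ.real {ω | E ω i a b = true} ≤ 2 / targetSize p i := by
  rw [targetSize, div_div_eq_mul_div]
  exact M.E_le i a b hi hiq hab hoff

theorem pairMass_advance_eq_zero (hℓ : ∀ y, pos x y + 1 ≠ ℓ) :
    pairMass μ x (fun ω => AdvancePair x (E ω) q c R ℓ i) = 0 := by
  refine Finset.sum_eq_zero fun e _ => ?_
  convert measureReal_empty (μ := μ) using 2
  exact Set.eq_empty_of_forall_notMem fun ω ⟨_, _, y, _, hy, _⟩ => hℓ y hy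

variable [IsProbabilityMeasure μ]

theorem prob_edge_from_last_le (M : PathModel μ Z x adj E q p) (hi : 1 ≤ i) {y a : Fin n}
    (hy : pos x y + 1 = ℓ) (ha : ℓ ≤ pos x a) :
    μ.real {ω | ∃ k, i ≤ k ∧ k ≤ q ∧ E ω k y a = true} ≤
      4 / targetSize p i + if pos x a = ℓ then 2 else 0 := by
  have hs := targetSize_pos M.p_pos i
  have hne : y ≠ a := by rintro rfl; omega
  split_ifs with haℓ
  · have h2i : (2 : ℝ) ^ 1 ≤ 2 ^ i := pow_le_pow_right₀ (by norm_num) hi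
    calc _ ≤ (4 : ℝ) / 2 ^ i := M.prob_path_edge_ge_le hi hne
      _ ≤ 2 := by rw [div_le_iff₀ (by positivity)]; linarith
      _ ≤ _ := le_add_of_nonneg_left (by positivity)
  · rw [add_zero, targetSize, div_div_eq_mul_div]
    exact M.prob_edge_ge_le hi hne (by rw [hamPath_adj]; omega)

variable [DiscreteMeasurableSpace Ω]

theorem prob_and_edge_and_unblocked_le (M : PathModel μ Z x adj E q p) (hc : 8 ≤ c)
    (hR : RecentlyRebuilt p q R ℓ) (hi : 1 ≤ i) (hiq : i ≤ q) {a b : Fin n}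
    (hab : pos x a < pos x b) (hoff : ¬ (hamPath x).Adj a b) {A : Ω → Prop}
    {S : Set (Sym2 (Fin n))} (hA : DeterminedBy Z S A) (hSab : Disjoint S {s(a, b)})
    (hS : ∀ t, ℓ < pos x t → pos x t < pos x b → t ≠ a → Disjoint S (blockingPairs x b t)) :
    μ.real {ω | (A ω ∧ E ω i a b = true) ∧ Unblocked x (E ω) q c R ℓ (i + c) b} ≤
      μ.real {ω | A ω} * (2 / targetSize p i) * unblockedBound p c (i + c) (pos x b - ℓ) := by
  have hne : a ≠ b := by rintro rfl; omega
  have hF : DeterminedBy Z (S ∪ {s(a, b)}) fun ω => A ω ∧ E ω i a b = true :=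
    (hA.mono Set.subset_union_left).and ((M.E_det i a b).mono Set.subset_union_right)
  refine (M.prob_and_unblocked_le hc (by omega) hR a hF fun t hfar htb hta => ?_).trans ?_
  · have hℓt : (ℓ : ℝ) < pos x t := by
      have := targetSize_pos M.p_pos (i + c + c)
      linarith
    rw [Set.disjoint_union_left]
    refine ⟨hS t (by exact_mod_cast hℓt) htb hta, Set.disjoint_singleton_left.2 ?_⟩
    rintro (he | ⟨s, -, he⟩) <;> rw [Sym2.eq_iff] at he <;>
      rcases he with ⟨rfl, h⟩ | ⟨rfl, h⟩ <;> subst_vars <;> omega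
  · rw [M.indep _ _ _ _ hSab hA (M.E_det i a b)]
    gcongr
    · exact unblockedBound_nonneg _ _ _ _
    · exact M.E_le_div_targetSize hi hiq hne hoff

theorem pairMass_rebuild_le (M : PathModel μ Z x adj E q p) (hc : 8 ≤ c)
    (hR : RecentlyRebuilt p q R ℓ) (hi : 1 ≤ i) (hiq : i ≤ q) :
    pairMass μ x (fun ω => RebuildPair x (E ω) q c R ℓ i) ≤
      2 / targetSize p i * ∑ j ∈ Finset.range n, (j : ℝ) * unblockedBound p c (i + c) j := by
  have hs := targetSize_pos M.p_pos i
  have hU := unblockedBound_nonneg p c (i + c)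
  calc _ ≤ ∑ ab ∈ laterPairs x ℓ,
        2 / targetSize p i * unblockedBound p c (i + c) (pos x ab.2 - ℓ) := by
        refine pairMass_le (f := fun ab : Fin n × Fin n => s(ab.1, ab.2))
          (A := fun ab ω => E ω i ab.1 ab.2 = true ∧ Unblocked x (E ω) q c R ℓ (i + c) ab.2)
          ?_ ?_ ?_
        · rintro ω e - ⟨v, hv⟩
          obtain ⟨ab, hab, he, -, hE⟩ := M.exists_mem_laterPairs_of_testPair hv
          exact ⟨ab, hab, he, hE⟩
        · intro ab _
          have := hU (pos x ab.2 - ℓ)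
          positivity
        · intro ab hab hoff
          have := M.prob_and_edge_and_unblocked_le hc hR hi hiq (mem_laterPairs.1 hab).2
            (mem_offPath.1 hoff) (A := fun _ => True) (S := ∅) (fun _ _ _ => Iff.rfl)
            (Set.empty_disjoint _) fun _ _ _ _ => Set.empty_disjoint _
          simpa using this
    _ ≤ _ := by
        rw [← Finset.mul_sum]
        exact mul_le_mul_of_nonneg_left (sum_laterPairs_le x ℓ hU) (by positivity)

theorem prob_advance_le (M : PathModel μ Z x adj E q p) (hc : 8 ≤ c)
    (hR : RecentlyRebuilt p q R ℓ) (hi : 1 ≤ i) (hiq : i ≤ q) {a b y v : Fin n}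
    (ha : ℓ ≤ pos x a) (hab : pos x a < pos x b) (hoff : ¬ (hamPath x).Adj a b)
    (hy : pos x y + 1 = ℓ) (hv : v = a ∨ v = b) :
    μ.real {ω | ((∃ k, i ≤ k ∧ k ≤ q ∧ E ω k y v = true) ∧ E ω i a b = true) ∧
      Unblocked x (E ω) q c R ℓ (i + c) b} ≤
      μ.real {ω | ∃ k, i ≤ k ∧ k ≤ q ∧ E ω k y v = true} * (2 / targetSize p i) *
        unblockedBound p c (i + c) (pos x b - ℓ) := by
  have hdet : DeterminedBy Z {s(y, v)} fun ω => ∃ k, i ≤ k ∧ k ≤ q ∧ E ω k y v = true :=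
    DeterminedBy.ex fun k => DeterminedBy.const_and fun _ => DeterminedBy.const_and fun _ =>
      M.E_det k y v
  refine M.prob_and_edge_and_unblocked_le hc hR hi hiq hab hoff hdet ?_ fun t hℓt htb hta => ?_
  · rw [Set.disjoint_singleton, Ne, Sym2.eq_iff]
    rintro (⟨rfl, -⟩ | ⟨rfl, -⟩) <;> omega
  · rw [Set.disjoint_singleton_left]
    rcases hv with rfl | rfl <;> rintro (he | ⟨s, hs, he⟩) <;> rw [Sym2.eq_iff] at he <;>
      rcases he with ⟨rfl, h⟩ | ⟨rfl, h⟩ <;> subst_vars <;> omega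

theorem pairMass_advance_le_sum (M : PathModel μ Z x adj E q p) (hc : 8 ≤ c)
    (hR : RecentlyRebuilt p q R ℓ) (hi : 1 ≤ i) (hiq : i ≤ q) {y : Fin n} (hy : pos x y + 1 = ℓ) :
    pairMass μ x (fun ω => AdvancePair x (E ω) q c R ℓ i) ≤
      ∑ ab ∈ laterPairs x ℓ, (16 / targetSize p i ^ 2 *
        unblockedBound p c (i + c) (pos x ab.2 - ℓ) + 4 / targetSize p i *
          if pos x ab.1 = ℓ then unblockedBound p c (i + c) (pos x ab.2 - ℓ) else 0) := by
  have hs := targetSize_pos M.p_pos i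
  have hU := unblockedBound_nonneg p c (i + c)
  refine pairMass_le (f := fun ab : Fin n × Fin n => s(ab.1, ab.2))
    (A := fun ab ω => (((∃ k, i ≤ k ∧ k ≤ q ∧ E ω k y ab.1 = true) ∧ E ω i ab.1 ab.2 = true) ∧
        Unblocked x (E ω) q c R ℓ (i + c) ab.2) ∨
      (((∃ k, i ≤ k ∧ k ≤ q ∧ E ω k y ab.2 = true) ∧ E ω i ab.1 ab.2 = true) ∧
        Unblocked x (E ω) q c R ℓ (i + c) ab.2)) ?_ ?_ ?_
  · rintro ω e - ⟨v, hv, y', k, hy', hik, hkq, hk⟩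
    obtain rfl : y' = y := pos_injective x (by omega)
    obtain ⟨ab, hab, he, rfl | rfl, hE, hub⟩ := M.exists_mem_laterPairs_of_testPair hv
    · exact ⟨ab, hab, he, Or.inl ⟨⟨⟨k, hik, hkq, hk⟩, hE⟩, hub⟩⟩
    · exact ⟨ab, hab, he, Or.inr ⟨⟨⟨k, hik, hkq, hk⟩, hE⟩, hub⟩⟩
  · intro ab _
    have := hU (pos x ab.2 - ℓ)
    split_ifs <;> positivity
  · rintro ⟨a, b⟩ hab hoff
    obtain ⟨ha, hab⟩ := mem_laterPairs.1 hab
    dsimp only at ha hab ⊢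
    have hoff := mem_offPath.1 hoff
    have := hU (pos x b - ℓ)
    refine (measureReal_union_le _ _).trans ?_
    calc _ ≤ _ := add_le_add (M.prob_advance_le hc hR hi hiq ha hab hoff hy (Or.inl rfl))
          (M.prob_advance_le hc hR hi hiq ha hab hoff hy (Or.inr rfl))
      _ ≤ (4 / targetSize p i + if pos x a = ℓ then 2 else 0) * (2 / targetSize p i) *
            unblockedBound p c (i + c) (pos x b - ℓ) +
          (4 / targetSize p i + if pos x b = ℓ then 2 else 0) * (2 / targetSize p i) *
            unblockedBound p c (i + c) (pos x b - ℓ) := by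
        gcongr
        · exact M.prob_edge_from_last_le hi hy ha
        · exact M.prob_edge_from_last_le hi hy (ha.trans hab.le)
      _ = _ := by
        rw [if_neg (by omega : ¬ pos x b = ℓ)]
        split_ifs <;> ring

theorem pairMass_advance_le (M : PathModel μ Z x adj E q p) (hc : 8 ≤ c)
    (hR : RecentlyRebuilt p q R ℓ) (hi : 1 ≤ i) (hiq : i ≤ q) :
    pairMass μ x (fun ω => AdvancePair x (E ω) q c R ℓ i) ≤ 640 * (2 ^ c) ^ 6 := by
  rcases em (∃ y, pos x y + 1 = ℓ) with ⟨y, hy⟩ | hnone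
  swap
  · rw [pairMass_advance_eq_zero (not_exists.1 hnone)]
    positivity
  have hs := targetSize_pos M.p_pos i
  have hU := unblockedBound_nonneg p c (i + c)
  have h2c : (1 : ℝ) ≤ 2 ^ c := one_le_pow₀ one_le_two
  have hic : 1 ≤ i + c := by omega
  calc _ ≤ _ := M.pairMass_advance_le_sum hc hR hi hiq hy
    _ ≤ 16 / targetSize p i ^ 2 * (32 * (2 ^ c) ^ 4 * targetSize p (i + c) ^ 2) +
        4 / targetSize p i * (32 * (2 ^ c) ^ 4 * targetSize p (i + c)) := by
      rw [Finset.sum_add_distrib, ← Finset.mul_sum, ← Finset.mul_sum]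
      gcongr
      · exact (sum_laterPairs_le x ℓ hU).trans (sum_mul_unblockedBound_le_sq M.p_pos hic c n)
      · exact (sum_laterPairs_fst_le x ℓ hU).trans (sum_unblockedBound_le M.p_pos hic c n)
    _ = (512 * (2 ^ c) + 128) * (2 ^ c) ^ 5 := by
      rw [targetSize_add]
      field_simp
      ring
    _ ≤ (640 * (2 ^ c)) * (2 ^ c) ^ 5 := by
      gcongr
      linarith
    _ = _ := by ring

end PathModel

/-! ### The cost of the search -/

section SearchBound

variable {p : unitInterval} {c r a b : ℕ}

/-- A bound for the tests of a candidate `a` positions after the last discovered vertex against an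
earlier vertex, `b` positions after it. -/
noncomputable def earlierTestBound (p : unitInterval) (c a b : ℕ) : ℝ :=
  if b < a then survivalBound p c a + unblockedBound p c 1 a else 0

/-- A bound for the tests, in round `r`, of a candidate close to the last discovered vertex against
a later vertex. -/
noncomputable def nearTestBound (p : unitInterval) (c r a b : ℕ) : ℝ :=
  (4 * p * a + 4) / 2 ^ (r - 1) * survivalBound p c a * unblockedBound p c r b

/-- A bound for the tests, in round `r`, of a candidate far from the last discovered vertex against
a later vertex. -/
noncomputable def farTestBound (p : unitInterval) (c r a b : ℕ) : ℝ :=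
  64 * (2 ^ c) ^ 4 * (targetSize p 1 / targetSize p r) ^ 2 *
    ((targetSize p r / (targetSize p r + a)) ^ 2 * (targetSize p r / (targetSize p r + b)) ^ 2)

/-- A bound on the probability that a candidate in position `ℓ + a` leads to a comparison with the
vertex in position `ℓ + b`, in round `r` of the search for the vertex in position `ℓ`. -/
noncomputable def searchBound (p : unitInterval) (c r a b : ℕ) : ℝ :=
  (p : ℝ) ^ 2 * (earlierTestBound p c a b + nearTestBound p c r a b + farTestBound p c r a b)

theorem earlierTestBound_nonneg (p : unitInterval) (c a b : ℕ) : 0 ≤ earlierTestBound p c a b := by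
  rw [earlierTestBound]
  split_ifs
  · exact add_nonneg (survivalBound_nonneg p c a) (unblockedBound_nonneg p c 1 a)
  · exact le_rfl

theorem nearTestBound_nonneg (p : unitInterval) (c r a b : ℕ) : 0 ≤ nearTestBound p c r a b := by
  have hp : (0 : ℝ) ≤ p := p.2.1
  have hsurv := survivalBound_nonneg p c a
  have hunbl := unblockedBound_nonneg p c r b
  rw [nearTestBound]
  positivity

theorem farTestBound_nonneg (p : unitInterval) (c r a b : ℕ) : 0 ≤ farTestBound p c r a b := by
  rw [farTestBound]
  positivity

theorem searchBound_nonneg (p : unitInterval) (c r a b : ℕ) : 0 ≤ searchBound p c r a b :=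
  mul_nonneg (sq_nonneg _) (add_nonneg (add_nonneg (earlierTestBound_nonneg p c a b)
    (nearTestBound_nonneg p c r a b)) (farTestBound_nonneg p c r a b))

theorem min_decay_le (σ τ : ℝ) (a b : ℕ) :
    min (decay σ a) (decay τ b) ≤ (σ / (σ + a)) ^ 2 * (τ / (τ + b)) ^ 2 := by
  have hsq : ∀ (ρ : ℝ) (j : ℕ), decay ρ j = (ρ / (ρ + j)) ^ 2 * (ρ / (ρ + j)) ^ 2 := fun ρ j => by
    rw [decay, ← pow_add]
  rw [hsq, hsq]
  rcases le_total ((σ / (σ + a)) ^ 2) ((τ / (τ + b)) ^ 2) with hle | hle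
  · exact (min_le_left _ _).trans (mul_le_mul_of_nonneg_left hle (sq_nonneg _))
  · exact (min_le_right _ _).trans (mul_le_mul_of_nonneg_right hle (sq_nonneg _))

theorem ratio_targetSize_one_le (hp : 0 < p) (hra : targetSize p r ≤ a) :
    targetSize p 1 / (targetSize p 1 + a) ≤
      2 * (targetSize p 1 / targetSize p r) * (targetSize p r / (targetSize p r + a)) := by
  have hr := targetSize_pos hp r
  have h₁ := targetSize_pos hp 1
  have hcancel : 2 * (targetSize p 1 / targetSize p r) * (targetSize p r / (targetSize p r + a)) =
      2 * targetSize p 1 / (targetSize p r + a) := by field_simp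
  rw [hcancel, div_le_div_iff₀ (by positivity) (by positivity)]
  nlinarith

theorem min_unblockedBound_le_farTestBound (hp : 0 < p) (hc : 8 ≤ c)
    (ha : targetSize p (r + c) / 16 < a) :
    min (unblockedBound p c 1 a) (unblockedBound p c r b) ≤ farTestBound p c r a b := by
  have hr := targetSize_pos hp r
  have h₁ := targetSize_pos hp 1
  have hra : targetSize p r ≤ a := by
    have h2c : (2 : ℝ) ^ 8 ≤ 2 ^ c := pow_le_pow_right₀ (by norm_num) hc
    rw [targetSize_add] at ha
    nlinarith
  rw [unblockedBound, unblockedBound, ← mul_min_of_nonneg _ _ (by positivity)]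
  calc _ ≤ 16 * ((2 : ℝ) ^ c) ^ 4 * ((targetSize p 1 / (targetSize p 1 + a)) ^ 2 *
        (targetSize p r / (targetSize p r + b)) ^ 2) := by gcongr; exact min_decay_le _ _ a b
    _ ≤ 16 * (2 ^ c) ^ 4 * ((2 * (targetSize p 1 / targetSize p r) *
        (targetSize p r / (targetSize p r + a))) ^ 2 *
          (targetSize p r / (targetSize p r + b)) ^ 2) := by
      gcongr
      exact ratio_targetSize_one_le hp hra
    _ = _ := by rw [farTestBound]; ring

end SearchBound

section SearchTest

variable {n : ℕ} {x : Equiv.Perm (Fin n)} {ℓ : ℕ} {y₀ y u z t : Fin n}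

/-- The positions that occur when, in the search for the vertex in position `ℓ`, the candidate `y`,
a neighbour of the vertex `y₀` discovered last, leads to the comparison of `u` with `z`. The vertex
`z` is either `y` or the vertex searched for. -/
structure SearchTest (x : Equiv.Perm (Fin n)) (ℓ : ℕ) (y₀ y u z : Fin n) : Prop where
  pos_last : pos x y₀ + 1 = ℓ
  lt_pos : ℓ < pos x y
  le_pos : ℓ ≤ pos x u
  ne_candidate : u ≠ y
  ne : u ≠ z
  eq_or_pos_eq : z = y ∨ pos x z = ℓ
  offPath : ¬ (hamPath x).Adj u z

/-- The two edges that must be present for `y` to be a candidate and `u` to be compared with `z`. -/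
def SearchEdges (adj : Fin n → Fin n → Bool) (y₀ y u z : Fin n) : Prop :=
  adj y₀ y = true ∧ adj u z = true

/-- The event that, in round `r` of the search for the vertex in position `ℓ`, the candidate `y`
leads to the comparison of `u` with `z`. -/
structure SearchEvent (x : Equiv.Perm (Fin n)) (adj : Fin n → Fin n → Bool)
    (E : ℕ → Fin n → Fin n → Bool) (q c : ℕ) (R : ℕ → ℕ) (ℓ r : ℕ) (y₀ y u z : Fin n) : Prop where
  edges : SearchEdges adj y₀ y u z
  unblocked_candidate : Unblocked x E q c R ℓ 1 y
  survives : Survives x adj E q ℓ r y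
  unblocked : Unblocked x E q c R ℓ r u

/-- The pairs of vertices in positions up to that of `y`. -/
def pairsUpTo (x : Equiv.Perm (Fin n)) (y : Fin n) : Set (Sym2 (Fin n)) :=
  {e | ∃ s t, pos x s < pos x t ∧ pos x t ≤ pos x y ∧ e = s(s, t)}

theorem earlierPairs_subset_pairsUpTo (ht : pos x t ≤ pos x y) :
    PathModel.earlierPairs x t ⊆ pairsUpTo x y := by
  rintro e ⟨s, hs, rfl⟩
  exact ⟨s, t, hs, ht, rfl⟩

namespace SearchTest

theorem disjoint_blockingPairs_candidate (hT : SearchTest x ℓ y₀ y u z) (hℓt : ℓ ≤ pos x t)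
    (hty : pos x t < pos x y) (htu : t ≠ u) :
    Disjoint {s(y₀, y), s(u, z)} (PathModel.blockingPairs x y t) := by
  obtain ⟨hy₀, hy, hu, huy, huz, hz, -⟩ := hT
  rw [Set.disjoint_left]
  rintro e (rfl | rfl) (he | ⟨s, hs, he⟩) <;> rw [Sym2.eq_iff] at he <;>
    rcases he with ⟨h₁, h₂⟩ | ⟨h₁, h₂⟩ <;> subst_vars <;>
    first | omega | exact absurd rfl htu | (rcases hz with rfl | hz <;> omega)

theorem disjoint_blockingPairs (hT : SearchTest x ℓ y₀ y u z) (hyu : pos x y < pos x u)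
    (hℓt : ℓ < pos x t) (htu : pos x t < pos x u) (hty : t ≠ y) :
    Disjoint {s(y₀, y), s(u, z)} (PathModel.blockingPairs x u t) := by
  obtain ⟨hy₀, hy, hu, huy, huz, hz, -⟩ := hT
  rw [Set.disjoint_left]
  rintro e (rfl | rfl) (he | ⟨s, hs, he⟩) <;> rw [Sym2.eq_iff] at he <;>
    rcases he with ⟨h₁, h₂⟩ | ⟨h₁, h₂⟩ <;> subst_vars <;> omega

theorem disjoint_earlierPairs (hT : SearchTest x ℓ y₀ y u z) (hyu : pos x y < pos x u)
    (hty : pos x t < pos x y) :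
    Disjoint {s(y₀, y), s(u, z)} (PathModel.earlierPairs x t) := by
  obtain ⟨hy₀, hy, hu, huy, huz, hz, -⟩ := hT
  rw [Set.disjoint_left]
  rintro e (rfl | rfl) ⟨s, hs, he⟩ <;> rw [Sym2.eq_iff] at he <;>
    rcases he with ⟨h₁, h₂⟩ | ⟨h₁, h₂⟩ <;> subst_vars <;> omega

end SearchTest

theorem disjoint_pairsUpTo_blockingPairs (hyu : pos x y < pos x u) (hyt : pos x y < pos x t) :
    Disjoint (pairsUpTo x y) (PathModel.blockingPairs x u t) := by
  rw [Set.disjoint_left]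
  rintro e ⟨s', t', hs', ht', rfl⟩ (he | ⟨s, hs, he⟩) <;> rw [Sym2.eq_iff] at he <;>
    rcases he with ⟨h₁, h₂⟩ | ⟨h₁, h₂⟩ <;> subst_vars <;> omega

theorem disjoint_earlierPairs_blockingPairs {s : Fin n} (hts : pos x t < pos x s)
    (hsy : pos x s < pos x y) :
    Disjoint (PathModel.earlierPairs x s) (PathModel.blockingPairs x y t) := by
  rw [Set.disjoint_left]
  rintro e ⟨s', hs', rfl⟩ (he | ⟨t', ht', he⟩) <;> rw [Sym2.eq_iff] at he <;>
    rcases he with ⟨h₁, h₂⟩ | ⟨h₁, h₂⟩ <;> subst_vars <;> omega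

end SearchTest

namespace PathModel

variable {n : ℕ} {Ω β : Type*} [MeasurableSpace Ω] {μ : Measure Ω} {Z : Sym2 (Fin n) → Ω → β}
  {x : Equiv.Perm (Fin n)} {adj : Ω → Fin n → Fin n → Bool} {E : Ω → ℕ → Fin n → Fin n → Bool}
  {q : ℕ} {p : unitInterval} {c ℓ r : ℕ} {R : ℕ → ℕ} {y₀ y u z : Fin n}

theorem det_searchEdges (M : PathModel μ Z x adj E q p) (y₀ y u z : Fin n) :
    DeterminedBy Z {s(y₀, y), s(u, z)} fun ω => SearchEdges (adj ω) y₀ y u z :=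
  ((M.adj_det y₀ y).mono (by simp)).and ((M.adj_det u z).mono (by simp))

theorem det_survives (M : PathModel μ Z x adj E q p) (ℓ r : ℕ) (y : Fin n) :
    DeterminedBy Z (pairsUpTo x y) fun ω => Survives x (adj ω) (E ω) q ℓ r y := by
  refine DeterminedBy.const_imp fun _ => DeterminedBy.all fun u => DeterminedBy.const_imp fun _ =>
    DeterminedBy.const_imp fun hu => DeterminedBy.imp ((M.adj_det u y).mono ?_)
      ((M.det_hasBlocker (r - 1) ℓ u).mono (earlierPairs_subset_pairsUpTo hu.le))
  rintro e rfl
  exact ⟨u, y, hu, le_rfl, rfl⟩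

theorem prob_searchEdges (M : PathModel μ Z x adj E q p) (hT : SearchTest x ℓ y₀ y u z) :
    μ.real {ω | SearchEdges (adj ω) y₀ y u z} = p ^ 2 := by
  obtain ⟨hy₀, hy, hu, huy, huz, hz, hoff⟩ := hT
  have hdisj : Disjoint ({s(y₀, y)} : Set (Sym2 (Fin n))) {s(u, z)} := by
    rw [Set.disjoint_singleton]
    intro he
    rw [Sym2.eq_iff] at he
    rcases he with ⟨h₁, h₂⟩ | ⟨h₁, h₂⟩ <;> subst_vars <;> omega
  have hindep := M.indep _ _ _ _ hdisj (M.adj_det y₀ y) (M.adj_det u z)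
  rw [M.adj_eq u z huz hoff, M.adj_eq y₀ y (by rintro rfl; omega) (by rw [hamPath_adj]; omega),
    ← sq] at hindep
  exact hindep

variable [IsProbabilityMeasure μ] [DiscreteMeasurableSpace Ω]

theorem prob_unblocked_candidate_le (M : PathModel μ Z x adj E q p) (hc : 8 ≤ c)
    (hR : RecentlyRebuilt p q R ℓ) (hT : SearchTest x ℓ y₀ y u z) :
    μ.real {ω | SearchEdges (adj ω) y₀ y u z ∧ Unblocked x (E ω) q c R ℓ 1 y} ≤
      p ^ 2 * unblockedBound p c 1 (pos x y - ℓ) := by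
  rw [← M.prob_searchEdges hT]
  refine M.prob_and_unblocked_le hc le_rfl hR u (M.det_searchEdges y₀ y u z)
    fun t hℓt hty htu => hT.disjoint_blockingPairs_candidate ?_ hty htu
  have hsize := targetSize_pos M.p_pos (1 + c)
  have : (ℓ : ℝ) < pos x t := by linarith
  exact_mod_cast this.le

theorem prob_unblocked_tested_le (M : PathModel μ Z x adj E q p) (hc : 8 ≤ c) (hr : 1 ≤ r)
    (hR : RecentlyRebuilt p q R ℓ) (hT : SearchTest x ℓ y₀ y u z) (hyu : pos x y < pos x u) :
    μ.real {ω | SearchEdges (adj ω) y₀ y u z ∧ Unblocked x (E ω) q c R ℓ r u} ≤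
      p ^ 2 * unblockedBound p c r (pos x u - ℓ) := by
  rw [← M.prob_searchEdges hT]
  refine M.prob_and_unblocked_le hc hr hR y (M.det_searchEdges y₀ y u z)
    fun t hℓt htu hty => hT.disjoint_blockingPairs hyu ?_ htu hty
  have hsize := targetSize_pos M.p_pos (r + c)
  have : (ℓ : ℝ) < pos x t := by linarith
  exact_mod_cast this

theorem prob_edges_and_survives_le (M : PathModel μ Z x adj E q p) (hT : SearchTest x ℓ y₀ y u z)
    (hnear : ((pos x y - ℓ : ℕ) : ℝ) ≤ targetSize p (r + c) / 16) :
    μ.real {ω | SearchEdges (adj ω) y₀ y u z ∧ Survives x (adj ω) (E ω) q ℓ r y} ≤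
      p ^ 2 * survivalBound p c (pos x y - ℓ) := by
  rw [← M.prob_searchEdges hT]
  exact M.prob_and_survives_le hT.lt_pos hnear u (M.det_searchEdges y₀ y u z) fun t hℓt hty htu =>
    hT.disjoint_blockingPairs_candidate hℓt (by omega) htu

/- The predecessor of `y` on the path is a neighbour of `y`, so that it has a blocker as well. -/
theorem prob_edges_and_survives_le_div (M : PathModel μ Z x adj E q p)
    (hT : SearchTest x ℓ y₀ y u z) (hyu : pos x y < pos x u) (hr : 2 ≤ r)
    (hnear : ((pos x y - ℓ : ℕ) : ℝ) ≤ targetSize p (r + c) / 16) :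
    μ.real {ω | SearchEdges (adj ω) y₀ y u z ∧ Survives x (adj ω) (E ω) q ℓ r y} ≤
      p ^ 2 * ((4 * p * (pos x y - ℓ : ℕ) + 4) / 2 ^ (r - 1)) *
        survivalBound p c (pos x y - ℓ) := by
  have hy := hT.lt_pos
  have hp : (0 : ℝ) ≤ p := p.2.1
  obtain ⟨y', hy'⟩ := exists_pos_eq x (k := pos x y - 1) (by have := pos_lt x y; omega)
  have hsurv := M.prob_and_survives_le hy hnear u
    (((M.det_searchEdges y₀ y u z).mono Set.subset_union_left).and
      ((M.det_hasBlocker (r - 1) ℓ y').mono Set.subset_union_right))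
    fun t hℓt hty htu => Set.disjoint_union_left.2
      ⟨hT.disjoint_blockingPairs_candidate hℓt (by omega) htu,
        disjoint_earlierPairs_blockingPairs (by omega) (by omega)⟩
  have hblocker : μ.real {ω | HasBlocker x (E ω) q (r - 1) ℓ y'} ≤
      (4 * p * (pos x y - ℓ : ℕ) + 4) / 2 ^ (r - 1) := by
    refine (M.prob_hasBlocker_le (by omega) y' (by omega)).trans ?_
    have : (pos x y' : ℝ) ≤ pos x y := by exact_mod_cast (by omega : pos x y' ≤ pos x y)
    rw [Nat.cast_sub hy.le]
    gcongr
  rw [M.indep _ _ _ _ (hT.disjoint_earlierPairs hyu (by omega)) (M.det_searchEdges y₀ y u z)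
    (M.det_hasBlocker (r - 1) ℓ y'), M.prob_searchEdges hT] at hsurv
  refine (measureReal_mono ?_ (measure_ne_top _ _)).trans (hsurv.trans ?_)
  · rintro ω ⟨hedges, hω⟩
    exact ⟨⟨hedges, hω hr y' (by omega) (by omega) ((M.valid ω).path _ _ (by omega))⟩, hω⟩
  · have := survivalBound_nonneg p c (pos x y - ℓ)
    gcongr

theorem prob_edges_and_survives_le_of_lt (M : PathModel μ Z x adj E q p)
    (hT : SearchTest x ℓ y₀ y u z) (hyu : pos x y < pos x u)
    (hnear : ((pos x y - ℓ : ℕ) : ℝ) ≤ targetSize p (r + c) / 16) :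
    μ.real {ω | SearchEdges (adj ω) y₀ y u z ∧ Survives x (adj ω) (E ω) q ℓ r y} ≤
      p ^ 2 * ((4 * p * (pos x y - ℓ : ℕ) + 4) / 2 ^ (r - 1)) *
        survivalBound p c (pos x y - ℓ) := by
  rcases Nat.lt_or_ge r 2 with hr | hr
  · refine (M.prob_edges_and_survives_le hT hnear).trans ?_
    have hp : (0 : ℝ) ≤ p := p.2.1
    refine mul_le_mul_of_nonneg_right (le_mul_of_one_le_right (sq_nonneg _) ?_)
      (survivalBound_nonneg p c _)
    rw [show r - 1 = 0 by omega, pow_zero, div_one]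
    have : 0 ≤ 4 * (p : ℝ) * (pos x y - ℓ : ℕ) := by positivity
    linarith
  · exact M.prob_edges_and_survives_le_div hT hyu hr hnear

theorem prob_search_near_le (M : PathModel μ Z x adj E q p) (hc : 8 ≤ c) (hr : 1 ≤ r)
    (hR : RecentlyRebuilt p q R ℓ) (hT : SearchTest x ℓ y₀ y u z) (hyu : pos x y < pos x u)
    (hnear : ((pos x y - ℓ : ℕ) : ℝ) ≤ targetSize p (r + c) / 16) :
    μ.real {ω | SearchEvent x (adj ω) (E ω) q c R ℓ r y₀ y u z} ≤
      p ^ 2 * nearTestBound p c r (pos x y - ℓ) (pos x u - ℓ) := by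
  have hunblocked := M.prob_and_unblocked_le hc hr hR y
    (F := fun ω => SearchEdges (adj ω) y₀ y u z ∧ Survives x (adj ω) (E ω) q ℓ r y)
    (((M.det_searchEdges y₀ y u z).mono Set.subset_union_left).and
      ((M.det_survives ℓ r y).mono Set.subset_union_right))
    (v := u) fun t hℓt htu hty => by
      have hyt : pos x y < pos x t := by
        rw [Nat.cast_sub hT.lt_pos.le] at hnear
        have : (pos x y : ℝ) < pos x t := by linarith
        exact_mod_cast this
      exact Set.disjoint_union_left.2
        ⟨hT.disjoint_blockingPairs hyu (hT.lt_pos.trans hyt) htu hty,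
          disjoint_pairsUpTo_blockingPairs hyu hyt⟩
  refine (measureReal_mono ?_ (measure_ne_top _ _)).trans (hunblocked.trans
    ((mul_le_mul_of_nonneg_right (M.prob_edges_and_survives_le_of_lt hT hyu hnear)
      (unblockedBound_nonneg p c r _)).trans_eq ?_))
  · exact fun ω hω => ⟨⟨hω.edges, hω.survives⟩, hω.unblocked⟩
  · rw [nearTestBound]
    ring

theorem prob_search_far_le (M : PathModel μ Z x adj E q p) (hc : 8 ≤ c) (hr : 1 ≤ r)
    (hR : RecentlyRebuilt p q R ℓ) (hT : SearchTest x ℓ y₀ y u z) (hyu : pos x y < pos x u)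
    (hfar : targetSize p (r + c) / 16 < (pos x y - ℓ : ℕ)) :
    μ.real {ω | SearchEvent x (adj ω) (E ω) q c R ℓ r y₀ y u z} ≤
      p ^ 2 * farTestBound p c r (pos x y - ℓ) (pos x u - ℓ) := by
  have hcandidate : {ω | SearchEvent x (adj ω) (E ω) q c R ℓ r y₀ y u z} ⊆
      {ω | SearchEdges (adj ω) y₀ y u z ∧ Unblocked x (E ω) q c R ℓ 1 y} :=
    fun ω hω => ⟨hω.edges, hω.unblocked_candidate⟩
  have htested : {ω | SearchEvent x (adj ω) (E ω) q c R ℓ r y₀ y u z} ⊆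
      {ω | SearchEdges (adj ω) y₀ y u z ∧ Unblocked x (E ω) q c R ℓ r u} :=
    fun ω hω => ⟨hω.edges, hω.unblocked⟩
  refine (le_min
    ((measureReal_mono hcandidate (measure_ne_top _ _)).trans
      (M.prob_unblocked_candidate_le hc hR hT))
    ((measureReal_mono htested (measure_ne_top _ _)).trans
      (M.prob_unblocked_tested_le hc hr hR hT hyu))).trans ?_
  rw [← mul_min_of_nonneg _ _ (sq_nonneg _)]
  exact mul_le_mul_of_nonneg_left (min_unblockedBound_le_farTestBound M.p_pos hc hfar)
    (sq_nonneg _)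

theorem prob_search_earlier_le (M : PathModel μ Z x adj E q p) (hc : 8 ≤ c)
    (hR : RecentlyRebuilt p q R ℓ) (hT : SearchTest x ℓ y₀ y u z) (huy : pos x u < pos x y) :
    μ.real {ω | SearchEvent x (adj ω) (E ω) q c R ℓ r y₀ y u z} ≤
      p ^ 2 * earlierTestBound p c (pos x y - ℓ) (pos x u - ℓ) := by
  have hsurv := survivalBound_nonneg p c (pos x y - ℓ)
  have hunbl := unblockedBound_nonneg p c 1 (pos x y - ℓ)
  rw [earlierTestBound, if_pos (by have := hT.le_pos; omega)]
  rcases le_or_gt ((pos x y - ℓ : ℕ) : ℝ) (targetSize p (r + c) / 16) with hnear | _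
  · have hsub : {ω | SearchEvent x (adj ω) (E ω) q c R ℓ r y₀ y u z} ⊆
        {ω | SearchEdges (adj ω) y₀ y u z ∧ Survives x (adj ω) (E ω) q ℓ r y} :=
      fun ω hω => ⟨hω.edges, hω.survives⟩
    refine (measureReal_mono hsub (measure_ne_top _ _)).trans
      ((M.prob_edges_and_survives_le hT hnear).trans ?_)
    gcongr
    linarith
  · have hsub : {ω | SearchEvent x (adj ω) (E ω) q c R ℓ r y₀ y u z} ⊆
        {ω | SearchEdges (adj ω) y₀ y u z ∧ Unblocked x (E ω) q c R ℓ 1 y} :=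
      fun ω hω => ⟨hω.edges, hω.unblocked_candidate⟩
    refine (measureReal_mono hsub (measure_ne_top _ _)).trans
      ((M.prob_unblocked_candidate_le hc hR hT).trans ?_)
    gcongr
    linarith

theorem prob_search_le (M : PathModel μ Z x adj E q p) (hc : 8 ≤ c) (hr : 1 ≤ r)
    (hR : RecentlyRebuilt p q R ℓ) (hT : SearchTest x ℓ y₀ y u z) :
    μ.real {ω | SearchEvent x (adj ω) (E ω) q c R ℓ r y₀ y u z} ≤
      searchBound p c r (pos x y - ℓ) (pos x u - ℓ) := by
  set a := pos x y - ℓ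
  set b := pos x u - ℓ
  have hearlier := earlierTestBound_nonneg p c a b
  have hnear := nearTestBound_nonneg p c r a b
  have hfar := farTestBound_nonneg p c r a b
  rcases lt_trichotomy (pos x u) (pos x y) with huy | huy | hyu
  · refine (M.prob_search_earlier_le hc hR hT huy).trans
      (mul_le_mul_of_nonneg_left ?_ (sq_nonneg _))
    linarith
  · exact absurd (pos_injective x huy) hT.ne_candidate
  · rcases le_or_gt (a : ℝ) (targetSize p (r + c) / 16) with ha | ha
    · refine (M.prob_search_near_le hc hr hR hT hyu ha).trans
        (mul_le_mul_of_nonneg_left ?_ (sq_nonneg _))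
      linarith
    · refine (M.prob_search_far_le hc hr hR hT hyu ha).trans
        (mul_le_mul_of_nonneg_left ?_ (sq_nonneg _))
      linarith

end PathModel

section SearchSum

variable {p : unitInterval} {r : ℕ}

theorem sum_survivalBound_le (hp : 0 < p) (c n : ℕ) :
    ∑ j ∈ Finset.range n, survivalBound p c j ≤ 432 * survivalScale p c := by
  have := sum_decay_le (one_le_survivalScale hp c) n
  calc _ = 216 * ∑ j ∈ Finset.range n, decay (survivalScale p c) j := (Finset.mul_sum _ _ _).symm
    _ ≤ 216 * (2 * survivalScale p c) := by gcongr
    _ = _ := by ring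

theorem sum_mul_survivalBound_le (hp : 0 < p) (c n : ℕ) :
    ∑ j ∈ Finset.range n, (j : ℝ) * survivalBound p c j ≤ 432 * survivalScale p c ^ 2 := by
  have := sum_mul_decay_le (one_le_survivalScale hp c) n
  calc _ = 216 * ∑ j ∈ Finset.range n, (j : ℝ) * decay (survivalScale p c) j := by
        rw [Finset.mul_sum]
        exact Finset.sum_congr rfl fun j _ => mul_left_comm _ _ _
    _ ≤ 216 * (2 * survivalScale p c ^ 2) := by gcongr
    _ = _ := by ring

theorem sum_earlierTestBound_le (hp : 0 < p) (c n : ℕ) :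
    (p : ℝ) ^ 2 * ∑ a ∈ Finset.range n, ∑ b ∈ Finset.range n, earlierTestBound p c a b ≤
      6912 * (2 ^ c) ^ 2 + 128 * (2 ^ c) ^ 4 := by
  have hp' : (0 : ℝ) < p := hp
  have hsurv := sum_mul_survivalBound_le hp c n
  have hunbl := sum_mul_unblockedBound_le_sq hp le_rfl c n
  have hrow : ∀ a ∈ Finset.range n, ∑ b ∈ Finset.range n, earlierTestBound p c a b =
      a * survivalBound p c a + a * unblockedBound p c 1 a := by
    intro a ha
    have hfilter : (Finset.range n).filter (fun b => b < a) = Finset.range a := by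
      ext b
      simp only [Finset.mem_filter, Finset.mem_range] at ha ⊢
      omega
    simp only [earlierTestBound]
    rw [← Finset.sum_filter, hfilter, Finset.sum_const, Finset.card_range, nsmul_eq_mul, mul_add]
  rw [Finset.sum_congr rfl hrow, Finset.sum_add_distrib]
  calc _ ≤ (p : ℝ) ^ 2 * (432 * survivalScale p c ^ 2 + 32 * (2 ^ c) ^ 4 * targetSize p 1 ^ 2) := by
        gcongr
    _ = _ := by
        rw [survivalScale, targetSize]
        field_simp
        ring

theorem sum_nearTestBound_le (hp : 0 < p) (hr : 1 ≤ r) (c n : ℕ) :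
    (p : ℝ) ^ 2 * ∑ a ∈ Finset.range n, ∑ b ∈ Finset.range n, nearTestBound p c r a b ≤
      2211840 * (2 ^ c) ^ 6 := by
  have hp' : (0 : ℝ) < p := hp
  have hscale : 0 ≤ survivalScale p c := zero_le_one.trans (one_le_survivalScale hp c)
  have hsurv := sum_survivalBound_le hp c n
  have hmul_surv := sum_mul_survivalBound_le hp c n
  have hunbl := sum_unblockedBound_le hp hr c n
  have hunbl₀ : 0 ≤ ∑ b ∈ Finset.range n, unblockedBound p c r b :=
    Finset.sum_nonneg fun b _ => unblockedBound_nonneg p c r b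
  have hfactor : ∑ a ∈ Finset.range n, ∑ b ∈ Finset.range n, nearTestBound p c r a b =
      4 / 2 ^ (r - 1) * (p * ∑ a ∈ Finset.range n, a * survivalBound p c a +
        ∑ a ∈ Finset.range n, survivalBound p c a) *
          ∑ b ∈ Finset.range n, unblockedBound p c r b := by
    rw [Finset.mul_sum (a := (p : ℝ)), ← Finset.sum_add_distrib,
      Finset.mul_sum (a := (4 / 2 ^ (r - 1) : ℝ)), Finset.sum_mul_sum]
    refine Finset.sum_congr rfl fun a _ => Finset.sum_congr rfl fun b _ => ?_
    rw [nearTestBound]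
    ring
  have h2c : (1 : ℝ) ≤ 2 ^ c := one_le_pow₀ (by norm_num)
  obtain ⟨r, rfl⟩ := Nat.exists_eq_add_of_le' hr
  rw [hfactor, Nat.add_sub_cancel]
  calc _ ≤ (p : ℝ) ^ 2 * (4 / 2 ^ r * (p * (432 * survivalScale p c ^ 2) + 432 * survivalScale p c)
        * (32 * (2 ^ c) ^ 4 * targetSize p (r + 1))) := by gcongr
    _ = 442368 * (2 ^ c) ^ 5 * (4 * 2 ^ c + 1) := by
        rw [survivalScale, targetSize, pow_succ]
        field_simp
        ring
    _ ≤ 442368 * (2 ^ c) ^ 5 * (4 * 2 ^ c + 2 ^ c) := by gcongr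
    _ = _ := by ring

theorem sum_farTestBound_le (hp : 0 < p) (hr : 1 ≤ r) (c n : ℕ) :
    (p : ℝ) ^ 2 * ∑ a ∈ Finset.range n, ∑ b ∈ Finset.range n, farTestBound p c r a b ≤
      1024 * (2 ^ c) ^ 4 := by
  have hp' : (0 : ℝ) < p := hp
  have hsize := targetSize_pos hp r
  have hratio := sum_ratio_sq_le (one_le_two.trans (two_le_targetSize hp hr)) n
  have hratio₀ : 0 ≤ ∑ b ∈ Finset.range n, (targetSize p r / (targetSize p r + b)) ^ 2 :=
    Finset.sum_nonneg fun b _ => sq_nonneg _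
  simp only [farTestBound, ← Finset.mul_sum]
  rw [← Finset.sum_mul]
  calc _ ≤ (p : ℝ) ^ 2 * (64 * (2 ^ c) ^ 4 * (targetSize p 1 / targetSize p r) ^ 2 *
        ((2 * targetSize p r) * (2 * targetSize p r))) := by gcongr
    _ = 256 * (2 ^ c) ^ 4 * (p * targetSize p 1) ^ 2 := by
        field_simp
        ring
    _ = _ := by
        rw [targetSize]
        field_simp
        norm_num

theorem sum_searchBound_le (hp : 0 < p) (hr : 1 ≤ r) (c n : ℕ) :
    ∑ a ∈ Finset.range n, ∑ b ∈ Finset.range n, searchBound p c r a b ≤ 2219904 * (2 ^ c) ^ 6 := by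
  have h2c : (1 : ℝ) ≤ 2 ^ c := one_le_pow₀ (by norm_num)
  have hpow₂ : ((2 : ℝ) ^ c) ^ 2 ≤ (2 ^ c) ^ 6 := pow_le_pow_right₀ h2c (by norm_num)
  have hpow₄ : ((2 : ℝ) ^ c) ^ 4 ≤ (2 ^ c) ^ 6 := pow_le_pow_right₀ h2c (by norm_num)
  have hearlier := sum_earlierTestBound_le hp c n
  have hnear := sum_nearTestBound_le hp hr c n
  have hfar := sum_farTestBound_le hp hr c n
  simp only [searchBound, ← Finset.mul_sum, Finset.sum_add_distrib, mul_add]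
  linarith

end SearchSum

section SearchTest

variable {n : ℕ}

open Classical in
theorem card_searchTest_le (x : Equiv.Perm (Fin n)) (ℓ : ℕ) (y u : Fin n) :
    (Finset.univ.filter fun a : Fin n × Fin n => SearchTest x ℓ a.1 y u a.2).card ≤ 2 := by
  have hlast : (Finset.univ.filter fun y₀ => pos x y₀ + 1 = ℓ).card ≤ 1 :=
    Finset.card_le_one.2 fun a ha b hb => pos_injective x (by
      simp only [Finset.mem_filter, Finset.mem_univ, true_and] at ha hb
      omega)
  have hnext : (Finset.univ.filter fun z => pos x z = ℓ).card ≤ 1 :=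
    Finset.card_le_one.2 fun a ha b hb => pos_injective x (by
      simp only [Finset.mem_filter, Finset.mem_univ, true_and] at ha hb
      omega)
  have hsub : (Finset.univ.filter fun a : Fin n × Fin n => SearchTest x ℓ a.1 y u a.2) ⊆
      (Finset.univ.filter fun y₀ => pos x y₀ + 1 = ℓ) ×ˢ
        insert y (Finset.univ.filter fun z => pos x z = ℓ) := by
    intro a ha
    obtain ⟨hy₀, -, -, -, -, hz, -⟩ := (Finset.mem_filter.1 ha).2
    simpa [hy₀] using hz
  calc _ ≤ _ := Finset.card_le_card hsub
    _ ≤ 1 * (1 + 1) := by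
      rw [Finset.card_product]
      exact Nat.mul_le_mul hlast ((Finset.card_insert_le _ _).trans (Nat.succ_le_succ hnext))

open Classical in
theorem sum_searchTest_le (x : Equiv.Perm (Fin n)) (ℓ : ℕ) {g : ℕ → ℕ → ℝ}
    (hg : ∀ a b, 0 ≤ g a b) :
    ∑ a : (Fin n × Fin n) × (Fin n × Fin n) with SearchTest x ℓ a.2.1 a.1.1 a.1.2 a.2.2,
        g (pos x a.1.1 - ℓ) (pos x a.1.2 - ℓ) ≤
      2 * ∑ a ∈ Finset.range n, ∑ b ∈ Finset.range n, g a b := by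
  rw [Finset.sum_filter, Fintype.sum_prod_type]
  calc _ ≤ ∑ yu : Fin n × Fin n, if ℓ ≤ pos x yu.1 ∧ ℓ ≤ pos x yu.2 then
        2 * g (pos x yu.1 - ℓ) (pos x yu.2 - ℓ) else 0 := by
        refine Finset.sum_le_sum fun yu _ => ?_
        dsimp only
        rw [← Finset.sum_filter, Finset.sum_const, nsmul_eq_mul]
        split_ifs with hℓ
        · exact mul_le_mul_of_nonneg_right (by exact_mod_cast card_searchTest_le x ℓ yu.1 yu.2)
            (hg _ _)
        · rw [Finset.filter_eq_empty_iff.2 fun a _ hT => hℓ ⟨hT.lt_pos.le, hT.le_pos⟩,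
            Finset.card_empty, Nat.cast_zero, zero_mul]
    _ = 2 * ∑ y with ℓ ≤ pos x y, ∑ u with ℓ ≤ pos x u, g (pos x y - ℓ) (pos x u - ℓ) := by
        rw [← Finset.sum_filter, ← Finset.mul_sum, ← Finset.sum_product',
          ← Finset.filter_product, Finset.univ_product_univ]
    _ ≤ 2 * ∑ y with ℓ ≤ pos x y, ∑ b ∈ Finset.range n, g (pos x y - ℓ) b := by
        gcongr with y
        exact sum_pos_le x ℓ (g (pos x y - ℓ)) (hg _)
    _ ≤ _ := by
        gcongr
        exact sum_pos_le x ℓ (fun a => ∑ b ∈ Finset.range n, g a b) fun a =>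
          Finset.sum_nonneg fun b _ => hg a b

end SearchTest

namespace PathModel

variable {n : ℕ} {Ω β : Type*} [MeasurableSpace Ω] {μ : Measure Ω} {Z : Sym2 (Fin n) → Ω → β}
  {x : Equiv.Perm (Fin n)} {adj : Ω → Fin n → Fin n → Bool} {E : Ω → ℕ → Fin n → Fin n → Bool}
  {q : ℕ} {p : unitInterval} {c ℓ r : ℕ} {R : ℕ → ℕ} {e : Sym2 (Fin n)}

theorem exists_searchTest_of_searchPair (M : PathModel μ Z x adj E q p) {ω : Ω}
    (he : e ∈ offPath x) (hpair : SearchPair x (adj ω) (E ω) q c R ℓ r e) :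
    ∃ y₀ y u z, SearchTest x ℓ y₀ y u z ∧ e = s(u, z) ∧
      SearchEvent x (adj ω) (E ω) q c R ℓ r y₀ y u z := by
  obtain ⟨y, ⟨hy, ⟨y₀, hy₀, hadj₀⟩, hunbl, hsurv⟩, u, z, rfl, hz, huy, hadj, hu, hunbl_u⟩ := hpair
  have huz : u ≠ z := by
    rintro rfl
    exact (M.valid ω).irrefl u hadj
  exact ⟨y₀, y, u, z, ⟨hy₀, hy, hu, huy, huz, hz, mem_offPath.1 he⟩, rfl,
    ⟨⟨hadj₀, hadj⟩, hunbl, hsurv, hunbl_u⟩⟩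

theorem pairMass_search_le [IsProbabilityMeasure μ] [DiscreteMeasurableSpace Ω]
    (M : PathModel μ Z x adj E q p) (hc : 8 ≤ c) (hR : RecentlyRebuilt p q R ℓ) (hr : 1 ≤ r) :
    pairMass μ x (fun ω => SearchPair x (adj ω) (E ω) q c R ℓ r) ≤ 4439808 * (2 ^ c) ^ 6 := by
  classical
  have hnonneg := searchBound_nonneg p c r
  calc _ ≤ ∑ a : (Fin n × Fin n) × (Fin n × Fin n) with SearchTest x ℓ a.2.1 a.1.1 a.1.2 a.2.2,
        searchBound p c r (pos x a.1.1 - ℓ) (pos x a.1.2 - ℓ) := by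
        refine pairMass_le (f := fun a => s(a.1.2, a.2.2))
          (A := fun a ω => SearchEvent x (adj ω) (E ω) q c R ℓ r a.2.1 a.1.1 a.1.2 a.2.2)
          ?_ (fun a _ => hnonneg _ _) fun a ha _ =>
            M.prob_search_le hc hr hR (Finset.mem_filter.1 ha).2
        intro ω e he hpair
        obtain ⟨y₀, y, u, z, hT, rfl, hevent⟩ := M.exists_searchTest_of_searchPair he hpair
        exact ⟨((y, u), (y₀, z)), by simpa using hT, rfl, hevent⟩
    _ ≤ 2 * ∑ a ∈ Finset.range n, ∑ b ∈ Finset.range n, searchBound p c r a b :=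
        sum_searchTest_le x ℓ hnonneg
    _ ≤ 2 * (2219904 * (2 ^ c) ^ 6) := by
        gcongr
        exact sum_searchBound_le M.p_pos hr c n
    _ = _ := by ring

end PathModel

/-! ### The total cost -/

section PairMass

variable {n : ℕ} {Ω : Type*} [MeasurableSpace Ω] {μ : Measure Ω} {x : Equiv.Perm (Fin n)}

theorem pairMass_or_le (Q Q' : Ω → Sym2 (Fin n) → Prop) :
    pairMass μ x (fun ω e => Q ω e ∨ Q' ω e) ≤ pairMass μ x Q + pairMass μ x Q' := by
  unfold pairMass
  rw [← Finset.sum_add_distrib]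
  exact Finset.sum_le_sum fun e _ => measureReal_union_le _ _

theorem card_compl_offPath_le (x : Equiv.Perm (Fin n)) : (offPath x)ᶜ.card ≤ n := by
  classical
  have hsub : (offPath x)ᶜ ⊆ (Finset.univ.filter fun uv : Fin n × Fin n =>
      pos x uv.1 + 1 = pos x uv.2).image fun uv => s(uv.1, uv.2) := by
    intro e
    induction e using Sym2.ind with
    | _ u v =>
      rw [Finset.mem_compl, mem_offPath, not_not, hamPath_adj, Finset.mem_image]
      rintro (huv | hvu)
      · exact ⟨(u, v), by simpa using huv, rfl⟩
      · exact ⟨(v, u), by simpa using hvu, Sym2.eq_swap⟩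
  refine (Finset.card_le_card hsub).trans (Finset.card_image_le.trans ?_)
  conv_rhs => rw [← Fintype.card_fin n, ← Finset.card_univ]
  refine Finset.card_le_card_of_injOn Prod.fst (fun _ _ => Finset.mem_univ _) ?_
  rintro ⟨u, v⟩ hv ⟨u', v'⟩ hv' (rfl : u = u')
  simp only [Finset.coe_filter, Finset.mem_univ, true_and, Set.mem_ofPred_eq] at hv hv'
  rw [pos_injective x (hv.symm.trans hv')]

variable [IsProbabilityMeasure μ]

theorem pairMass_mono {Q Q' : Ω → Sym2 (Fin n) → Prop} (h : ∀ ω e, Q ω e → Q' ω e) :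
    pairMass μ x Q ≤ pairMass μ x Q' :=
  Finset.sum_le_sum fun e _ => measureReal_mono (fun ω => h ω e) (measure_ne_top _ _)

theorem pairMass_exists_le {ι : Type*} (I : Finset ι) (Q : ι → Ω → Sym2 (Fin n) → Prop) :
    pairMass μ x (fun ω e => ∃ a ∈ I, Q a ω e) ≤ ∑ a ∈ I, pairMass μ x (Q a) := by
  unfold pairMass
  rw [Finset.sum_comm]
  refine Finset.sum_le_sum fun e _ => ?_
  refine (measureReal_mono (fun ω hω => ?_) (measure_ne_top _ _)).trans
    (measureReal_biUnion_finset_le I fun a => {ω | Q a ω e})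
  obtain ⟨a, ha, hQ⟩ := hω
  simp only [Set.mem_iUnion]
  exact ⟨a, ha, hQ⟩

theorem pairMass_exists_le_card_mul {ι : Type*} {I : Finset ι}
    {Q : ι → Ω → Sym2 (Fin n) → Prop} {B : ℝ} (hQ : ∀ a ∈ I, pairMass μ x (Q a) ≤ B) :
    pairMass μ x (fun ω e => ∃ a ∈ I, Q a ω e) ≤ I.card * B :=
  (pairMass_exists_le I Q).trans
    ((Finset.sum_le_card_nsmul I _ B hQ).trans_eq (nsmul_eq_mul _ _))

theorem card_le_add_card_filter_offPath {A F : Finset (Sym2 (Fin n))} {Q : Sym2 (Fin n) → Prop}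
    [DecidablePred Q] (hA : ∀ e ∈ A, e ∈ F ∨ Q e) :
    A.card ≤ F.card + n + ((offPath x).filter Q).card := by
  classical
  have hsub : A ⊆ F ∪ (offPath x)ᶜ ∪ (offPath x).filter Q := by
    intro e he
    simp only [Finset.mem_union, Finset.mem_compl, Finset.mem_filter]
    have := hA e he
    tauto
  calc A.card ≤ _ := Finset.card_le_card hsub
    _ ≤ (F ∪ (offPath x)ᶜ).card + _ := Finset.card_union_le _ _
    _ ≤ F.card + (offPath x)ᶜ.card + _ := by gcongr; exact Finset.card_union_le _ _
    _ ≤ _ := by gcongr; exact card_compl_offPath_le x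

open Classical in
theorem integral_card_filter_offPath [Finite Ω] [MeasurableSingletonClass Ω]
    (Q : Ω → Sym2 (Fin n) → Prop) :
    ∫ ω, (((offPath x).filter (Q ω)).card : ℝ) ∂μ = pairMass μ x Q := by
  have hcard : ∀ ω, (((offPath x).filter (Q ω)).card : ℝ) =
      ∑ e ∈ offPath x, {ω | Q ω e}.indicator (1 : Ω → ℝ) ω := by
    intro ω
    rw [Finset.card_filter]
    push_cast
    exact Finset.sum_congr rfl fun e _ => by simp [Set.indicator_apply]
  simp only [hcard]
  rw [integral_finsetSum _ fun e _ => Integrable.of_finite]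
  exact Finset.sum_congr rfl fun e _ => integral_indicator_one (Set.toFinite _).measurableSet

theorem integral_card_le [Finite Ω] [MeasurableSingletonClass Ω] {A : Ω → Finset (Sym2 (Fin n))}
    {Q : Ω → Sym2 (Fin n) → Prop} {N : ℕ}
    (hA : ∀ ω, ∃ F : Finset (Sym2 (Fin n)), F.card ≤ N ∧ ∀ e ∈ A ω, e ∈ F ∨ Q ω e) :
    ∫ ω, ((A ω).card : ℝ) ∂μ ≤ N + n + pairMass μ x Q := by
  classical
  have hcard : ∀ ω, ((A ω).card : ℝ) ≤ N + n + ((offPath x).filter (Q ω)).card := by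
    intro ω
    obtain ⟨F, hF, hQ⟩ := hA ω
    exact_mod_cast (card_le_add_card_filter_offPath hQ).trans (by gcongr)
  refine (integral_mono Integrable.of_finite Integrable.of_finite hcard).trans_eq ?_
  rw [integral_add Integrable.of_finite Integrable.of_finite, integral_card_filter_offPath]
  simp

end PairMass

namespace PathModel

variable {n : ℕ} {Ω β : Type*} [MeasurableSpace Ω] {μ : Measure Ω} {Z : Sym2 (Fin n) → Ω → β}
  {x : Equiv.Perm (Fin n)} {adj : Ω → Fin n → Fin n → Bool} {E : Ω → ℕ → Fin n → Fin n → Bool}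
  {q c i ℓ : ℕ} {p : unitInterval} {R : ℕ → ℕ}

theorem reverse (M : PathModel μ Z x adj E q p) : PathModel μ Z (reverseOrder x) adj E q p where
  __ := M
  valid ω := (M.valid ω).reverse
  adj_eq := by
    rw [hamPath_reverseOrder]
    exact M.adj_eq
  E_le := by
    rw [hamPath_reverseOrder]
    exact M.E_le

variable [IsProbabilityMeasure μ] [DiscreteMeasurableSpace Ω]

theorem pairMass_rebuild_le_min (M : PathModel μ Z x adj E q p) (hc : 8 ≤ c)
    (hR : RecentlyRebuilt p q R ℓ) (hi : 1 ≤ i) (hiq : i ≤ q) :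
    pairMass μ x (fun ω => RebuildPair x (E ω) q c R ℓ i) ≤
      64 * (2 ^ c) ^ 6 * min (targetSize p i) n := by
  have hs := targetSize_pos M.p_pos i
  have h2c : (1 : ℝ) ≤ 2 ^ c := one_le_pow₀ (by norm_num)
  have hrebuild := M.pairMass_rebuild_le hc hR hi hiq
  have hic : 1 ≤ i + c := Nat.le_add_right_of_le hi
  rw [mul_min_of_nonneg _ _ (by positivity)]
  refine le_min (hrebuild.trans ?_) (hrebuild.trans ?_)
  · have := sum_mul_unblockedBound_le_sq M.p_pos hic c n
    calc _ ≤ 2 / targetSize p i * (32 * (2 ^ c) ^ 4 * targetSize p (i + c) ^ 2) := by gcongr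
      _ = _ := by
        rw [targetSize_add]
        field_simp
        ring
  · have := sum_mul_unblockedBound_le_mul M.p_pos hic c n
    calc _ ≤ 2 / targetSize p i * (32 * (2 ^ c) ^ 4 * (n * targetSize p (i + c))) := by gcongr
      _ = 64 * (2 ^ c) ^ 5 * n := by
        rw [targetSize_add]
        field_simp
        ring
      _ ≤ _ := by
        gcongr
        norm_num

theorem sum_pairMass_rebuild_le (M : PathModel μ Z x adj E q p) (hc : 8 ≤ c) {R : ℕ → ℕ → ℕ}
    (hR : ∀ ℓ, RecentlyRebuilt p q (R ℓ) ℓ) (hi : 1 ≤ i) (hiq : i ≤ q) :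
    ∑ ℓ ∈ insert 0 ((Finset.Icc 1 n).filter fun ℓ => i ≤ schedule q p ℓ),
        pairMass μ x (fun ω => RebuildPair x (E ω) q c (R ℓ) ℓ i) ≤
      (n + 1) * (2112 * (2 ^ c) ^ 6) := by
  have hs := targetSize_pos M.p_pos i
  have hcard := card_rebuild_le M.p_pos hi hiq n
  have hmass := fun ℓ => M.pairMass_rebuild_le_min hc (hR ℓ) hi hiq
  have hinit : pairMass μ x (fun ω => RebuildPair x (E ω) q c (R 0) 0 i) ≤
      64 * (2 ^ c) ^ 6 * (n + 1) :=
    (hmass 0).trans (by gcongr; exact (min_le_right _ _).trans (le_add_of_nonneg_right zero_le_one))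
  rw [Finset.sum_insert (by simp)]
  calc _ ≤ 64 * (2 ^ c) ^ 6 * ((n : ℝ) + 1) +
        32 * (n + 1) / targetSize p i * (64 * (2 ^ c) ^ 6 * targetSize p i) := by
        refine add_le_add hinit ((Finset.sum_le_card_nsmul _ _ (64 * (2 ^ c) ^ 6 * targetSize p i)
          fun ℓ _ => (hmass ℓ).trans ?_).trans ?_)
        · gcongr
          exact min_le_left _ _
        · rw [nsmul_eq_mul]
          gcongr
    _ = _ := by
        field_simp
        ring

theorem pairMass_rebuilds_le (M : PathModel μ Z x adj E q p) (hc : 8 ≤ c) {R : ℕ → ℕ → ℕ}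
    (hR : ∀ ℓ, RecentlyRebuilt p q (R ℓ) ℓ) :
    pairMass μ x (fun ω e => ∃ i ∈ Finset.Icc 1 q,
        ∃ ℓ ∈ insert 0 ((Finset.Icc 1 n).filter fun ℓ => i ≤ schedule q p ℓ),
          RebuildPair x (E ω) q c (R ℓ) ℓ i e) ≤ q * ((n + 1) * (2112 * (2 ^ c) ^ 6)) := by
  refine (pairMass_exists_le_card_mul fun i hi => ?_).trans_eq
    (by rw [Nat.card_Icc, Nat.add_sub_cancel])
  obtain ⟨hi, hiq⟩ := Finset.mem_Icc.1 hi
  exact (pairMass_exists_le _ fun ℓ ω => RebuildPair x (E ω) q c (R ℓ) ℓ i).trans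
    (M.sum_pairMass_rebuild_le hc hR hi hiq)

theorem pairMass_advances_le (M : PathModel μ Z x adj E q p) (hc : 8 ≤ c) {R : ℕ → ℕ → ℕ}
    (hR : ∀ ℓ, RecentlyRebuilt p q (R ℓ) ℓ) :
    pairMass μ x (fun ω e => ∃ i ∈ Finset.Icc 1 q, ∃ ℓ ∈ Finset.range (n + 1),
      AdvancePair x (E ω) q c (R ℓ) ℓ i e) ≤ q * ((n + 1) * (640 * (2 ^ c) ^ 6)) := by
  refine (pairMass_exists_le_card_mul fun i hi => ?_).trans_eq
    (by rw [Nat.card_Icc, Nat.add_sub_cancel])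
  obtain ⟨hi, hiq⟩ := Finset.mem_Icc.1 hi
  exact (pairMass_exists_le_card_mul fun ℓ _ => M.pairMass_advance_le hc (hR ℓ) hi hiq).trans_eq
    (by rw [Finset.card_range, Nat.cast_succ])

theorem pairMass_searches_le (M : PathModel μ Z x adj E q p) (hc : 8 ≤ c) {R : ℕ → ℕ → ℕ}
    (hR : ∀ ℓ, RecentlyRebuilt p q (R ℓ) ℓ) :
    pairMass μ x (fun ω e => ∃ r ∈ Finset.Icc 1 (q + 1), ∃ ℓ ∈ Finset.range (n + 1),
      SearchPair x (adj ω) (E ω) q c (R ℓ) ℓ r e) ≤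
        (q + 1) * ((n + 1) * (4439808 * (2 ^ c) ^ 6)) := by
  refine (pairMass_exists_le_card_mul fun r hr => ?_).trans_eq
    (by rw [Nat.card_Icc, Nat.add_sub_cancel, Nat.cast_succ])
  exact (pairMass_exists_le_card_mul fun ℓ _ =>
    M.pairMass_search_le hc (hR ℓ) (Finset.mem_Icc.1 hr).1).trans_eq
      (by rw [Finset.card_range, Nat.cast_succ])

theorem pairMass_comparedAt_le (M : PathModel μ Z x adj E q p) (hc : 8 ≤ c) :
    pairMass μ x (fun ω e => ∃ ℓ ≤ n, ComparedAt x (adj ω) (E ω) q c (schedule q p) ℓ e) ≤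
      (q + 1) * ((n + 1) * (4442560 * (2 ^ c) ^ 6)) := by
  set R : ℕ → ℕ → ℕ := fun ℓ => lastRebuild (schedule q p) (ℓ - 1)
  have hR : ∀ ℓ, RecentlyRebuilt p q (R ℓ) ℓ := recentlyRebuilt_lastRebuild M.p_pos q
  have hsplit : ∀ ω e, (∃ ℓ ≤ n, ComparedAt x (adj ω) (E ω) q c (schedule q p) ℓ e) →
      (∃ i ∈ Finset.Icc 1 q,
        ∃ ℓ ∈ insert 0 ((Finset.Icc 1 n).filter fun ℓ => i ≤ schedule q p ℓ),
          RebuildPair x (E ω) q c (R ℓ) ℓ i e) ∨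
      (∃ i ∈ Finset.Icc 1 q, ∃ ℓ ∈ Finset.range (n + 1),
        AdvancePair x (E ω) q c (R ℓ) ℓ i e) ∨
      ∃ r ∈ Finset.Icc 1 (q + 1), ∃ ℓ ∈ Finset.range (n + 1),
        SearchPair x (adj ω) (E ω) q c (R ℓ) ℓ r e := by
    simp only [Finset.mem_Icc, Finset.mem_insert, Finset.mem_filter, Finset.mem_range_succ_iff]
    rintro ω e ⟨ℓ, hℓ, ⟨i, hi, hiq, hsched, hpair⟩ | ⟨i, hi, hiq, hpair⟩ | ⟨r, hr, hrq, hpair⟩⟩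
    · exact .inl ⟨i, ⟨hi, hiq⟩, ℓ, by omega, hpair⟩
    · exact .inr (.inl ⟨i, ⟨hi, hiq⟩, ℓ, hℓ, hpair⟩)
    · exact .inr (.inr ⟨r, ⟨hr, hrq⟩, ℓ, hℓ, hpair⟩)
  calc _ ≤ _ := pairMass_mono hsplit
    _ ≤ _ := (pairMass_or_le _ _).trans (add_le_add_right (pairMass_or_le _ _) _)
    _ ≤ (q : ℝ) * ((n + 1) * (2112 * (2 ^ c) ^ 6)) + (q * ((n + 1) * (640 * (2 ^ c) ^ 6)) +
        (q + 1) * ((n + 1) * (4439808 * (2 ^ c) ^ 6))) :=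
      add_le_add (M.pairMass_rebuilds_le hc hR)
        (add_le_add (M.pairMass_advances_le hc hR) (M.pairMass_searches_le hc hR))
    _ ≤ ((q : ℝ) + 1) * ((n + 1) * (2112 * (2 ^ c) ^ 6)) +
        ((q + 1) * ((n + 1) * (640 * (2 ^ c) ^ 6)) +
        (q + 1) * ((n + 1) * (4439808 * (2 ^ c) ^ 6))) := by
      gcongr <;> exact le_add_of_nonneg_right zero_le_one
    _ = _ := by ring

variable [Finite Ω]

theorem integral_card_asked_sortPrefix_le (M : PathModel μ Z x adj E q p) (hc : 8 ≤ c) {m : ℕ}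
    (hm : m ≤ n) :
    ∫ ω, (((sortPrefix (adj ω) (E ω) q c (schedule q p) m).asked (precedes x)).card : ℝ) ∂μ ≤
      2 * n + (q + 1) * ((n + 1) * (4442560 * (2 ^ c) ^ 6)) := by
  refine (integral_card_le fun ω => ?_).trans
    (add_le_add (two_mul _).ge (M.pairMass_comparedAt_le hc))
  obtain ⟨F, hF, -, hspec⟩ := sortPrefix_spec (M.valid ω) (show 1 ≤ c by omega) (schedule_le q p) hm
  exact ⟨F, hF, hspec.asked⟩

theorem integral_card_asked_sortAll_le (M : PathModel μ Z x adj E q p) (hc : 8 ≤ c) :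
    ∫ ω, (((sortAll (adj ω) (E ω) q c (schedule q p)).asked (precedes x)).card : ℝ) ∂μ ≤
      20000000 * (2 ^ c) ^ 6 * n * (q + 1) := by
  rcases Nat.eq_zero_or_pos n with rfl | hn
  · have hzero : ∀ ω,
        ((sortAll (adj ω) (E ω) q c (schedule q p)).asked (precedes x)).card = 0 := by
      intro ω
      rw [Finset.card_eq_zero, Finset.eq_empty_iff_forall_notMem]
      exact fun e => isEmptyElim e
    simp [hzero]
  have hfront := M.integral_card_asked_sortPrefix_le hc (m := (n + 1) / 2) (by omega)
  have hback := M.reverse.integral_card_asked_sortPrefix_le hc (m := n / 2) (by omega)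
  have hn' : (1 : ℝ) ≤ n := by exact_mod_cast hn
  have h2c : (1 : ℝ) ≤ (2 ^ c) ^ 6 := one_le_pow₀ (one_le_pow₀ (by norm_num))
  have hn_le : (n : ℝ) ≤ (q + 1) * (n * (2 ^ c) ^ 6) := by
    nlinarith [mul_le_mul_of_nonneg_left h2c (zero_le_one.trans hn'), Nat.cast_nonneg (α := ℝ) q]
  calc _ ≤ ∫ ω, ((((sortPrefix (adj ω) (E ω) q c (schedule q p) ((n + 1) / 2)).asked
          (precedes x)).card : ℝ) + ((sortPrefix (adj ω) (E ω) q c (schedule q p) (n / 2)).asked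
            (precedes (reverseOrder x))).card) ∂μ := by
        refine integral_mono Integrable.of_finite Integrable.of_finite fun ω => ?_
        simp only [asked_sortAll]
        exact_mod_cast Finset.card_union_le _ _
    _ ≤ 2 * (2 * n + (q + 1) * ((n + 1) * (4442560 * (2 ^ c) ^ 6))) := by
        rw [integral_add Integrable.of_finite Integrable.of_finite]
        linarith
    _ ≤ 2 * (2 * ((q + 1) * (n * (2 ^ c) ^ 6)) +
        (q + 1) * ((n + n) * (4442560 * (2 ^ c) ^ 6))) := by gcongr
    _ ≤ 20000000 * ((q + 1) * (n * (2 ^ c) ^ 6)) := by linarith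
    _ = _ := by ring

end PathModel

/-! ### The law of the input -/

open ProbabilityTheory unitInterval

section TupleLaw

variable {q : ℕ} {p : unitInterval}

theorem pi_bernoulliMeasure_exists (hq : 1 ≤ q) (p : unitInterval) :
    (Measure.pi fun i => bernoulliMeasure true false (setProb q p i)).real {t | ∃ i, t i = true} =
      p := by
  have hcompl : {t : Fin q → Bool | ∃ i, t i = true} = (Set.univ.pi fun _ => {false})ᶜ := by
    ext t
    simp [Set.mem_pi]
  have hnone : (Measure.pi fun i => bernoulliMeasure true false (setProb q p i)).real
      (Set.univ.pi fun _ => {false}) = 1 - (p : ℝ) := by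
    rw [← prod_alpha hq p, measureReal_def, Measure.pi_pi, ENNReal.toReal_prod]
    refine Finset.prod_congr rfl fun i _ => ?_
    rw [← measureReal_def, bernoulliMeasure_real_apply _ (Set.toFinite _).measurableSet]
    simp [setProb]
  rw [hcompl, probReal_compl_eq_one_sub (Set.toFinite _).measurableSet, hnone]
  ring

theorem isProbabilityMeasure_tupleLaw (hq : 1 ≤ q) (hp : 0 < p) :
    IsProbabilityMeasure (tupleLaw q p) := by
  refine cond_isProbabilityMeasure fun hzero => ?_
  have hp_eq := pi_bernoulliMeasure_exists hq p
  rw [measureReal_def, hzero, ENNReal.toReal_zero] at hp_eq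
  exact hp.ne (Subtype.ext hp_eq)

theorem tupleLaw_real_apply (hq : 1 ≤ q) (hp : 0 < p) (j : Fin q) :
    (tupleLaw q p).real {t | t j = true} = alpha q p / 2 ^ (j.val + 1) := by
  have hp' : (0 : ℝ) < p := hp
  have hinter : {t : Fin q → Bool | ∃ i, t i = true} ∩ {t | t j = true} =
      Function.eval j ⁻¹' ({true} : Set Bool) := by
    ext t
    exact ⟨fun ht => ht.2, fun ht => ⟨⟨j, ht⟩, ht⟩⟩
  have hsingle : (bernoulliMeasure true false (setProb q p j)).real {true} =
      alpha q p * p / 2 ^ (j.val + 1) := by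
    rw [bernoulliMeasure_real_apply _ (Set.toFinite _).measurableSet]
    simp [setProb]
  rw [tupleLaw, measureReal_def, cond_apply (Set.toFinite _).measurableSet, ENNReal.toReal_mul,
    ENNReal.toReal_inv, ← measureReal_def, ← measureReal_def, pi_bernoulliMeasure_exists hq p,
    hinter, (measurePreserving_eval _ j).measureReal_preimage
      (Set.toFinite _).measurableSet.nullMeasurableSet, hsingle]
  field_simp

end TupleLaw

section BinomialRandom

variable {n : ℕ} {p : unitInterval}

/-- The law of the event that the pair `e` is an edge of the binomial random graph; the diagonal
pairs of `Sym2` are never edges. -/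
noncomputable def edgeLaw (p : unitInterval) (e : Sym2 (Fin n)) : Measure Prop :=
  toNNReal p • Measure.dirac (¬ e.IsDiag) + toNNReal (σ p) • Measure.dirac False

instance (p : unitInterval) (e : Sym2 (Fin n)) : IsProbabilityMeasure (edgeLaw p e) :=
  ⟨by simp [edgeLaw]⟩

theorem map_binomialRandom_eq_pi (n : ℕ) (p : unitInterval) :
    (SimpleGraph.binomialRandom (Fin n) p).map (fun G e => e ∈ G.edgeSet) =
      Measure.pi (edgeLaw p) := by
  rw [SimpleGraph.binomialRandom_eq_map, Measure.map_map (by fun_prop) (by fun_prop)]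
  have hae : (fun (G : SimpleGraph (Fin n)) e => e ∈ G.edgeSet) ∘ SimpleGraph.fromEdgeSet
      =ᵐ[setBernoulli Sym2.diagSetᶜ p] fun S e => e ∈ S := by
    filter_upwards [setBernoulli_ae_subset] with S hS
    funext e
    have := @hS e
    simp only [Set.mem_compl_iff, Sym2.mem_diagSet] at this
    simp only [Function.comp_apply, SimpleGraph.edgeSet_fromEdgeSet, Set.mem_sdiff,
      Sym2.mem_diagSet, eq_iff_iff]
    tauto
  rw [Measure.map_congr hae, setBernoulli_eq_map, Measure.map_map (by fun_prop) (by fun_prop),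
    Measure.infinitePi_eq_pi]
  exact Measure.map_id

instance (n : ℕ) : DiscreteMeasurableSpace (SimpleGraph (Fin n)) where
  forall_measurableSet s := by
    rw [← SimpleGraph.edgeSet_injective.preimage_image s]
    exact SimpleGraph.measurable_edgeSet (Set.toFinite _).measurableSet

theorem binomialRandom_real_adj {u v : Fin n} (huv : u ≠ v) :
    (SimpleGraph.binomialRandom (Fin n) p).real {G | G.Adj u v} = p := by
  have hpre : {G : SimpleGraph (Fin n) | G.Adj u v} =
      (fun G e => e ∈ G.edgeSet) ⁻¹' (Function.eval s(u, v) ⁻¹' {True}) := by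
    ext G
    simp
  rw [hpre, ← map_measureReal_apply .of_discrete (Set.toFinite _).measurableSet,
    map_binomialRandom_eq_pi, (measurePreserving_eval (edgeLaw p) s(u, v)).measureReal_preimage
      (Set.toFinite _).measurableSet.nullMeasurableSet]
  simp [edgeLaw, measureReal_def, huv]

end BinomialRandom

section SampleLaw

/-- The probability space of the random graph and the random choices of the algorithm. -/
abbrev Sample (n q : ℕ) : Type := SimpleGraph (Fin n) × (Sym2 (Fin n) → Fin q → Bool)

/-- The joint law of the random graph and the random choices of the algorithm. -/
noncomputable def sampleLaw (n q : ℕ) (p : unitInterval) : Measure (Sample n q) :=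
  (SimpleGraph.binomialRandom (Fin n) p).prod (coinLaw n q p)

/-- Everything that is random at the vertex pair `e`: whether it is an edge of the random graph, and
its tuple of indicators. -/
def pairData {n q : ℕ} (e : Sym2 (Fin n)) (ω : Sample n q) : Prop × (Fin q → Bool) :=
  (e ∈ ω.1.edgeSet, ω.2 e)

variable {n q : ℕ} {p : unitInterval}

theorem isProbabilityMeasure_coinLaw (hq : 1 ≤ q) (hp : 0 < p) :
    IsProbabilityMeasure (coinLaw n q p) := by
  have := isProbabilityMeasure_tupleLaw hq hp
  unfold coinLaw
  infer_instance

theorem isProbabilityMeasure_sampleLaw (hq : 1 ≤ q) (hp : 0 < p) :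
    IsProbabilityMeasure (sampleLaw n q p) := by
  have := isProbabilityMeasure_coinLaw (n := n) hq hp
  unfold sampleLaw
  infer_instance

theorem map_pairData_sampleLaw (hq : 1 ≤ q) (hp : 0 < p) :
    (sampleLaw n q p).map (fun ω e => pairData e ω) =
      Measure.pi fun e => (edgeLaw p e).prod (tupleLaw q p) := by
  have := isProbabilityMeasure_tupleLaw hq hp
  have := isProbabilityMeasure_coinLaw (n := n) hq hp
  refine Measure.ext_of_singleton fun z => ?_
  have hpre : (fun (ω : Sample n q) e => pairData e ω) ⁻¹' {z} =
      ((fun (G : SimpleGraph (Fin n)) e => e ∈ G.edgeSet) ⁻¹' {fun e => (z e).1}) ×ˢ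
        {fun e => (z e).2} := by
    ext ω
    simp [pairData, funext_iff, Prod.ext_iff, forall_and]
  rw [Measure.map_apply .of_discrete (Set.toFinite _).measurableSet, Measure.pi_singleton, hpre,
    sampleLaw, Measure.prod_prod, ← Measure.map_apply .of_discrete (Set.toFinite _).measurableSet,
    map_binomialRandom_eq_pi, coinLaw, Measure.pi_singleton, Measure.pi_singleton,
    ← Finset.prod_mul_distrib]
  refine Finset.prod_congr rfl fun e _ => ?_
  rw [← Measure.prod_prod, Set.singleton_prod_singleton]

theorem iIndepFun_pairData (hq : 1 ≤ q) (hp : 0 < p) :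
    iIndepFun (pairData (n := n) (q := q)) (sampleLaw n q p) := by
  have := isProbabilityMeasure_tupleLaw hq hp
  have := isProbabilityMeasure_sampleLaw (n := n) hq hp
  have hmap := map_pairData_sampleLaw (n := n) hq hp
  rw [iIndepFun_iff_map_fun_eq_pi_map fun e => Measurable.of_discrete.aemeasurable, hmap]
  congr 1
  funext e
  rw [← (measurePreserving_eval (fun e => (edgeLaw p e).prod (tupleLaw q p)) e).map_eq, ← hmap,
    Measure.map_map .of_discrete .of_discrete]
  rfl

theorem sampleLaw_real_and_of_determinedBy (hq : 1 ≤ q) (hp : 0 < p) {S T : Set (Sym2 (Fin n))}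
    {A B : Sample n q → Prop} (hST : Disjoint S T) (hA : DeterminedBy pairData S A)
    (hB : DeterminedBy pairData T B) :
    (sampleLaw n q p).real {ω | A ω ∧ B ω} =
      (sampleLaw n q p).real {ω | A ω} * (sampleLaw n q p).real {ω | B ω} := by
  classical
  have hindep := (iIndepFun_pairData (n := n) hq hp).indepFun_finset S.toFinset T.toFinset
    (by simpa using hST) fun e => .of_discrete
  have preimage_image : ∀ {U : Set (Sym2 (Fin n))} {C : Sample n q → Prop},
      DeterminedBy pairData U C →
        (fun ω (e : U.toFinset) => pairData (e : Sym2 (Fin n)) ω) ⁻¹'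
          ((fun ω (e : U.toFinset) => pairData (e : Sym2 (Fin n)) ω) '' {ω | C ω}) =
            {ω | C ω} := by
    intro U C hC
    refine (Set.subset_preimage_image _ _).antisymm' ?_
    rintro ω ⟨ω', hω', hdata⟩
    exact (hC ω' ω fun e he => congrFun hdata ⟨e, by simpa using he⟩).1 hω'
  have hprod := hindep.measure_inter_preimage_eq_mul _ _
    (Set.toFinite ((fun ω (e : S.toFinset) =>
      pairData (e : Sym2 (Fin n)) ω) '' {ω | A ω})).measurableSet
    (Set.toFinite ((fun ω (e : T.toFinset) =>
      pairData (e : Sym2 (Fin n)) ω) '' {ω | B ω})).measurableSet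
  rw [preimage_image hA, preimage_image hB] at hprod
  simp only [measureReal_def]
  rw [← ENNReal.toReal_mul, ← hprod]
  rfl

theorem coinLaw_real_apply (hq : 1 ≤ q) (hp : 0 < p) (e : Sym2 (Fin n)) (j : Fin q) :
    (coinLaw n q p).real {T | T e j = true} = alpha q p / 2 ^ (j.val + 1) := by
  have := isProbabilityMeasure_tupleLaw hq hp
  rw [← tupleLaw_real_apply hq hp j, coinLaw,
    ← (measurePreserving_eval (fun _ : Sym2 (Fin n) => tupleLaw q p) e).measureReal_preimage
      (Set.toFinite _).measurableSet.nullMeasurableSet]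
  rfl

theorem sampleLaw_real_adj (hq : 1 ≤ q) (hp : 0 < p) {u v : Fin n} (huv : u ≠ v) :
    (sampleLaw n q p).real {ω | ω.1.Adj u v} = p := by
  have := isProbabilityMeasure_coinLaw (n := n) hq hp
  rw [← binomialRandom_real_adj huv, show {ω : Sample n q | ω.1.Adj u v} =
    {G | G.Adj u v} ×ˢ Set.univ by ext; simp, sampleLaw, measureReal_prod_prod, probReal_univ,
    mul_one]

theorem sampleLaw_real_tuple (hq : 1 ≤ q) (hp : 0 < p) (e : Sym2 (Fin n)) (j : Fin q) :
    (sampleLaw n q p).real {ω | ω.2 e j = true} = alpha q p / 2 ^ (j.val + 1) := by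
  have := isProbabilityMeasure_coinLaw (n := n) hq hp
  rw [← coinLaw_real_apply hq hp e j, show {ω : Sample n q | ω.2 e j = true} =
    Set.univ ×ˢ {T | T e j = true} by ext; simp, sampleLaw, measureReal_prod_prod, probReal_univ,
    one_mul]

theorem sampleLaw_real_adj_and_tuple (hq : 1 ≤ q) (hp : 0 < p) {u v : Fin n} (huv : u ≠ v)
    (j : Fin q) :
    (sampleLaw n q p).real {ω | ω.1.Adj u v ∧ ω.2 s(u, v) j = true} =
      p * (alpha q p / 2 ^ (j.val + 1)) := by
  have := isProbabilityMeasure_coinLaw (n := n) hq hp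
  rw [← coinLaw_real_apply hq hp s(u, v) j, ← binomialRandom_real_adj huv,
    show {ω : Sample n q | ω.1.Adj u v ∧ ω.2 s(u, v) j = true} =
    {G | G.Adj u v} ×ˢ {T | T s(u, v) j = true} by ext; simp, sampleLaw, measureReal_prod_prod]

end SampleLaw

section PathModel

variable {n q : ℕ} {p : unitInterval} {x : Equiv.Perm (Fin n)} {u v : Fin n}

theorem edgeSets_succ_eq_true {G : SimpleGraph (Fin n)} {T : Sym2 (Fin n) → Fin q → Bool}
    (j : Fin q) : edgeSets G T (j.val + 1) u v = true ↔ G.Adj u v ∧ T s(u, v) j = true := by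
  simp [edgeSets, Fin.val_inj]

theorem edgeSets_comm (G : SimpleGraph (Fin n)) (T : Sym2 (Fin n) → Fin q → Bool) (k : ℕ)
    (u v : Fin n) : edgeSets G T k u v = edgeSets G T k v u := by
  rw [Bool.eq_iff_iff]
  simp only [edgeSets, decide_eq_true_eq, SimpleGraph.adj_comm _ u v, Sym2.eq_swap (a := u)]

theorem determinedBy_adj (H : SimpleGraph (Fin n)) (u v : Fin n) :
    DeterminedBy (pairData (q := q)) {s(u, v)} fun ω => (ω.1 ⊔ H).Adj u v := by
  intro ω ω' hω
  have hadj := congrArg Prod.fst (hω s(u, v) rfl)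
  simp only [pairData, SimpleGraph.mem_edgeSet] at hadj
  simp only [SimpleGraph.sup_adj, hadj]

theorem determinedBy_edgeSets (H : SimpleGraph (Fin n)) (k : ℕ) (u v : Fin n) :
    DeterminedBy (pairData (q := q)) {s(u, v)} fun ω =>
      edgeSets (ω.1 ⊔ H) ω.2 k u v = true := by
  simp only [edgeSets, decide_eq_true_eq]
  refine (determinedBy_adj H u v).and
    (DeterminedBy.ex fun j => DeterminedBy.const_and fun _ ω ω' hω => ?_)
  have htuple := congrArg Prod.snd (hω s(u, v) rfl)
  simp only [pairData] at htuple
  simp only [htuple]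

theorem sampleLaw_real_edgeSets_of_not_adj (hq : 1 ≤ q) (hp : 0 < p) {H : SimpleGraph (Fin n)}
    (huv : u ≠ v) (hH : ¬ H.Adj u v) (j : Fin q) :
    (sampleLaw n q p).real {ω | edgeSets (ω.1 ⊔ H) ω.2 (j.val + 1) u v = true} =
      p * (alpha q p / 2 ^ (j.val + 1)) := by
  rw [← sampleLaw_real_adj_and_tuple hq hp huv j]
  simp only [edgeSets_succ_eq_true, SimpleGraph.sup_adj, hH, or_false]

theorem sampleLaw_real_edgeSets_of_adj (hq : 1 ≤ q) (hp : 0 < p) {H : SimpleGraph (Fin n)}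
    (hH : H.Adj u v) (j : Fin q) :
    (sampleLaw n q p).real {ω | edgeSets (ω.1 ⊔ H) ω.2 (j.val + 1) u v = true} =
      alpha q p / 2 ^ (j.val + 1) := by
  rw [← sampleLaw_real_tuple hq hp s(u, v) j]
  simp only [edgeSets_succ_eq_true, SimpleGraph.sup_adj, hH, or_true, true_and]

theorem sampleLaw_real_edgeSets_mem_Icc (hq : 1 ≤ q) (hp : 0 < p) {H : SimpleGraph (Fin n)}
    (huv : u ≠ v) (j : Fin q) :
    (sampleLaw n q p).real {ω | edgeSets (ω.1 ⊔ H) ω.2 (j.val + 1) u v = true} ∈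
      Set.Icc ((p : ℝ) / 2 ^ (j.val + 1)) (2 / 2 ^ (j.val + 1)) := by
  have hp₀ : (0 : ℝ) ≤ p := p.2.1
  have hp₁ : (p : ℝ) ≤ 1 := p.2.2
  obtain ⟨one_le_alpha, alpha_le_two⟩ := alpha_mem q p
  by_cases hH : H.Adj u v
  · rw [sampleLaw_real_edgeSets_of_adj hq hp hH]
    exact ⟨by gcongr; exact hp₁.trans one_le_alpha, by gcongr⟩
  · rw [sampleLaw_real_edgeSets_of_not_adj hq hp huv hH, mul_div_assoc']
    exact ⟨by gcongr; exact le_mul_of_one_le_right hp₀ one_le_alpha,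
      by gcongr; exact (mul_le_of_le_one_left (by linarith) hp₁).trans alpha_le_two⟩

theorem pathModel_sampleLaw (hp : 0 < p) (x : Equiv.Perm (Fin n)) :
    PathModel (sampleLaw n (numSets n p) p) pairData x
      (fun ω u v => @decide ((ω.1 ⊔ hamPath x).Adj u v) (Classical.propDecidable _))
      (fun ω => edgeSets (ω.1 ⊔ hamPath x) ω.2) (numSets n p) p := by
  have hq := one_le_numSets n p
  have exists_index : ∀ {k}, 1 ≤ k → k ≤ numSets n p → ∃ j : Fin (numSets n p), k = j.val + 1 :=
    fun {k} hk hkq => ⟨⟨k - 1, by omega⟩, by simp only; omega⟩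
  exact
  { p_pos := hp
    n_le := le_targetSize_numSets hp n
    valid := fun ω => validInput ω.2 le_sup_right
    E_symm := fun ω k u v => edgeSets_comm _ _ k u v
    indep := fun S T A B hST hA hB => sampleLaw_real_and_of_determinedBy hq hp hST hA hB
    adj_det := fun u v => by simpa only [decide_eq_true_eq] using determinedBy_adj (hamPath x) u v
    E_det := determinedBy_edgeSets (hamPath x)
    adj_eq := fun u v huv hpath => by
      simpa only [decide_eq_true_eq, SimpleGraph.sup_adj, hpath, or_false]
        using sampleLaw_real_adj hq hp huv
    E_le := fun k u v hk hkq huv hpath => by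
      obtain ⟨j, rfl⟩ := exists_index hk hkq
      rw [sampleLaw_real_edgeSets_of_not_adj hq hp huv hpath, mul_div_assoc', mul_comm]
      gcongr
      · exact p.2.1
      · exact (alpha_mem _ p).2
    E_le' := fun k u v hk hkq huv => by
      obtain ⟨j, rfl⟩ := exists_index hk hkq
      exact (sampleLaw_real_edgeSets_mem_Icc hq hp huv j).2
    le_E := fun k u v hk hkq huv => by
      obtain ⟨j, rfl⟩ := exists_index hk hkq
      exact (sampleLaw_real_edgeSets_mem_Icc hq hp huv j).1 }

end PathModel

end StochSort

open StochSort in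
theorem theorem3 :
    ∃ c₀ : ℕ, ∀ c : ℕ, c₀ ≤ c → ∃ K : ℝ, ∀ (n : ℕ) (p : unitInterval), 0 < p →
      ∀ x : Equiv.Perm (Fin n),
        (∀ (G : SimpleGraph (Fin n)) (T : Sym2 (Fin n) → Fin (numSets n p) → Bool),
          hamPath x ≤ G →
            (stochasticSort c p G T).output (precedes x) = List.ofFn x ∧
            ∀ e ∈ (stochasticSort c p G T).asked (precedes x), e ∈ G.edgeSet) ∧
        expectedComparisons c n p x ≤ K * (n * max 1 (Real.log (p * n))) := by
  refine ⟨8, fun c hc => ⟨20000000 * (2 ^ c) ^ 6 * 4, fun n p hp x =>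
    ⟨fun G T hG => stochasticSort_correct (by omega) T hG, ?_⟩⟩⟩
  have := isProbabilityMeasure_sampleLaw (n := n) (one_le_numSets n p) hp
  have := numSets_add_one_le (p := p) n
  calc expectedComparisons c n p x
      ≤ 20000000 * (2 ^ c) ^ 6 * n * (numSets n p + 1) :=
        (pathModel_sampleLaw hp x).integral_card_asked_sortAll_le hc
    _ ≤ 20000000 * (2 ^ c) ^ 6 * n * (4 * max 1 (Real.log (p * n))) := by gcongr
    _ = _ := by ring
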